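/- Let $d\ge 1$, let $\mathbb T^d=\mathbb R^d/\mathbb Z^d$ be equipped with Lebesgue measure, and let $\mathbb E$ be $(0,\infty)$ or $[0,\infty)$. Let $\mathcal M_{ac}(\mathbb T^d)$ be the set of finite positive measures on $\mathbb T^d$ that are absolutely continuous with respect to Lebesgue measure; for an integrable $m\ge 0$, write $\mathbf m$ for the measure with density $m$. Let $h:\mathcal M_{ac}(\mathbb T^d)\to C(\mathbb T^d)$, let $g:\mathbb T^d\times\mathbb E\times\mathbb R\to\mathbb R$ be continuous, and let $H:\mathbb T^d\times\mathbb R^d\times\mathbb R^{d\times d}\times\mathbb E\times\mathbb R\to\mathbb R$, $(x,p,M,m,\theta)\mapsto H(x,p,M,m,\theta)$. Below, $H$, $D_pH$, $D_{M_{ij}}H$ inside an equation or integral are evaluated at $(x,Du(x),D^2u(x),m(x),h(\mathbf m)(x))$, similarly for $g,g_1,g_2$ at $(x,m(x),h(\mathbf m)(x))$; repeated indices are summed; densities $m$ in (g) and (H1) are those with values in $\mathbb E$ almost everywhere; and, except for the integrability of $g_2$, which is part of (g)(ii), integral conditions are imposed whenever the integrals in them exist and are finite. Assume: * **(h)** For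 every integer $\kappa>\frac d2+1$: $h(\mathbf m)\in W^{\kappa,2}(\mathbb T^d)$ for every nonnegative $m\in W^{\kappa,2}(\mathbb T^d)$, and $m\mapsto h(\mathbf m)$ is Fréchet differentiable, with respect to the $W^{\kappa,2}$ norms, on the cone of nonnegative elements of $W^{\kappa,2}(\mathbb T^d)$. * **(g)** There are functions $g_1,g_2:\mathbb T^d\times\mathbb E\times\mathbb R\to\mathbb R$ with $g=g_1+g_2$ such that, for all densities $m$ of measures in $\mathcal M_{ac}(\mathbb T^d)$: (i) $g_2(x,m(x),h(\mathbf m)(x))\ge 0$ for a.e. $x$; (ii) $g_2(\cdot,m,h(\mathbf m))$ is integrable and $\int_{\mathbb T^d} g_2\,dx\le c\,(1+\int_{\mathbb T^d} m\,dx)$, with a constant $c>0$ independent of $m$; (iii) for every $\delta>0$ there is $C_\delta>0$, independent of $m$, with $\max\{\int_{\mathbb T^d} g_1\,dx,\int_{\mathbb T^d} m\,dx\}\le\delta\int_{\mathbb T^d} m g_1\,dx+C_\delta$; (iv) $\int_{\mathbb T^d} m g_1\,dx\ge -R$ with a constant $R\ge 0$ independent of $m$. * **(H1)** There are constants $\gamma>1$,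 $0\le\tau<1$ and $C_1,C_2,C_3,C_4>0$ such that: (a) for all $x\in\mathbb T^d$, $p\in\mathbb R^d$, symmetric $M\in\mathbb R^{d\times d}$, $m\in\mathbb E$, $\theta\in\mathbb R$, $$-H+D_pH\cdot p+D_MH:M\ \ge\ \tfrac1{C_1}m^{-\tau}|p|^\gamma+C_2\,g(x,m,\theta)-C_1;$$ (b) for all densities $m$ of measures in $\mathcal M_{ac}(\mathbb T^d)$ and all $u\in W^{1,\gamma}(\mathbb T^d)$ whose weak second derivatives are integrable functions, $$-C_3\!\int_{\mathbb T^d}\! g\,dx+\tfrac1{C_1}\!\int_{\mathbb T^d}\!|Du|^\gamma m^{-\tau}dx-C_1\le\int_{\mathbb T^d}\! H\,dx\le -C_4\!\int_{\mathbb T^d}\! g\,dx+C_1\Big(1+\int_{\mathbb T^d}\!|Du|^\gamma m^{-\tau}dx\Big).$$ * **(H2)** $H$ is of class $C^\infty$ on $\mathbb T^d\times\mathbb R^d\times\mathbb R^{d\times d}\times\mathbb E\times\mathbb R$. * **(H3)** The operator $$A\begin{bmatrix}m\\u\end{bmatrix}=\begin{bmatrix}-u-H\\ m-\operatorname{div}(mD_pH)+(mD_{M_{ij}}H)_{x_ix_j}-1\end{bmatrix}$$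 is monotone for the $L^2(\mathbb T^d)\times L^2(\mathbb T^d)$ inner product on $C^\infty(\mathbb T^d;\mathbb E)\times C^\infty(\mathbb T^d)$. Let $p\in\mathbb N$ with $2p-4>\frac d2+1$, let $q>d$, let $\epsilon_1,\epsilon_2\in(0,1)$, and let $\beta_{\epsilon_1}:(0,\infty)\to(-\infty,0]$ be a non-decreasing $C^\infty$ function with $\beta_{\epsilon_1}(s)=0$ for $s\ge\epsilon_1$ and $\beta_{\epsilon_1}(s)=-s^{-q}$ for $0<s\le\epsilon_1/2$. Then there exist $m,u\in C^\infty(\mathbb T^d)$ with $\inf_{\mathbb T^d}m>0$ such that, at every point of $\mathbb T^d$, $$\begin{cases}-u-H+\epsilon_1(m+\Delta^{2p}m)+\epsilon_2(m-\Delta m)+\beta_{\epsilon_1}(m)=0,\\ m-\operatorname{div}(mD_pH)+(mD_{M_{ij}}H)_{x_ix_j}-1+\epsilon_1(u+\Delta^{2p}u)+\epsilon_2(u-\Delta u)=0.\end{cases}$$ -/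

import Mathlib

open MeasureTheory
open scoped ContDiff

noncomputable section

namespace RegMFG

/-! ### Calculus on the flat torus -/

/-- The torus `ℝ^d / ℤ^d`, with its Lebesgue measure `volume` (of total mass one). -/
abbrev Torus (d : ℕ) : Type := UnitAddTorus (Fin d)

/-- The values of a gradient. -/
abbrev Vec (d : ℕ) : Type := EuclideanSpace ℝ (Fin d)

/-- Real `d × d` matrices, in the form of functions so that they are a normed space. -/
abbrev Mat (d : ℕ) : Type := Fin d → Fin d → ℝ

/-- The covering map `ℝ^d → ℝ^d / ℤ^d`. -/
def proj {d : ℕ} (y : Fin d → ℝ) : Torus d := fun i => (y i : UnitAddCircle)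

/-- `f ∈ C^∞(𝕋^d)`: the periodic lift of `f` to `ℝ^d` is of class `C^∞`. -/
def IsSmooth {d : ℕ} (f : Torus d → ℝ) : Prop :=
  ContDiff ℝ ∞ (fun y : Fin d → ℝ => f (proj y))

/-- The classical partial derivative `∂f/∂x_i` on the torus. -/
def pd {d : ℕ} (i : Fin d) (f : Torus d → ℝ) : Torus d → ℝ :=
  fun x => deriv (fun t : ℝ => f (x + Pi.single i (t : UnitAddCircle))) 0

/-- The gradient `Du`. -/
def grad {d : ℕ} (u : Torus d → ℝ) (x : Torus d) : Vec d :=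
  WithLp.toLp 2 (fun i => pd i u x)

/-- The Hessian `D²u`. -/
def hess {d : ℕ} (u : Torus d → ℝ) (x : Torus d) : Mat d :=
  fun i j => pd i (pd j u) x

/-- The Laplacian. -/
def lap {d : ℕ} (f : Torus d → ℝ) : Torus d → ℝ :=
  fun x => ∑ i, pd i (pd i f) x

lemma proj_add_single {d : ℕ} (y : Fin d → ℝ) (i : Fin d) (t : ℝ) :
    proj y + Pi.single i (t : UnitAddCircle) = proj (y + t • Pi.single i (1 : ℝ)) := by
  funext j
  by_cases hj : j = i
  · subst hj
    simp [proj]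
  · simp [proj, hj]

lemma continuous_proj {d : ℕ} : Continuous (proj (d := d)) :=
  continuous_pi fun i => (AddCircle.continuous_mk' (1 : ℝ)).comp (continuous_apply i)

lemma isQuotientMap_proj {d : ℕ} : Topology.IsQuotientMap (proj (d := d)) := by
  refine IsOpenMap.isQuotientMap ?_ continuous_proj ?_
  · refine IsOpenMap.piMap (f := fun _ : Fin d => ((↑) : ℝ → UnitAddCircle)) (fun i => ?_) ?_
    · exact QuotientAddGroup.isOpenMap_coe
    · exact Filter.Eventually.of_forall fun i => QuotientAddGroup.mk_surjective
  · intro x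
    choose y hy using fun i => QuotientAddGroup.mk_surjective (x i)
    exact ⟨y, funext hy⟩

lemma IsSmooth.continuous {d : ℕ} {f : Torus d → ℝ} (hf : IsSmooth f) : Continuous f :=
  isQuotientMap_proj.continuous_iff.2 (ContDiff.continuous hf)

lemma IsSmooth.pd {d : ℕ} {f : Torus d → ℝ} (hf : IsSmooth f) (i : Fin d) :
    IsSmooth (pd i f) := by
  have h1 : (fun y : Fin d → ℝ => RegMFG.pd i f (proj y)) =
      fun y => fderiv ℝ (fun y : Fin d → ℝ => f (proj y)) y (Pi.single i 1) := by
    funext y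
    have hd : DifferentiableAt ℝ (fun y : Fin d → ℝ => f (proj y)) y :=
      (ContDiff.differentiable hf (by simp)) y
    rw [← hd.lineDeriv_eq_fderiv]
    simp only [RegMFG.pd, lineDeriv, proj_add_single]
  unfold IsSmooth at hf ⊢
  rw [h1]
  exact (hf.fderiv_right (m := ∞) (by simp)).clm_apply contDiff_const

/-! ### Sobolev spaces on the torus -/

/-- `g` is the weak partial derivative of `f` in the direction `i`. -/
def IsWeakDeriv {d : ℕ} (i : Fin d) (f g : Torus d → ℝ) : Prop :=
  ∀ φ : Torus d → ℝ, IsSmooth φ → ∫ x, f x * pd i φ x = -∫ x, g x * φ x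

/-- Multi-indices `α ∈ ℕ^d` with `|α| ≤ κ`. -/
abbrev MultiIdx (d κ : ℕ) : Type := {α : Fin d → Fin (κ + 1) // ∑ i, (α i : ℕ) ≤ κ}

/-- The length `|α|`. -/
def MultiIdx.len {d κ : ℕ} (α : MultiIdx d κ) : ℕ := ∑ i, (α.1 i : ℕ)

/-- The multi-index zero. -/
def MultiIdx.zero (d κ : ℕ) : MultiIdx d κ := ⟨fun _ => 0, by simp⟩

/-- The classical derivative `∂^α f`. -/
def pdMulti {d κ : ℕ} (α : MultiIdx d κ) (f : Torus d → ℝ) : Torus d → ℝ :=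
  (List.finRange d).foldr (fun i ψ => (pd i)^[(α.1 i : ℕ)] ψ) f

lemma IsSmooth.pdMulti {d κ : ℕ} {f : Torus d → ℝ} (hf : IsSmooth f) (α : MultiIdx d κ) :
    IsSmooth (pdMulti α f) := by
  unfold RegMFG.pdMulti
  induction List.finRange d with
  | nil => exact hf
  | cons i l ih =>
    rw [List.foldr_cons]
    generalize (α.1 i : ℕ) = n
    induction n with
    | zero => exact ih
    | succ n ihn =>
      rw [Function.iterate_succ_apply']
      exact ihn.pd i

lemma IsSmooth.memLp {d : ℕ} {f : Torus d → ℝ} (hf : IsSmooth f) (q : ENNReal) :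
    MemLp f q (volume : Measure (Torus d)) := by
  obtain ⟨C, hC⟩ := isCompact_univ.exists_bound_of_continuousOn hf.continuous.continuousOn
  exact MemLp.of_bound hf.continuous.aestronglyMeasurable C
    (Filter.Eventually.of_forall fun x => hC x (Set.mem_univ x))

/-- The Sobolev space `W^{κ,2}(𝕋^d)`: the families `(f_α)_{|α| ≤ κ}` in `L²(𝕋^d)` such that `f_α`
is the weak derivative `D^α f` of `f = f_0`, with the norm `(∑_{|α| ≤ κ} ‖D^α f‖²)^{1/2}`. -/
def Sobolev (d κ : ℕ) :
    Submodule ℝ (PiLp 2 (fun _ : MultiIdx d κ => Lp ℝ 2 (volume : Measure (Torus d)))) where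
  carrier := {F | ∀ (α : MultiIdx d κ) (φ : Torus d → ℝ), IsSmooth φ →
    ∫ x, F (MultiIdx.zero d κ) x * pdMulti α φ x = (-1) ^ α.len * ∫ x, F α x * φ x}
  zero_mem' := by
    intro α φ hφ
    simp
  add_mem' := by
    intro F G hF hG α φ hφ
    have hadd : ∀ (a b : Lp ℝ 2 (volume : Measure (Torus d))) (ψ : Torus d → ℝ), IsSmooth ψ →
        ∫ x, (a + b) x * ψ x = (∫ x, a x * ψ x) + ∫ x, b x * ψ x := by
      intro a b ψ hψ
      have ha : Integrable (fun x => a x * ψ x) volume :=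
        (Lp.memLp a).integrable_mul (hψ.memLp 2)
      have hb : Integrable (fun x => b x * ψ x) volume :=
        (Lp.memLp b).integrable_mul (hψ.memLp 2)
      rw [← integral_add ha hb]
      refine integral_congr_ae ?_
      filter_upwards [Lp.coeFn_add a b] with x hx
      rw [hx, Pi.add_apply, add_mul]
    rw [PiLp.add_apply, PiLp.add_apply, hadd _ _ _ (hφ.pdMulti α), hadd _ _ _ hφ, hF α φ hφ,
      hG α φ hφ, mul_add]
  smul_mem' := by
    intro c F hF α φ hφ
    have hsmul : ∀ (a : Lp ℝ 2 (volume : Measure (Torus d))) (ψ : Torus d → ℝ),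
        ∫ x, (c • a) x * ψ x = c * ∫ x, a x * ψ x := by
      intro a ψ
      rw [← integral_const_mul]
      refine integral_congr_ae ?_
      filter_upwards [Lp.coeFn_smul c a] with x hx
      simp [hx, mul_assoc]
    rw [PiLp.smul_apply, PiLp.smul_apply, hsmul, hsmul, hF α φ hφ]
    ring

/-- The function (a representative of its class) underlying an element of `W^{κ,2}(𝕋^d)`. -/
def sobFn {d κ : ℕ} (f : Sobolev d κ) : Torus d → ℝ := f.1 (MultiIdx.zero d κ)

/-- `u ∈ W^{1,γ}(𝕋^d)` with weak gradient `P`, and the weak second derivatives of `u` are the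
functions `Q i j = ∂_i ∂_j u`. -/
structure HasWeakDerivs {d : ℕ} (γ : ℝ) (u : Torus d → ℝ) (P : Torus d → Vec d)
    (Q : Torus d → Mat d) : Prop where
  memLp : MemLp u (ENNReal.ofReal γ) volume
  memLp_grad : ∀ i, MemLp (fun x => P x i) (ENNReal.ofReal γ) volume
  grad_eq : ∀ i, IsWeakDeriv i u (fun x => P x i)
  integrable_hess : ∀ i j, Integrable (fun x => Q x i j) volume
  hess_eq : ∀ i j, IsWeakDeriv i (fun x => P x j) (fun x => Q x i j)

/-! ### Absolutely continuous measures and the nonlocal operator -/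

/-- `M_ac(𝕋^d)`: the finite positive measures that are absolutely continuous with respect to the
Lebesgue measure. -/
def Mac (d : ℕ) : Type :=
  {ν : Measure (Torus d) // IsFiniteMeasure ν ∧ ν ≪ (volume : Measure (Torus d))}

open Classical in
/-- The measure with density `m`, for an integrable `m ≥ 0`. (The value for other `m` is
irrelevant: it is never used.) -/
def bold {d : ℕ} (m : Torus d → ℝ) : Mac d :=
  if hm : Integrable m volume then
    ⟨volume.withDensity (fun x => ENNReal.ofReal (m x)),
      isFiniteMeasure_withDensity_ofReal hm.2, withDensity_absolutelyContinuous _ _⟩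
  else ⟨0, inferInstance, Measure.AbsolutelyContinuous.zero _⟩

/-- `m` is the density of a measure in `M_ac(𝕋^d)` with values in `E` (almost everywhere), where
`E` is `(0,∞)` or `[0,∞)`. -/
structure IsDensity {d : ℕ} (E : Set ℝ) (m : Torus d → ℝ) : Prop where
  integrable : Integrable m volume
  mem : ∀ᵐ x ∂(volume : Measure (Torus d)), m x ∈ E

/-- Assumption (h): for every `κ > d/2 + 1`, the map `m ↦ h(𝐦)` sends `W^{κ,2}(𝕋^d)` to itself and
is Fréchet differentiable there. As `h` acts on positive measures, `m` ranges over the cone of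
the nonnegative functions of `W^{κ,2}(𝕋^d)`. -/
def AssumptionH {d : ℕ} (h : Mac d → C(Torus d, ℝ)) : Prop :=
  ∀ κ : ℕ, (d : ℝ) / 2 + 1 < κ →
    ∃ F : Sobolev d κ → Sobolev d κ,
      (∀ m : Sobolev d κ, 0 ≤ᵐ[volume] sobFn m → sobFn (F m) =ᵐ[volume] h (bold (sobFn m))) ∧
      DifferentiableOn ℝ F {m : Sobolev d κ | 0 ≤ᵐ[volume] sobFn m}

/-- Assumption (g). Integral conditions are imposed on those densities for which the integrals
exist; for the nonnegative function `g₂` integrability is part of the condition. -/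
def AssumptionG {d : ℕ} (E : Set ℝ) (h : Mac d → C(Torus d, ℝ))
    (g : Torus d → ℝ → ℝ → ℝ) : Prop :=
  ∃ g₁ g₂ : Torus d → ℝ → ℝ → ℝ,
    (∀ x, ∀ m ∈ E, ∀ θ, g x m θ = g₁ x m θ + g₂ x m θ) ∧
    (∀ m : Torus d → ℝ, IsDensity E m →
      ∀ᵐ x ∂(volume : Measure (Torus d)), 0 ≤ g₂ x (m x) (h (bold m) x)) ∧
    (∃ c : ℝ, 0 < c ∧ ∀ m : Torus d → ℝ, IsDensity E m →
      Integrable (fun x => g₂ x (m x) (h (bold m) x)) volume ∧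
      ∫ x, g₂ x (m x) (h (bold m) x) ≤ c * (1 + ∫ x, m x)) ∧
    (∀ δ : ℝ, 0 < δ → ∃ Cδ : ℝ, 0 < Cδ ∧ ∀ m : Torus d → ℝ, IsDensity E m →
      Integrable (fun x => g₁ x (m x) (h (bold m) x)) volume →
      Integrable (fun x => m x * g₁ x (m x) (h (bold m) x)) volume →
      max (∫ x, g₁ x (m x) (h (bold m) x)) (∫ x, m x) ≤
        δ * (∫ x, m x * g₁ x (m x) (h (bold m) x)) + Cδ) ∧
    (∃ R : ℝ, 0 ≤ R ∧ ∀ m : Torus d → ℝ, IsDensity E m →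
      Integrable (fun x => m x * g₁ x (m x) (h (bold m) x)) volume →
      -R ≤ ∫ x, m x * g₁ x (m x) (h (bold m) x))

/-! ### The Hamiltonian -/

/-- Hamiltonians `H(x, p, M, m, θ)`; only the values with `m ∈ E` matter. -/
abbrev Hamiltonian (d : ℕ) : Type := Torus d → Vec d → Mat d → ℝ → ℝ → ℝ

/-- The partial derivative `∂H/∂p_i`. -/
def DpH {d : ℕ} (H : Hamiltonian d) (i : Fin d) (x : Torus d) (p : Vec d) (M : Mat d)
    (m θ : ℝ) : ℝ :=
  fderiv ℝ (fun p' : Vec d => H x p' M m θ) p (EuclideanSpace.single i 1)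

/-- The partial derivative `∂H/∂M_{ij}`. -/
def DMH {d : ℕ} (H : Hamiltonian d) (i j : Fin d) (x : Torus d) (p : Vec d) (M : Mat d)
    (m θ : ℝ) : ℝ :=
  fderiv ℝ (fun M' : Mat d => H x p M' m θ) M (Pi.single i (Pi.single j 1))

/-- Assumption (H1), with the function `g`. The product `D_M H : M` is used for symmetric `M`. The
integral condition is imposed on those pairs `(𝐦, u)` for which the integrals exist. -/
def AssumptionH1 {d : ℕ} (E : Set ℝ) (h : Mac d → C(Torus d, ℝ)) (g : Torus d → ℝ → ℝ → ℝ)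
    (H : Hamiltonian d) : Prop :=
  ContinuousOn (fun z : Torus d × ℝ × ℝ => g z.1 z.2.1 z.2.2) {z | z.2.1 ∈ E} ∧
  ∃ γ τ C₁ C₂ C₃ C₄ : ℝ, 1 < γ ∧ 0 ≤ τ ∧ τ < 1 ∧ 0 < C₁ ∧ 0 < C₂ ∧ 0 < C₃ ∧ 0 < C₄ ∧
    (∀ (x : Torus d) (p : Vec d) (M : Mat d), (∀ i j, M i j = M j i) → ∀ m ∈ E, ∀ θ : ℝ,
      1 / C₁ * (m ^ (-τ) * ‖p‖ ^ γ) + C₂ * g x m θ - C₁ ≤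
        -H x p M m θ + ∑ i, DpH H i x p M m θ * p i + ∑ i, ∑ j, DMH H i j x p M m θ * M i j) ∧
    (∀ (m u : Torus d → ℝ) (P : Torus d → Vec d) (Q : Torus d → Mat d),
      IsDensity E m → HasWeakDerivs γ u P Q →
      Integrable (fun x => g x (m x) (h (bold m) x)) volume →
      Integrable (fun x => ‖P x‖ ^ γ * m x ^ (-τ)) volume →
      Integrable (fun x => H x (P x) (Q x) (m x) (h (bold m) x)) volume →
      -C₃ * (∫ x, g x (m x) (h (bold m) x)) + 1 / C₁ * (∫ x, ‖P x‖ ^ γ * m x ^ (-τ)) - C₁ ≤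
          ∫ x, H x (P x) (Q x) (m x) (h (bold m) x) ∧
        ∫ x, H x (P x) (Q x) (m x) (h (bold m) x) ≤
          -C₄ * (∫ x, g x (m x) (h (bold m) x)) +
            C₁ * (1 + ∫ x, ‖P x‖ ^ γ * m x ^ (-τ)))

/-- Assumption (H2): `H` is of class `C^∞` on `𝕋^d × ℝ^d × ℝ^{d×d} × E × ℝ`. -/
def AssumptionH2 {d : ℕ} (E : Set ℝ) (H : Hamiltonian d) : Prop :=
  ContDiffOn ℝ ∞ (fun z : (Fin d → ℝ) × Vec d × Mat d × ℝ × ℝ =>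
    H (proj z.1) z.2.1 z.2.2.1 z.2.2.2.1 z.2.2.2.2) {z | z.2.2.2.1 ∈ E}

/-- First component of the mean-field game operator `A(η, v)`:
`-v - H(x, Dv, D²v, η, h(𝛈))`. -/
def opA₁ {d : ℕ} (h : Mac d → C(Torus d, ℝ)) (H : Hamiltonian d) (η v : Torus d → ℝ)
    (x : Torus d) : ℝ :=
  -v x - H x (grad v x) (hess v x) (η x) (h (bold η) x)

/-- Second component of the mean-field game operator `A(η, v)`:
`η - div(η D_p H) + (η D_{M_{ij}} H)_{x_i x_j} - 1`. -/
def opA₂ {d : ℕ} (h : Mac d → C(Torus d, ℝ)) (H : Hamiltonian d) (η v : Torus d → ℝ)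
    (x : Torus d) : ℝ :=
  η x
    - ∑ i, pd i (fun y => η y * DpH H i y (grad v y) (hess v y) (η y) (h (bold η) y)) x
    + ∑ i, ∑ j,
        pd i (pd j fun y => η y * DMH H i j y (grad v y) (hess v y) (η y) (h (bold η) y)) x
    - 1

/-- Assumption (H3): the operator `A` is monotone for the `L² × L²` inner product. -/
def AssumptionH3 {d : ℕ} (E : Set ℝ) (h : Mac d → C(Torus d, ℝ)) (H : Hamiltonian d) : Prop :=
  ∀ η v η' v' : Torus d → ℝ, IsSmooth η → IsSmooth v → IsSmooth η' → IsSmooth v' →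
    (∀ x, η x ∈ E) → (∀ x, η' x ∈ E) →
    0 ≤ (∫ x, (opA₁ h H η v x - opA₁ h H η' v' x) * (η x - η' x)) +
      ∫ x, (opA₂ h H η v x - opA₂ h H η' v' x) * (v x - v' x)

/-! ### The regularized problem -/

/-- `β : (0,∞) → (-∞,0]` is an admissible penalization with parameters `ε₁` and `q`. -/
structure IsPenalization (ε₁ q : ℝ) (β : ℝ → ℝ) : Prop where
  nonpos : ∀ s, 0 < s → β s ≤ 0
  mono : MonotoneOn β (Set.Ioi 0)
  smooth : ContDiffOn ℝ ∞ β (Set.Ioi 0)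
  eq_zero : ∀ s, ε₁ ≤ s → β s = 0
  eq_neg : ∀ s, 0 < s → s ≤ ε₁ / 2 → β s = -(1 / s ^ q)

/-- `(m, u)` solves the regularized system at every point of the torus. -/
def SolvesRP {d : ℕ} (h : Mac d → C(Torus d, ℝ)) (H : Hamiltonian d) (p : ℕ) (ε₁ ε₂ : ℝ)
    (β : ℝ → ℝ) (m u : Torus d → ℝ) : Prop :=
  ∀ x : Torus d,
    opA₁ h H m u x + ε₁ * (m x + lap^[2 * p] m x) + ε₂ * (m x - lap m x) + β (m x) = 0 ∧
    opA₂ h H m u x + ε₁ * (u x + lap^[2 * p] u x) + ε₂ * (u x - lap u x) = 0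

end RegMFG

end

/-! # Existence of smooth solutions of a regularized mean-field game system

The monotonicity of the operator `A` gives a priori bounds in `W^{2p,2}` and a positive lower bound
for the density. Galerkin approximations in spaces of trigonometric polynomials converge to a weak
solution, which is smooth by a bootstrap on its Fourier coefficients. -/

noncomputable section

namespace RegMFG

open Complex UnitAddTorus

/-! ### Differentiability classes on the torus -/

/-! The regularization turns a monotone operator into a strongly monotone one. Write `reg` for
ε₁(1+Δ^{2p}) + ε₂(1-Δ). Since `A` is monotone and β is non-decreasing, the difference of the
residuals of two smooth pairs with positive densities, tested with the difference of the pairs,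
dominates the `reg`-energies of the differences (`res_monotone`), and each energy is at least ε₁
times the squared L² norm. Comparison with the pair (1,0), where β vanishes because ε₁ < 1, and
Young's inequality give `a_priori`: the energies of m-1 and u and the integral of β(m)(m-1), whose
integrand is nonnegative, are controlled by the residuals tested with (m-1,u).

The energy controls the H^{2p} norm, and 2p > d/2+5, so m is Lipschitz with a known constant. If m
dipped to a small value s, it would stay below 2s on a ball of radius comparable to s, where
β(m)(m-1) is at least a multiple of s^{-q}. The integral would be at least a multiple of s^{d-q},
which is impossible for tiny s because q > d. Hence the density has a positive lower bound
(`exists_lower_bound`).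

In a finite-dimensional space of smooth functions containing 1, the tested residuals form a strongly
monotone map on the open cone of positive densities. A zero is found by minimizing the norm of this
map: the two estimates above confine the relevant sublevel set to a compact subset of the cone, and
a step in the direction -F(x₀) would decrease a nonzero minimum (`exists_zero_of_stronglyMonotone`).
This uses the Lipschitz estimate only at one point at a time, which is what Fréchet
differentiability of h provides (`nonlocal_lipschitzAt`, `gal_lipschitzAt`).

For trigonometric polynomials of degree at most N the bounds are uniform in N (`exists_approx`). A
Rellich argument on Fourier coefficients (`exists_subseq`) gives convergence in H^{2p-1}, hence in
C², and h(𝐦) converges uniformly by `tendsto_nonlocal`. So the equations pass to the limit frequency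
by frequency (`exists_weak_solution`). Finally `reg` gains 4p derivatives, more than the nonlinear
terms lose; `inH_succ` raises the regularity by one derivative at a time, and a smooth weak solution
has vanishing residuals because all their Fourier coefficients vanish (`exists_solution`). -/

/-- `f ∈ C^n(𝕋^d)`: the periodic lift of `f` to `ℝ^d` is of class `C^n`. -/
def IsC {d : ℕ} (n : WithTop ℕ∞) (f : Torus d → ℝ) : Prop :=
  ContDiff ℝ n (fun y : Fin d → ℝ => f (proj y))

section Calculus

variable {d : ℕ}

lemma IsSmooth.isC {f : Torus d → ℝ} (hf : IsSmooth f) : IsC ∞ f := hf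

lemma IsC.of_le {n n' : WithTop ℕ∞} {f : Torus d → ℝ} (hf : IsC n f) (h : n' ≤ n) : IsC n' f :=
  ContDiff.of_le hf h

lemma natCast_le_infty (n : ℕ) : (n : WithTop ℕ∞) ≤ ∞ := by
  exact_mod_cast (le_top : ((n : ℕ∞)) ≤ ⊤)

lemma IsSmooth.isC_nat {f : Torus d → ℝ} (hf : IsSmooth f) (n : ℕ) : IsC n f :=
  hf.isC.of_le (natCast_le_infty n)

lemma IsC.continuous {n : WithTop ℕ∞} {f : Torus d → ℝ} (hf : IsC n f) : Continuous f :=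
  isQuotientMap_proj.continuous_iff.2 (ContDiff.continuous hf)

lemma isSmooth_of_forall {f : Torus d → ℝ} (hf : ∀ n : ℕ, IsC n f) : IsSmooth f :=
  contDiff_infty.2 hf

lemma proj_surjective (x : Torus d) : ∃ y : Fin d → ℝ, proj y = x :=
  isQuotientMap_proj.surjective x

lemma IsC.pd_proj {n : WithTop ℕ∞} {f : Torus d → ℝ} (hf : IsC n f) (hn : 1 ≤ n) (i : Fin d)
    (y : Fin d → ℝ) :
    pd i f (proj y) = fderiv ℝ (fun y : Fin d → ℝ => f (proj y)) y (Pi.single i 1) := by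
  have hd : DifferentiableAt ℝ (fun y : Fin d → ℝ => f (proj y)) y :=
    (ContDiff.differentiable hf (by rintro rfl; simp at hn)) y
  rw [← hd.lineDeriv_eq_fderiv]
  simp only [RegMFG.pd, lineDeriv, proj_add_single]

lemma IsC.pd {n : WithTop ℕ∞} {f : Torus d → ℝ} (hf : IsC (n + 1) f) (i : Fin d) :
    IsC n (pd i f) := by
  have h1 : (fun y : Fin d → ℝ => RegMFG.pd i f (proj y)) =
      fun y => fderiv ℝ (fun y : Fin d → ℝ => f (proj y)) y (Pi.single i 1) :=
    funext (hf.pd_proj (by simp) i)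
  unfold IsC at hf ⊢
  rw [h1]
  exact (hf.fderiv_right (m := n) le_rfl).clm_apply contDiff_const

lemma IsC.hasDerivAt {f : Torus d → ℝ} (hf : IsC 1 f) (i : Fin d) (x : Torus d) (t : ℝ) :
    HasDerivAt (fun s : ℝ => f (x + Pi.single i (s : UnitAddCircle)))
      (RegMFG.pd i f (x + Pi.single i (t : UnitAddCircle))) t := by
  obtain ⟨y, rfl⟩ := proj_surjective x
  simp only [proj_add_single]
  rw [hf.pd_proj le_rfl]
  have h1 : HasDerivAt (fun s : ℝ => y + s • Pi.single i (1 : ℝ)) (Pi.single i (1 : ℝ)) t := by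
    simpa using ((hasDerivAt_id t).smul_const (Pi.single i (1 : ℝ))).const_add y
  have hd : DifferentiableAt ℝ (fun y : Fin d → ℝ => f (proj y)) (y + t • Pi.single i (1 : ℝ)) :=
    (ContDiff.differentiable hf one_ne_zero) _
  exact hd.hasFDerivAt.comp_hasDerivAt t h1

lemma IsC.hasDerivAt_zero {f : Torus d → ℝ} (hf : IsC 1 f) (i : Fin d) (x : Torus d) :
    HasDerivAt (fun s : ℝ => f (x + Pi.single i (s : UnitAddCircle))) (RegMFG.pd i f x) 0 := by
  simpa using hf.hasDerivAt i x 0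

lemma pd_eq_of_hasDerivAt {f : Torus d → ℝ} {i : Fin d} {x : Torus d} {a : ℝ}
    (h : HasDerivAt (fun s : ℝ => f (x + Pi.single i (s : UnitAddCircle))) a 0) :
    pd i f x = a := h.deriv

lemma IsC.pd_sub {f f' : Torus d → ℝ} (hf : IsC 1 f) (hf' : IsC 1 f') (i : Fin d) :
    RegMFG.pd i (fun x => f x - f' x) = fun x => RegMFG.pd i f x - RegMFG.pd i f' x :=
  funext fun x => pd_eq_of_hasDerivAt ((hf.hasDerivAt_zero i x).sub (hf'.hasDerivAt_zero i x))

lemma IsC.pd_mul {f f' : Torus d → ℝ} (hf : IsC 1 f) (hf' : IsC 1 f') (i : Fin d) :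
    RegMFG.pd i (fun x => f x * f' x) =
      fun x => RegMFG.pd i f x * f' x + f x * RegMFG.pd i f' x :=
  funext fun x => pd_eq_of_hasDerivAt <|
    ((hf.hasDerivAt_zero i x).mul (hf'.hasDerivAt_zero i x)).congr_deriv (by simp)

lemma IsC.sub {n : WithTop ℕ∞} {f f' : Torus d → ℝ} (hf : IsC n f) (hf' : IsC n f') :
    IsC n (fun x => f x - f' x) := ContDiff.sub hf hf'

lemma IsC.mul {n : WithTop ℕ∞} {f f' : Torus d → ℝ} (hf : IsC n f) (hf' : IsC n f') :
    IsC n (fun x => f x * f' x) := ContDiff.mul hf hf'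

lemma IsC.sum {ι : Type*} {s : Finset ι} {n : WithTop ℕ∞} {f : ι → Torus d → ℝ}
    (hf : ∀ j ∈ s, IsC n (f j)) : IsC n (fun x => ∑ j ∈ s, f j x) :=
  ContDiff.sum fun j hj => hf j hj

lemma IsSmooth.lap {f : Torus d → ℝ} (hf : IsSmooth f) : IsSmooth (lap f) :=
  IsC.sum (n := ∞) (s := Finset.univ) fun i _ => (hf.pd i).pd i

lemma IsSmooth.lap_iterate {f : Torus d → ℝ} (hf : IsSmooth f) (n : ℕ) : IsSmooth (RegMFG.lap^[n] f) := by
  induction n with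
  | zero => exact hf
  | succ n ih => rw [Function.iterate_succ_apply']; exact ih.lap

end Calculus

/-! ### Lebesgue measure and Fourier analysis on the torus -/

instance : IsProbabilityMeasure (volume : Measure UnitAddCircle) :=
  ⟨by simp⟩

/-- The circle has length one, so Lebesgue measure is already the normalized Haar measure for which
the Fourier basis is available. -/
lemma volume_torus_eq (d : ℕ) :
    (volume : Measure (Torus d)) = Measure.pi fun _ => AddCircle.haarAddCircle := by
  rw [volume_pi]
  congr 1
  funext i
  rw [AddCircle.volume_eq_smul_haarAddCircle]
  simp

lemma _root_.Continuous.integrable_torus {d : ℕ} {F : Type*} [NormedAddCommGroup F]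
    {f : Torus d → F} (hf : Continuous f) :
    Integrable f (volume : Measure (Torus d)) :=
  hf.integrable_of_hasCompactSupport (HasCompactSupport.of_compactSpace f)

/-- The `k`-th Fourier coefficient of a complex function on the torus. -/
def fourC {d : ℕ} (f : Torus d → ℂ) (k : Fin d → ℤ) : ℂ := ∫ x, mFourier (-k) x * f x

/-- The `k`-th Fourier coefficient of a real function on the torus. -/
def four {d : ℕ} (f : Torus d → ℝ) (k : Fin d → ℤ) : ℂ := fourC (fun x => (f x : ℂ)) k

section Fourier

variable {d : ℕ}

lemma exists_hilbertBasis (d : ℕ) :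
    ∃ b : HilbertBasis (Fin d → ℤ) ℂ (Lp ℂ 2 (volume : Measure (Torus d))),
      ∀ f k, b.repr f k = fourC f k := by
  -- The L² space depends on the measure, so the statement is quantified over the measure before the
  -- equality is substituted.
  have key : ∀ μ : Measure (Torus d), μ = Measure.pi (fun _ => AddCircle.haarAddCircle) →
      ∃ b : HilbertBasis (Fin d → ℤ) ℂ (Lp ℂ 2 μ),
        ∀ (f : Lp ℂ 2 μ) k, b.repr f k = ∫ x, mFourier (-k) x * f x ∂μ := by
    rintro μ rfl
    exact ⟨mFourierBasis, fun f k => mFourierBasis_repr f k⟩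
  exact key _ (volume_torus_eq d)

/-- The Fourier basis of `L²(𝕋^d)`. -/
def fourierBasis (d : ℕ) : HilbertBasis (Fin d → ℤ) ℂ (Lp ℂ 2 (volume : Measure (Torus d))) :=
  (exists_hilbertBasis d).choose

lemma fourierBasis_repr (f : Lp ℂ 2 (volume : Measure (Torus d))) (k : Fin d → ℤ) :
    (fourierBasis d).repr f k = fourC f k :=
  (exists_hilbertBasis d).choose_spec f k

lemma hasSum_fourC {f : Torus d → ℂ} (hf : Continuous f) (hs : Summable (fourC f))
    (x : Torus d) : HasSum (fun k => fourC f k * mFourier k x) (f x) := by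
  have key : ∀ μ : Measure (Torus d), μ = Measure.pi (fun _ => AddCircle.haarAddCircle) →
      Summable (fun k => ∫ x, mFourier (-k) x * f x ∂μ) →
      HasSum (fun k => (∫ x, mFourier (-k) x * f x ∂μ) * mFourier k x) (f x) := by
    rintro μ rfl h
    exact hasSum_mFourier_series_apply_of_summable (f := ⟨f, hf⟩) h x
  exact key _ (volume_torus_eq d) hs

lemma fourC_congr {f f' : Torus d → ℂ} (h : f =ᵐ[volume] f') (k : Fin d → ℤ) :
    fourC f k = fourC f' k :=
  integral_congr_ae (by filter_upwards [h] with x hx; rw [hx])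

lemma four_congr {f f' : Torus d → ℝ} (h : f =ᵐ[volume] f') (k : Fin d → ℤ) :
    four f k = four f' k :=
  fourC_congr (by filter_upwards [h] with x hx; rw [hx]) k

lemma norm_mFourier_apply (k : Fin d → ℤ) (x : Torus d) : ‖mFourier k x‖ = 1 := by
  simp only [mFourier, ContinuousMap.coe_mk, norm_prod, fourier_apply, Circle.norm_coe,
    Finset.prod_const_one]

lemma integrable_mFourier_mul {f : Torus d → ℂ} (hf : Integrable f volume) (k : Fin d → ℤ) :
    Integrable (fun x => mFourier k x * f x) volume :=
  hf.bdd_mul (c := 1) (mFourier k).continuous.aestronglyMeasurable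
    (Filter.Eventually.of_forall fun x => (norm_mFourier_apply k x).le)

lemma integrable_mFourier_mul_ofReal {f : Torus d → ℝ} (hf : Integrable f volume)
    (k : Fin d → ℤ) : Integrable (fun x => mFourier k x * (f x : ℂ)) volume :=
  integrable_mFourier_mul hf.ofReal k

lemma four_add {f f' : Torus d → ℝ} (hf : Integrable f volume) (hf' : Integrable f' volume)
    (k : Fin d → ℤ) : four (fun x => f x + f' x) k = four f k + four f' k := by
  simp only [four, fourC]
  rw [← integral_add (integrable_mFourier_mul_ofReal hf _) (integrable_mFourier_mul_ofReal hf' _)]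
  congr 1; funext x; push_cast; ring

lemma four_sub {f f' : Torus d → ℝ} (hf : Integrable f volume) (hf' : Integrable f' volume)
    (k : Fin d → ℤ) : four (fun x => f x - f' x) k = four f k - four f' k := by
  simp only [four, fourC]
  rw [← integral_sub (integrable_mFourier_mul_ofReal hf _) (integrable_mFourier_mul_ofReal hf' _)]
  congr 1; funext x; push_cast; ring

lemma four_const_mul (f : Torus d → ℝ) (c : ℝ) (k : Fin d → ℤ) :
    four (fun x => c * f x) k = c * four f k := by
  unfold four fourC
  rw [← integral_const_mul]
  congr 1; funext x; push_cast; ring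

lemma four_sum {ι : Type*} (s : Finset ι) {f : ι → Torus d → ℝ}
    (hf : ∀ j ∈ s, Integrable (f j) volume) (k : Fin d → ℤ) :
    four (fun x => ∑ j ∈ s, f j x) k = ∑ j ∈ s, four (f j) k := by
  simp only [four, fourC]
  rw [← integral_finsetSum s fun j hj => integrable_mFourier_mul_ofReal (hf j hj) _]
  congr 1; funext x; push_cast; rw [Finset.mul_sum]

lemma norm_four_le {f : Torus d → ℝ} {C : ℝ} (hC : ∀ x, |f x| ≤ C) (k : Fin d → ℤ) :
    ‖four f k‖ ≤ C := by
  refine (norm_integral_le_of_norm_le_const (C := C)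
    (Filter.Eventually.of_forall fun x => ?_)).trans ?_
  · rw [norm_mul, norm_mFourier_apply, one_mul, Complex.norm_real]
    exact hC x
  · simp

lemma mFourier_add_single (k : Fin d → ℤ) (x : Torus d) (i : Fin d) (t : ℝ) :
    mFourier k (x + Pi.single i (t : UnitAddCircle)) =
      mFourier k x * exp (2 * Real.pi * I * k i * t) := by
  have h1 : ∀ x y : Torus d, mFourier k (x + y) = mFourier k x * mFourier k y := by
    intro x y
    simp only [mFourier, ContinuousMap.coe_mk, ← Finset.prod_mul_distrib]
    refine Finset.prod_congr rfl fun j _ => ?_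
    simp [fourier_apply, AddCircle.toCircle_add]
  rw [h1]
  congr 1
  simp only [mFourier, ContinuousMap.coe_mk]
  rw [Finset.prod_eq_single i]
  · simp
  · intro j _ hj
    simp [hj]
  · simp

/-- The coefficient of the translate f(· + t e_i) is differentiated at t = 0 in two ways: under the
integral sign, with the bounded derivative as dominating constant, and after translation invariance
has turned it into e^{2πi k_i t} times the coefficient of f. -/
lemma four_pd {f : Torus d → ℝ} (hf : IsC 1 f) (i : Fin d) (k : Fin d → ℤ) :
    four (pd i f) k = 2 * Real.pi * I * k i * four f k := by
  have hpc : Continuous (pd i f) := (IsC.pd (n := 0) (by simpa using hf) i).continuous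
  obtain ⟨C, hC⟩ := isCompact_univ.exists_bound_of_continuousOn hpc.continuousOn
  have hcont : ∀ t : ℝ, Continuous fun x : Torus d =>
      mFourier (-k) x * ((f (x + Pi.single i (t : UnitAddCircle)) : ℝ) : ℂ) := fun t =>
    (mFourier (-k)).continuous.mul (continuous_ofReal.comp (hf.continuous.comp (by fun_prop)))
  have hL : HasDerivAt (fun t : ℝ => ∫ x : Torus d,
      mFourier (-k) x * ((f (x + Pi.single i (t : UnitAddCircle)) : ℝ) : ℂ))
      (∫ x, mFourier (-k) x * ((pd i f (x + Pi.single i ((0 : ℝ) : UnitAddCircle)) : ℝ) : ℂ)) 0 := by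
    have hcont' : ∀ t : ℝ, Continuous fun x : Torus d =>
        mFourier (-k) x * ((pd i f (x + Pi.single i (t : UnitAddCircle)) : ℝ) : ℂ) := fun t =>
      (mFourier (-k)).continuous.mul (continuous_ofReal.comp (hpc.comp (by fun_prop)))
    have hb : ∀ (t : ℝ) (x : Torus d),
        ‖mFourier (-k) x * ((pd i f (x + Pi.single i (t : UnitAddCircle)) : ℝ) : ℂ)‖ ≤ C := by
      intro t x
      rw [norm_mul, norm_mFourier_apply, one_mul, Complex.norm_real]
      exact hC _ (Set.mem_univ _)
    have hd : ∀ (t : ℝ) (x : Torus d), HasDerivAt (fun s : ℝ =>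
        mFourier (-k) x * ((f (x + Pi.single i (s : UnitAddCircle)) : ℝ) : ℂ))
        (mFourier (-k) x * ((pd i f (x + Pi.single i (t : UnitAddCircle)) : ℝ) : ℂ)) t :=
      fun t x => ((hf.hasDerivAt i x t).ofReal_comp).const_mul _
    generalize hG : (fun (t : ℝ) (x : Torus d) =>
      mFourier (-k) x * ((f (x + Pi.single i (t : UnitAddCircle)) : ℝ) : ℂ)) = G at *
    generalize hG' : (fun (t : ℝ) (x : Torus d) =>
      mFourier (-k) x * ((pd i f (x + Pi.single i (t : UnitAddCircle)) : ℝ) : ℂ)) = G' at *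
    simp only [funext_iff] at hG hG'
    simp only [hG, hG'] at *
    exact (hasDerivAt_integral_of_dominated_loc_of_deriv_le (bound := fun _ => C) (s := Set.univ)
      Filter.univ_mem (Filter.Eventually.of_forall fun t => (hcont t).aestronglyMeasurable)
      (hcont 0).integrable_torus (hcont' 0).aestronglyMeasurable
      (Filter.Eventually.of_forall fun x t _ => hb t x) (integrable_const C)
      (Filter.Eventually.of_forall fun x t _ => hd t x)).2
  have hR : (fun t : ℝ => ∫ x : Torus d,
      mFourier (-k) x * ((f (x + Pi.single i (t : UnitAddCircle)) : ℝ) : ℂ)) =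
      fun t : ℝ => exp (2 * Real.pi * I * k i * t) * four f k := by
    funext t
    unfold four fourC
    rw [← integral_const_mul, ← integral_add_right_eq_self
      (fun x => exp (2 * Real.pi * I * k i * t) * (mFourier (-k) x * (f x : ℂ)))
      (Pi.single i (t : UnitAddCircle))]
    congr 1
    funext x
    rw [mFourier_add_single, ← mul_assoc, mul_left_comm, ← exp_add]
    simp
  have hD : HasDerivAt (fun t : ℝ => exp (2 * Real.pi * I * k i * t) * four f k)
      (2 * Real.pi * I * k i * four f k) 0 := by
    have := ((((hasDerivAt_id (0 : ℝ)).ofReal_comp).const_mul (2 * Real.pi * I * k i)).cexp).mul_const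
      (four f k)
    simpa using this
  rw [hR] at hL
  have := hL.unique hD
  simpa [four, fourC] using this

/-- This is `four_pd` at frequency zero; with the product rule it yields integration by parts. -/
lemma integral_pd {f : Torus d → ℝ} (hf : IsC 1 f) (i : Fin d) : ∫ x, pd i f x = 0 := by
  have h := four_pd hf i 0
  simp only [Pi.zero_apply, Int.cast_zero, mul_zero, zero_mul] at h
  simp only [four, fourC, neg_zero, mFourier_zero, ContinuousMap.one_apply, one_mul] at h
  rw [integral_complex_ofReal] at h
  exact_mod_cast h

lemma integral_pd_mul {f φ : Torus d → ℝ} (hf : IsC 1 f) (hφ : IsC 1 φ) (i : Fin d) :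
    ∫ x, pd i f x * φ x = -∫ x, f x * pd i φ x := by
  have h := integral_pd (hf.mul hφ) i
  simp only [hf.pd_mul hφ] at h
  have c1 : Continuous (pd i f) := (IsC.pd (n := 0) (by simpa using hf) i).continuous
  have c2 : Continuous (pd i φ) := (IsC.pd (n := 0) (by simpa using hφ) i).continuous
  have i1 : Integrable (fun x => pd i f x * φ x) := (c1.mul hφ.continuous).integrable_torus
  have i2 : Integrable (fun x => f x * pd i φ x) := (hf.continuous.mul c2).integrable_torus
  rw [integral_add i1 i2] at h
  linarith

end Fourier

end RegMFG
end

noncomputable section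

namespace RegMFG

open Complex UnitAddTorus

/-! ### Weighted summability of Fourier coefficients -/

section Weights

variable {d : ℕ}

/-- The weight `1 + |k|` on frequencies. -/
def wt {d : ℕ} (k : Fin d → ℤ) : ℝ := 1 + ‖k‖

lemma one_le_wt (k : Fin d → ℤ) : 1 ≤ wt k := le_add_of_nonneg_right (norm_nonneg k)

lemma wt_pos (k : Fin d → ℤ) : 0 < wt k := one_pos.trans_le (one_le_wt k)

lemma abs_le_wt (k : Fin d → ℤ) (i : Fin d) : |(k i : ℝ)| ≤ wt k := by
  have := norm_le_pi_norm k i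
  rw [Int.norm_eq_abs] at this
  unfold wt
  linarith

/-- The sup norm of k is attained at some coordinate, and 1+|k| is at most 2 or at most 2|k|. Thus
control of the pure derivatives in the coordinate directions is enough to control the full weight.
-/
lemma wt_pow_le (k : Fin d → ℤ) (n : ℕ) : wt k ^ n ≤ 2 ^ n * (1 + ∑ i, |(k i : ℝ)| ^ n) := by
  have hs : 0 ≤ ∑ i, |(k i : ℝ)| ^ n := Finset.sum_nonneg fun i _ => by positivity
  rcases le_or_gt ‖k‖ 1 with h1 | h1
  · have : wt k ^ n ≤ 2 ^ n := by
      refine pow_le_pow_left₀ (wt_pos k).le ?_ n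
      unfold wt; linarith
    nlinarith [pow_pos (two_pos (α := ℝ)) n]
  · have hd : Nonempty (Fin d) := by
      by_contra hne
      rw [not_nonempty_iff] at hne
      rw [Subsingleton.elim k 0, norm_zero] at h1
      linarith
    obtain ⟨i, hi⟩ : ∃ i, |(k i : ℝ)| = ‖k‖ := by
      obtain ⟨i, -, hi⟩ := Finset.exists_mem_eq_sup Finset.univ Finset.univ_nonempty
        (fun i => ‖k i‖₊)
      exact ⟨i, by rw [Pi.norm_def, hi, coe_nnnorm, Int.norm_eq_abs]⟩
    have h2 : wt k ^ n ≤ (2 * |(k i : ℝ)|) ^ n := by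
      refine pow_le_pow_left₀ (wt_pos k).le ?_ n
      rw [hi]; unfold wt; linarith
    have h3 : |(k i : ℝ)| ^ n ≤ ∑ i, |(k i : ℝ)| ^ n :=
      Finset.single_le_sum (f := fun i => |(k i : ℝ)| ^ n) (fun i _ => by positivity)
        (Finset.mem_univ i)
    rw [mul_pow] at h2
    nlinarith [pow_pos (two_pos (α := ℝ)) n]

/-- Comparison with the sum of |k|^{-n} over the lattice ℤ^d, which converges for n above the rank;
the zero frequency is discarded. -/
lemma summable_wt_inv_pow {n : ℕ} (hn : d < n) : Summable fun k : Fin d → ℤ => (wt k)⁻¹ ^ n := by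
  let B := Pi.basisFun ℝ (Fin d)
  let L : Submodule ℤ (Fin d → ℝ) := Submodule.span ℤ (Set.range B)
  let b : Module.Basis (Fin d) ℤ L := B.restrictScalars ℤ
  have hfr : Module.finrank ℤ L = d := by simpa using Module.finrank_eq_card_basis b
  have hs := ZLattice.summable_norm_pow_inv L n (by rw [hfr]; exact hn)
  have hs2 := hs.comp_injective b.equivFun.symm.injective
  have hnorm : ∀ k : Fin d → ℤ, ‖b.equivFun.symm k‖ = ‖k‖ := by
    intro k
    have hc : ((b.equivFun.symm k : L) : Fin d → ℝ) = fun i => (k i : ℝ) := by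
      rw [Module.Basis.equivFun_symm_apply]
      funext j
      have hb : ∀ i, ((b i : L) : Fin d → ℝ) = Pi.single i 1 := fun i => by
        rw [Module.Basis.restrictScalars_apply]; simp [B]
      simp [hb, Finset.sum_apply, Pi.single_apply]
    rw [Submodule.coe_norm, hc]
    simp only [Pi.norm_def]
    congr 2
  refine Summable.of_norm_bounded_eventually hs2 ?_
  filter_upwards [(Set.finite_singleton (0 : Fin d → ℤ)).compl_mem_cofinite] with k hk
  have hk0 : 0 < ‖k‖ := norm_pos_iff.2 hk
  simp only [Function.comp_apply, hnorm]
  rw [Real.norm_of_nonneg (by have := wt_pos k; positivity)]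
  refine pow_le_pow_left₀ (inv_nonneg.2 (wt_pos k).le) ?_ n
  refine inv_anti₀ hk0 ?_
  unfold wt; linarith

lemma summable_mul_of_sq {ι : Type*} {a b : ι → ℝ} (ha : ∀ i, 0 ≤ a i) (hb : ∀ i, 0 ≤ b i)
    (hsa : Summable fun i => a i ^ 2) (hsb : Summable fun i => b i ^ 2) :
    Summable (fun i => a i * b i) ∧
      ∑' i, a i * b i ≤ √(∑' i, a i ^ 2) * √(∑' i, b i ^ 2) := by
  have key : ∀ s : Finset ι, ∑ i ∈ s, a i * b i ≤ √(∑' i, a i ^ 2) * √(∑' i, b i ^ 2) := by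
    intro s
    rw [← Real.sqrt_mul (tsum_nonneg fun i => sq_nonneg _)]
    refine Real.le_sqrt_of_sq_le ((Finset.sum_mul_sq_le_sq_mul_sq s a b).trans ?_)
    exact mul_le_mul (hsa.sum_le_tsum s fun i _ => sq_nonneg _)
      (hsb.sum_le_tsum s fun i _ => sq_nonneg _) (Finset.sum_nonneg fun i _ => sq_nonneg _)
      (tsum_nonneg fun i => sq_nonneg _)
  have hs := summable_of_sum_le (fun i => mul_nonneg (ha i) (hb i)) key
  exact ⟨hs, hs.tsum_le_of_sum_le key⟩

/-- The square of the `H^s` norm of a family of Fourier coefficients. -/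
def hsum {d : ℕ} (s : ℕ) (c : (Fin d → ℤ) → ℂ) : ℝ := ∑' k, wt k ^ (2 * s) * ‖c k‖ ^ 2

/-- The family `c` has finite `H^s` norm. -/
def InH {d : ℕ} (s : ℕ) (c : (Fin d → ℤ) → ℂ) : Prop :=
  Summable fun k => wt k ^ (2 * s) * ‖c k‖ ^ 2

lemma hsum_nonneg (s : ℕ) (c : (Fin d → ℤ) → ℂ) : 0 ≤ hsum s c :=
  tsum_nonneg fun k => by have := wt_pos k; positivity

lemma InH.mono {s s' : ℕ} {c : (Fin d → ℤ) → ℂ} (h : InH s c) (hs : s' ≤ s) : InH s' c := by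
  refine Summable.of_nonneg_of_le (fun k => by have := wt_pos k; positivity) (fun k => ?_) h
  exact mul_le_mul_of_nonneg_right (pow_le_pow_right₀ (one_le_wt k) (by omega)) (sq_nonneg _)

lemma InH.of_le {s s' : ℕ} {c c' : (Fin d → ℤ) → ℂ} {C : ℝ} (h : InH s c)
    (hc : ∀ k, wt k ^ s' * ‖c' k‖ ≤ C * (wt k ^ s * ‖c k‖)) : InH s' c' := by
  refine Summable.of_nonneg_of_le (fun k => by have := wt_pos k; positivity) (fun k => ?_)
    (h.mul_left (C ^ 2))
  have h0 : 0 ≤ wt k ^ s' * ‖c' k‖ := by have := wt_pos k; positivity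
  have := pow_le_pow_left₀ h0 (hc k) 2
  calc wt k ^ (2 * s') * ‖c' k‖ ^ 2 = (wt k ^ s' * ‖c' k‖) ^ 2 := by ring
    _ ≤ _ := this
    _ = _ := by ring

lemma InH.add {s : ℕ} {c c' : (Fin d → ℤ) → ℂ} (h : InH s c) (h' : InH s c') :
    InH s (fun k => c k + c' k) := by
  refine Summable.of_nonneg_of_le (fun k => by have := wt_pos k; positivity) (fun k => ?_)
    ((Summable.add h h').mul_left 2)
  have h1 : ‖c k + c' k‖ ^ 2 ≤ 2 * (‖c k‖ ^ 2 + ‖c' k‖ ^ 2) := by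
    have := pow_le_pow_left₀ (norm_nonneg _) (norm_add_le (c k) (c' k)) 2
    nlinarith [sq_nonneg (‖c k‖ - ‖c' k‖)]
  have := mul_le_mul_of_nonneg_left h1 (pow_nonneg (wt_pos k).le (2 * s))
  linarith

lemma InH.const_mul {s : ℕ} {c : (Fin d → ℤ) → ℂ} (h : InH s c) (a : ℂ) :
    InH s (fun k => a * c k) :=
  h.of_le (C := ‖a‖) fun k => by rw [norm_mul]; exact le_of_eq (by ring)

lemma InH.sub {s : ℕ} {c c' : (Fin d → ℤ) → ℂ} (h : InH s c) (h' : InH s c') :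
    InH s (fun k => c k - c' k) := by
  simpa [sub_eq_add_neg] using h.add (h'.const_mul (-1))

lemma InH.sum {ι : Type*} (S : Finset ι) {s : ℕ} {c : ι → (Fin d → ℤ) → ℂ}
    (h : ∀ j ∈ S, InH s (c j)) : InH s (fun k => ∑ j ∈ S, c j k) := by
  classical
  induction S using Finset.induction_on with
  | empty => simp [InH, summable_zero]
  | insert a S ha ih =>
    simp only [Finset.sum_insert ha]
    exact (h a (by simp)).add (ih fun j hj => h j (by simp [hj]))

/-- The constant of the embedding of `H^s` into the space of families with summable
`|k|^n`-moments. -/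
def embConst (d s n : ℕ) : ℝ := √(∑' k : Fin d → ℤ, (wt k)⁻¹ ^ (2 * s - 2 * n))

/-- Sobolev embedding on the Fourier side: Cauchy–Schwarz for the splitting of wt^n |c| into
wt^{-(s-n)} and wt^s |c|. The first factor is square summable because 2(s-n) > d. -/
lemma InH.summable {s n : ℕ} {c : (Fin d → ℤ) → ℂ} (h : InH s c) (hs : 2 * n + d < 2 * s) :
    Summable (fun k => wt k ^ n * ‖c k‖) ∧
      ∑' k, wt k ^ n * ‖c k‖ ≤ embConst d s n * √(hsum s c) := by
  have hw : ∀ k : Fin d → ℤ, ((wt k)⁻¹ ^ (s - n)) ^ 2 = (wt k)⁻¹ ^ (2 * s - 2 * n) := by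
    intro k; rw [← pow_mul]; congr 1; omega
  have hc : ∀ k : Fin d → ℤ, (wt k ^ s * ‖c k‖) ^ 2 = wt k ^ (2 * s) * ‖c k‖ ^ 2 := by
    intro k; ring
  have hp : ∀ k : Fin d → ℤ, (wt k)⁻¹ ^ (s - n) * (wt k ^ s * ‖c k‖) = wt k ^ n * ‖c k‖ := by
    intro k
    have h0 := (wt_pos k).ne'
    have : wt k ^ s = wt k ^ (s - n) * wt k ^ n := by rw [← pow_add]; congr 1; omega
    rw [this, inv_pow]
    field_simp
  have := summable_mul_of_sq (a := fun k : Fin d → ℤ => (wt k)⁻¹ ^ (s - n))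
    (b := fun k => wt k ^ s * ‖c k‖) (fun k => by have := wt_pos k; positivity)
    (fun k => by have := wt_pos k; positivity)
    (by simp only [hw]; exact summable_wt_inv_pow (by omega)) (by simp only [hc]; exact h)
  simpa only [hw, hc, hp] using! this

end Weights

/-! ### Parseval's identity and regularity -/

section Parseval

variable {d : ℕ}

lemma hasSum_inner_fourC (f f' : Lp ℂ 2 (volume : Measure (Torus d))) :
    HasSum (fun k => starRingEnd ℂ (fourC f k) * fourC f' k) (inner ℂ f f') := by
  have h := (fourierBasis d).hasSum_inner_mul_inner f f'
  refine h.congr_fun fun k => ?_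
  rw [← fourierBasis_repr, ← fourierBasis_repr, HilbertBasis.repr_apply_apply,
    HilbertBasis.repr_apply_apply, inner_conj_symm]

lemma hasSum_sq_fourC (f : Lp ℂ 2 (volume : Measure (Torus d))) :
    HasSum (fun k => ‖fourC f k‖ ^ 2) (‖f‖ ^ 2) := by
  have h := hasSum_inner_fourC f f
  rw [inner_self_eq_norm_sq_to_K] at h
  have h2 := Complex.hasSum_re h
  have h3 : ((‖f‖ : ℂ) ^ 2).re = ‖f‖ ^ 2 := by rw [← Complex.ofReal_pow, Complex.ofReal_re]
  have h4 : ∀ z : ℂ, (starRingEnd ℂ z * z).re = ‖z‖ ^ 2 := fun z => by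
    rw [← Complex.normSq_eq_conj_mul_self, Complex.ofReal_re, Complex.normSq_eq_norm_sq]
  simp only [h4] at h2
  rw [← h3]
  exact h2

/-- A real square-integrable function as an element of the complex `L²` space. -/
def toL2 {f : Torus d → ℝ} (hf : MemLp f 2 (volume : Measure (Torus d))) :
    Lp ℂ 2 (volume : Measure (Torus d)) := hf.ofReal.toLp

lemma coeFn_toL2 {f : Torus d → ℝ} (hf : MemLp f 2 (volume : Measure (Torus d))) :
    toL2 hf =ᵐ[volume] fun x => (f x : ℂ) := MemLp.coeFn_toLp _

lemma fourC_toL2 {f : Torus d → ℝ} (hf : MemLp f 2 (volume : Measure (Torus d)))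
    (k : Fin d → ℤ) : fourC (toL2 hf) k = four f k :=
  fourC_congr (coeFn_toL2 hf) k

lemma inner_toL2 {f : Torus d → ℝ} (hf : MemLp f 2 (volume : Measure (Torus d)))
    (G : Lp ℂ 2 (volume : Measure (Torus d))) :
    inner ℂ (toL2 hf) G = ∫ x, G x * (f x : ℂ) := by
  rw [L2.inner_def]
  refine integral_congr_ae ?_
  filter_upwards [coeFn_toL2 hf] with x hx
  rw [hx, RCLike.inner_apply, Complex.conj_ofReal]

lemma hasSum_four_mul {f f' : Torus d → ℝ} (hf : MemLp f 2 (volume : Measure (Torus d)))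
    (hf' : MemLp f' 2 (volume : Measure (Torus d))) :
    HasSum (fun k => starRingEnd ℂ (four f k) * four f' k) ((∫ x, f' x * f x : ℝ) : ℂ) := by
  have h := hasSum_inner_fourC (toL2 hf) (toL2 hf')
  simp only [fourC_toL2] at h
  convert h using 1
  rw [inner_toL2, ← integral_complex_ofReal]
  refine integral_congr_ae ?_
  filter_upwards [coeFn_toL2 hf'] with x hx
  rw [hx]; push_cast; rfl

lemma hasSum_sq_four {f : Torus d → ℝ} (hf : MemLp f 2 (volume : Measure (Torus d))) :
    HasSum (fun k => ‖four f k‖ ^ 2) (∫ x, f x ^ 2) := by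
  have h2 := Complex.hasSum_re (hasSum_four_mul hf hf)
  have h4 : ∀ z : ℂ, (starRingEnd ℂ z * z).re = ‖z‖ ^ 2 := fun z => by
    rw [← Complex.normSq_eq_conj_mul_self, Complex.ofReal_re, Complex.normSq_eq_norm_sq]
  simpa only [h4, Complex.ofReal_re, ← pow_two] using h2

lemma _root_.Continuous.memLp_torus {f : Torus d → ℝ} (hf : Continuous f) (q : ENNReal) :
    MemLp f q (volume : Measure (Torus d)) := by
  obtain ⟨C, hC⟩ := isCompact_univ.exists_bound_of_continuousOn hf.continuousOn
  exact MemLp.of_bound hf.aestronglyMeasurable C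
    (Filter.Eventually.of_forall fun x => hC x (Set.mem_univ x))

/-- By Parseval the difference has zero L² norm, and continuous functions that agree almost
everywhere agree because Lebesgue measure charges open sets. -/
lemma eq_of_four_eq {f f' : Torus d → ℝ} (hf : Continuous f) (hf' : Continuous f')
    (h : ∀ k, four f k = four f' k) : f = f' := by
  have hc : Continuous fun x => f x - f' x := hf.sub hf'
  have h1 := hasSum_sq_four (hc.memLp_torus 2)
  have h2 : ∀ k, four (fun x => f x - f' x) k = 0 := fun k => by
    rw [four_sub hf.integrable_torus hf'.integrable_torus, h k, sub_self]
  simp only [h2, norm_zero, ne_eq, OfNat.ofNat_ne_zero, not_false_eq_true, zero_pow] at h1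
  have h3 : ∫ x, (f x - f' x) ^ 2 = 0 := h1.unique hasSum_zero
  have hi : Integrable (fun x => (f x - f' x) ^ 2) (volume : Measure (Torus d)) :=
    (hc.pow 2).integrable_torus
  have h4 := (integral_eq_zero_iff_of_nonneg (fun x => sq_nonneg _) hi).1 h3
  refine (Continuous.ae_eq_iff_eq (volume : Measure (Torus d)) hf hf').1 ?_
  filter_upwards [h4] with x hx
  simpa [sub_eq_zero] using hx

lemma summable_four_of_InH {f : Torus d → ℝ} {s : ℕ} (h : InH s (four f)) (hs : d < 2 * s) :
    Summable (fun k => ‖four f k‖) ∧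
      ∑' k, ‖four f k‖ ≤ embConst d s 0 * √(hsum s (four f)) := by
  simpa using h.summable (n := 0) (by omega)

lemma abs_le_tsum_four {f : Torus d → ℝ} (hf : Continuous f)
    (hs : Summable fun k => ‖four f k‖) (x : Torus d) : |f x| ≤ ∑' k, ‖four f k‖ := by
  have h := hasSum_fourC (f := fun x => (f x : ℂ)) (continuous_ofReal.comp hf) hs.of_norm x
  have h1 : ∀ k, ‖fourC (fun x => (f x : ℂ)) k * mFourier k x‖ = ‖four f k‖ := fun k => by
    rw [norm_mul, norm_mFourier_apply, mul_one]; rfl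
  have := norm_tsum_le_tsum_norm (f := fun k => fourC (fun x => (f x : ℂ)) k * mFourier k x)
    (by simpa only [h1] using hs)
  rw [h.tsum_eq] at this
  simpa only [h1, Complex.norm_real, Real.norm_eq_abs] using this

lemma mFourier_proj (k : Fin d → ℤ) (y : Fin d → ℝ) :
    mFourier k (proj y) = exp (((2 * Real.pi * ∑ i, (k i : ℝ) * y i : ℝ) : ℂ) * I) := by
  simp only [mFourier, ContinuousMap.coe_mk, proj, fourier_coe_apply]
  rw [← exp_sum]
  congr 1
  push_cast
  rw [Finset.mul_sum, Finset.sum_mul]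
  refine Finset.sum_congr rfl fun i _ => ?_
  ring

/-- The phase `y ↦ 2π k·y`. -/
def phase {d : ℕ} (k : Fin d → ℤ) : (Fin d → ℝ) →L[ℝ] ℝ :=
  ∑ i, (2 * Real.pi * (k i : ℝ)) • ContinuousLinearMap.proj (R := ℝ) (φ := fun _ => ℝ) i

lemma phase_apply (k : Fin d → ℤ) (y : Fin d → ℝ) :
    phase k y = 2 * Real.pi * ∑ i, (k i : ℝ) * y i := by
  simp [phase, Finset.mul_sum, mul_assoc]

lemma norm_phase_le (k : Fin d → ℤ) : ‖phase k‖ ≤ 2 * Real.pi * d * wt k := by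
  have hw := wt_pos k
  refine ContinuousLinearMap.opNorm_le_bound _ (by positivity) fun y => ?_
  rw [phase_apply, norm_mul, Real.norm_of_nonneg (by positivity)]
  have : ‖∑ i, (k i : ℝ) * y i‖ ≤ d * (wt k * ‖y‖) := by
    refine (norm_sum_le _ _).trans ?_
    calc ∑ i, ‖(k i : ℝ) * y i‖ ≤ ∑ _i : Fin d, wt k * ‖y‖ := by
          refine Finset.sum_le_sum fun i _ => ?_
          rw [norm_mul]
          exact mul_le_mul (abs_le_wt k i) (norm_le_pi_norm y i) (norm_nonneg _) hw.le
      _ = _ := by simp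
  calc 2 * Real.pi * ‖∑ i, (k i : ℝ) * y i‖ ≤ 2 * Real.pi * (d * (wt k * ‖y‖)) := by gcongr
    _ = _ := by ring

lemma contDiff_expI : ContDiff ℝ ∞ fun t : ℝ => exp ((t : ℂ) * I) :=
  ((Complex.ofRealCLM.contDiff).mul contDiff_const).cexp

lemma norm_iteratedFDeriv_expI (n : ℕ) (t : ℝ) :
    ‖iteratedFDeriv ℝ n (fun t : ℝ => exp ((t : ℂ) * I)) t‖ = 1 := by
  rw [norm_iteratedFDeriv_eq_norm_iteratedDeriv]
  have : ∀ n, iteratedDeriv n (fun t : ℝ => exp ((t : ℂ) * I)) =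
      fun t : ℝ => I ^ n * exp ((t : ℂ) * I) := by
    intro n
    induction n with
    | zero => simp
    | succ n ih =>
      rw [iteratedDeriv_succ, ih]
      funext t
      have h : HasDerivAt (fun t : ℝ => I ^ n * exp ((t : ℂ) * I)) (I ^ n * (exp (t * I) * (1 * I))) t :=
        ((((hasDerivAt_id t).ofReal_comp).mul_const I).cexp).const_mul _
      rw [h.deriv]
      ring
  rw [this]
  simp [Complex.norm_exp_ofReal_mul_I]

lemma contDiff_mFourier_proj (k : Fin d → ℤ) :
    ContDiff ℝ ∞ fun y : Fin d → ℝ => mFourier k (proj y) := by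
  simp only [mFourier_proj, ← phase_apply]
  exact contDiff_expI.comp (phase k).contDiff

/-- A character is t ↦ e^{it}, all of whose derivatives have norm one, composed with a linear form
of norm at most 2πd·wt(k). -/
lemma norm_iteratedFDeriv_mFourier_le (k : Fin d → ℤ) (n : ℕ) (y : Fin d → ℝ) :
    ‖iteratedFDeriv ℝ n (fun y : Fin d → ℝ => mFourier k (proj y)) y‖ ≤
      (2 * Real.pi * d * wt k) ^ n := by
  have h1 : (fun y : Fin d → ℝ => mFourier k (proj y)) =
      (fun t : ℝ => exp ((t : ℂ) * I)) ∘ phase k := by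
    funext y
    simp only [mFourier_proj, ← phase_apply, Function.comp_apply]
  rw [h1, ContinuousLinearMap.iteratedFDeriv_comp_right _ contDiff_expI _ (i := n) (by exact_mod_cast le_top)]
  refine (ContinuousMultilinearMap.norm_compContinuousLinearMap_le _ _).trans ?_
  rw [norm_iteratedFDeriv_expI, one_mul, Finset.prod_const, Finset.card_univ, Fintype.card_fin]
  exact pow_le_pow_left₀ (norm_nonneg _) (norm_phase_le k) n

lemma isC_of_summable {f : Torus d → ℝ} (hf : Continuous f) {n : ℕ}
    (hs : Summable fun k => wt k ^ n * ‖four f k‖) : IsC n f := by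
  have hs0 : Summable fun k => ‖four f k‖ := by
    refine Summable.of_nonneg_of_le (fun k => norm_nonneg _) (fun k => ?_) hs
    exact le_mul_of_one_le_left (norm_nonneg _) (one_le_pow₀ (one_le_wt k))
  have h1 : ∀ y : Fin d → ℝ, f (proj y) = (∑' k, four f k * mFourier k (proj y)).re := fun y => by
    have h : HasSum (fun k => four f k * mFourier k (proj y)) (f (proj y) : ℂ) :=
      hasSum_fourC (f := fun x => (f x : ℂ)) (continuous_ofReal.comp hf) hs0.of_norm (proj y)
    rw [h.tsum_eq, Complex.ofReal_re]
  unfold IsC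
  simp only [h1]
  refine Complex.reCLM.contDiff.comp ?_
  refine contDiff_tsum (N := (n : ℕ∞))
    (v := fun j k => (2 * Real.pi * d) ^ j * (wt k ^ n * ‖four f k‖))
    (fun k => contDiff_const.mul ((contDiff_mFourier_proj k).of_le (by exact_mod_cast le_top)))
    (fun j hj => hs.mul_left _) ?_
  intro j k y hj
  have hj' : j ≤ n := by exact_mod_cast hj
  have h2 : (fun y : Fin d → ℝ => four f k * mFourier k (proj y)) =
      four f k • fun y : Fin d → ℝ => mFourier k (proj y) := rfl
  rw [h2, iteratedFDeriv_const_smul_apply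
    ((contDiff_mFourier_proj k).of_le (by exact_mod_cast le_top)).contDiffAt, norm_smul]
  calc ‖four f k‖ * ‖iteratedFDeriv ℝ j (fun y : Fin d → ℝ => mFourier k (proj y)) y‖
      ≤ ‖four f k‖ * (2 * Real.pi * d * wt k) ^ j := by
        gcongr
        exact norm_iteratedFDeriv_mFourier_le k j y
    _ = (2 * Real.pi * d) ^ j * (wt k ^ j * ‖four f k‖) := by rw [mul_pow]; ring
    _ ≤ _ := by
        gcongr
        exact one_le_wt k

lemma IsC.pd_iterate {n j : ℕ} {f : Torus d → ℝ} (hf : IsC (n + j : ℕ) f) (i : Fin d) :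
    IsC n ((RegMFG.pd i)^[j] f) := by
  induction j generalizing f with
  | zero => simpa using hf
  | succ j ih =>
    rw [Function.iterate_succ_apply]
    exact ih (IsC.pd (n := (n + j : ℕ)) (by exact_mod_cast hf) i)

lemma four_pd_iterate {n : ℕ} {f : Torus d → ℝ} (hf : IsC n f) (i : Fin d) (k : Fin d → ℤ) :
    four ((pd i)^[n] f) k = (2 * Real.pi * I * k i) ^ n * four f k := by
  induction n with
  | zero => simp
  | succ n ih =>
    rw [Function.iterate_succ_apply', four_pd, ih (hf.of_le (by exact_mod_cast Nat.le_succ n))]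
    · ring
    · exact IsC.pd_iterate (n := 1) (j := n) (by rwa [add_comm]) i

lemma norm_symbol (k : Fin d → ℤ) (i : Fin d) :
    ‖(2 * Real.pi * I * k i : ℂ)‖ = 2 * Real.pi * |(k i : ℝ)| := by
  simp [abs_of_pos Real.pi_pos]

lemma abs_le_norm_symbol (k : Fin d → ℤ) (i : Fin d) :
    |(k i : ℝ)| ≤ ‖(2 * Real.pi * I * k i : ℂ)‖ := by
  rw [norm_symbol]
  nlinarith [Real.pi_gt_three, abs_nonneg (k i : ℝ)]

lemma norm_symbol_le (k : Fin d → ℤ) (i : Fin d) :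
    ‖(2 * Real.pi * I * k i : ℂ)‖ ≤ 2 * Real.pi * wt k := by
  rw [norm_symbol]
  exact mul_le_mul_of_nonneg_left (abs_le_wt k i) (by positivity)

/-- Parseval for f and for the pure derivatives ∂_i^n f, combined through `wt_pow_le`. -/
lemma IsC.inH {n : ℕ} {f : Torus d → ℝ} (hf : IsC n f) : InH n (four f) := by
  have h1 : ∀ i, Summable fun k => ‖(2 * Real.pi * I * k i) ^ n * four f k‖ ^ 2 := fun i => by
    have hc : Continuous ((RegMFG.pd i)^[n] f) :=
      (IsC.pd_iterate (n := 0) (j := n) (by rwa [zero_add]) i).continuous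
    have := (hasSum_sq_four (hc.memLp_torus 2)).summable
    simpa only [four_pd_iterate hf i] using this
  have h0 := (hasSum_sq_four (hf.continuous.memLp_torus 2)).summable
  have h2 : Summable fun k => ‖four f k‖ ^ 2 + ∑ i, ‖(2 * Real.pi * I * k i) ^ n * four f k‖ ^ 2 :=
    h0.add (summable_sum fun i _ => h1 i)
  refine Summable.of_nonneg_of_le (fun k => by have := wt_pos k; positivity) (fun k => ?_)
    (h2.mul_left (2 ^ (2 * n)))
  calc wt k ^ (2 * n) * ‖four f k‖ ^ 2
      ≤ 2 ^ (2 * n) * (1 + ∑ i, |(k i : ℝ)| ^ (2 * n)) * ‖four f k‖ ^ 2 := by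
        gcongr
        exact wt_pow_le k _
    _ = 2 ^ (2 * n) * (‖four f k‖ ^ 2 + ∑ i, (|(k i : ℝ)| ^ n * ‖four f k‖) ^ 2) := by
        rw [mul_assoc, add_mul, one_mul, Finset.sum_mul]
        congr 2
        refine Finset.sum_congr rfl fun i _ => ?_
        ring
    _ ≤ _ := by
        gcongr with i
        rw [norm_mul, norm_pow]
        gcongr
        exact abs_le_norm_symbol k i

end Parseval

end RegMFG
end

noncomputable section

namespace RegMFG

open Complex UnitAddTorus

/-! ### Fourier description of the Sobolev spaces -/

section Trig

variable {d : ℕ}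

/-- The real trigonometric function `Re (c e_k)`. -/
def trig {d : ℕ} (c : ℂ) (k : Fin d → ℤ) (x : Torus d) : ℝ := (c * mFourier k x).re

lemma isSmooth_trig (c : ℂ) (k : Fin d → ℤ) : IsSmooth (trig c k) :=
  Complex.reCLM.contDiff.comp (contDiff_const.mul (contDiff_mFourier_proj k))

lemma pd_trig (c : ℂ) (k : Fin d → ℤ) (i : Fin d) :
    pd i (trig c k) = trig (2 * Real.pi * I * k i * c) k := by
  funext x
  refine pd_eq_of_hasDerivAt ?_
  have h1 : (fun s : ℝ => trig c k (x + Pi.single i (s : UnitAddCircle))) =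
      fun s : ℝ => (c * mFourier k x * exp (2 * Real.pi * I * k i * s)).re := by
    funext s
    simp only [trig, mFourier_add_single, mul_assoc]
  rw [h1]
  have h2 : HasDerivAt (fun s : ℝ => c * mFourier k x * exp (2 * Real.pi * I * k i * s))
      (2 * Real.pi * I * k i * c * mFourier k x) 0 := by
    have := ((((hasDerivAt_id (0 : ℝ)).ofReal_comp).const_mul (2 * Real.pi * I * k i)).cexp).const_mul
      (c * mFourier k x)
    refine this.congr_deriv ?_
    simp
    ring
  exact Complex.reCLM.hasFDerivAt.comp_hasDerivAt (0 : ℝ) h2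

/-- A real pairing sees only real parts; letting c run over 1 and i recovers the complex
coefficient. This is how real test functions are used to read off Fourier coefficients below. -/
lemma integral_mul_trig {f : Torus d → ℝ} (hf : Integrable f volume) (c : ℂ) (k : Fin d → ℤ) :
    ∫ x, f x * trig c (-k) x = (c * four f k).re := by
  have h1 : c * four f k = ∫ x, c * (mFourier (-k) x * (f x : ℂ)) := by
    rw [integral_const_mul]; rfl
  rw [h1, ← Complex.reCLM_apply, ← Complex.reCLM.integral_comp_comm
    ((integrable_mFourier_mul_ofReal hf _).const_mul c)]
  congr 1
  funext x
  simp only [trig, Complex.reCLM_apply]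
  rw [← mul_assoc, Complex.re_mul_ofReal, mul_comm]

/-- The symbol `(2πik)^α` of `∂^α`. -/
def symb {d κ : ℕ} (α : MultiIdx d κ) (k : Fin d → ℤ) : ℂ :=
  ∏ i, (2 * Real.pi * I * k i) ^ (α.1 i : ℕ)

lemma pd_iterate_trig (c : ℂ) (k : Fin d → ℤ) (i : Fin d) (n : ℕ) :
    (pd i)^[n] (trig c k) = trig ((2 * Real.pi * I * k i) ^ n * c) k := by
  induction n with
  | zero => simp
  | succ n ih => rw [Function.iterate_succ_apply', ih, pd_trig]; congr 1; ring

lemma pdMulti_trig {κ : ℕ} (α : MultiIdx d κ) (c : ℂ) (k : Fin d → ℤ) :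
    pdMulti α (trig c k) = trig (symb α k * c) k := by
  have key : ∀ l : List (Fin d), l.foldr (fun i ψ => (pd i)^[(α.1 i : ℕ)] ψ) (trig c k) =
      trig ((l.map fun i => (2 * Real.pi * I * k i : ℂ) ^ (α.1 i : ℕ)).prod * c) k := by
    intro l
    induction l with
    | nil => simp
    | cons i l ih =>
      rw [List.foldr_cons, ih, pd_iterate_trig, List.map_cons, List.prod_cons]
      congr 1
      ring
  rw [pdMulti, key, symb, Fin.prod_univ_def]

lemma IsSmooth.pd_iterate {f : Torus d → ℝ} (hf : IsSmooth f) (i : Fin d) (n : ℕ) :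
    IsSmooth ((RegMFG.pd i)^[n] f) := by
  induction n with
  | zero => exact hf
  | succ n ih => rw [Function.iterate_succ_apply']; exact ih.pd i

lemma four_pdMulti {κ : ℕ} (α : MultiIdx d κ) {f : Torus d → ℝ} (hf : IsSmooth f)
    (k : Fin d → ℤ) : four (pdMulti α f) k = symb α k * four f k := by
  have key : ∀ l : List (Fin d), IsSmooth (l.foldr (fun i ψ => (pd i)^[(α.1 i : ℕ)] ψ) f) ∧
      four (l.foldr (fun i ψ => (pd i)^[(α.1 i : ℕ)] ψ) f) k =
      (l.map fun i => (2 * Real.pi * I * k i : ℂ) ^ (α.1 i : ℕ)).prod * four f k := by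
    intro l
    induction l with
    | nil => exact ⟨hf, by simp⟩
    | cons i l ih =>
      refine ⟨ih.1.pd_iterate i _, ?_⟩
      rw [List.foldr_cons, four_pd_iterate (ih.1.isC.of_le (by exact_mod_cast le_top)), ih.2,
        List.map_cons, List.prod_cons]
      ring
  rw [pdMulti, (key _).2, symb, Fin.prod_univ_def]

lemma symb_neg {κ : ℕ} (α : MultiIdx d κ) (k : Fin d → ℤ) :
    symb α (-k) = (-1) ^ α.len * symb α k := by
  unfold symb MultiIdx.len
  rw [← Finset.prod_pow_eq_pow_sum, ← Finset.prod_mul_distrib]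
  refine Finset.prod_congr rfl fun i _ => ?_
  rw [← mul_pow]
  congr 1
  simp

lemma conj_symb {κ : ℕ} (α : MultiIdx d κ) (k : Fin d → ℤ) :
    starRingEnd ℂ (symb α k) = (-1) ^ α.len * symb α k := by
  rw [← symb_neg]
  unfold symb
  rw [map_prod]
  refine Finset.prod_congr rfl fun i _ => ?_
  rw [map_pow]
  congr 1
  simp [Complex.conj_ofNat]

lemma symb_zero {κ : ℕ} (k : Fin d → ℤ) : symb (MultiIdx.zero d κ) k = 1 := by
  simp [symb, MultiIdx.zero]

lemma norm_symb_le {κ : ℕ} (α : MultiIdx d κ) (k : Fin d → ℤ) :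
    ‖symb α k‖ ≤ (2 * Real.pi * wt k) ^ κ := by
  have h1 : 1 ≤ 2 * Real.pi * wt k := by
    have := one_le_wt k
    nlinarith [Real.pi_gt_three]
  unfold symb
  rw [norm_prod]
  calc ∏ i, ‖(2 * Real.pi * I * k i : ℂ) ^ (α.1 i : ℕ)‖
      ≤ ∏ i, (2 * Real.pi * wt k) ^ (α.1 i : ℕ) := by
        refine Finset.prod_le_prod (fun i _ => norm_nonneg _) fun i _ => ?_
        rw [norm_pow]
        exact pow_le_pow_left₀ (norm_nonneg _) (norm_symbol_le k i) _
    _ = (2 * Real.pi * wt k) ^ (∑ i, (α.1 i : ℕ)) := by rw [Finset.prod_pow_eq_pow_sum]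
    _ ≤ _ := pow_le_pow_right₀ h1 α.2

/-- The multi-index `κ e_i`. -/
def MultiIdx.single (d κ : ℕ) (i : Fin d) : MultiIdx d κ :=
  ⟨fun j => if j = i then Fin.last κ else 0, by
    have : ∀ j, ((if j = i then Fin.last κ else 0 : Fin (κ + 1)) : ℕ) = if j = i then κ else 0 :=
      fun j => by split_ifs <;> simp
    simp [this]⟩

lemma symb_single {κ : ℕ} (i : Fin d) (k : Fin d → ℤ) :
    symb (MultiIdx.single d κ i) k = (2 * Real.pi * I * k i) ^ κ := by
  unfold symb MultiIdx.single
  rw [Finset.prod_eq_single i]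
  · simp
  · intro j _ hj
    simp [hj]
  · simp

end Trig

/-! ### The space `Sobolev` described by weighted Fourier coefficients -/

section SobolevFourier

variable {d κ : ℕ}

/-- The defining weak identity is tested with trigonometric functions of frequency -k. The sign from
the symbol at -k cancels the sign of the integrations by parts. -/
lemma four_sobolev (G : Sobolev d κ) (α : MultiIdx d κ) (k : Fin d → ℤ) :
    four (G.1 α) k = symb α k * four (sobFn G) k := by
  have hInt : ∀ β : MultiIdx d κ, Integrable (G.1 β) (volume : Measure (Torus d)) := fun β =>
    (Lp.memLp (G.1 β)).integrable (by norm_num)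
  have h : ∀ c : ℂ, (c * (symb α k * four (sobFn G) k)).re = (c * four (G.1 α) k).re := by
    intro c
    have h1 := G.2 α (trig c (-k)) (isSmooth_trig c _)
    rw [pdMulti_trig, integral_mul_trig (hInt _), integral_mul_trig (hInt _), symb_neg] at h1
    have h2 : (-1 : ℂ) ^ α.len * symb α k * c * four (G.1 (MultiIdx.zero d κ)) k =
        (((-1 : ℝ) ^ α.len : ℝ) : ℂ) * (c * (symb α k * four (sobFn G) k)) := by
      push_cast
      unfold sobFn
      ring
    rw [h2, Complex.re_ofReal_mul] at h1
    exact mul_left_cancel₀ (pow_ne_zero _ (by norm_num)) h1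
  apply Complex.ext
  · simpa using (h 1).symm
  · have := (h I).symm
    simpa only [Complex.I_mul_re, neg_inj] using this

lemma norm_sobolev_apply_le (G : Sobolev d κ) (α : MultiIdx d κ) : ‖G.1 α‖ ≤ ‖G‖ :=
  PiLp.norm_apply_le G.1 α

lemma hasSum_sq_four_lp (a : Lp ℝ 2 (volume : Measure (Torus d))) :
    HasSum (fun k => ‖four a k‖ ^ 2) (‖a‖ ^ 2) := by
  convert hasSum_sq_four (Lp.memLp a) using 1
  rw [← real_inner_self_eq_norm_sq, L2.inner_def]
  refine integral_congr_ae (Filter.Eventually.of_forall fun x => ?_)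
  simp [pow_two]

/-- Only the components of index 0 and κe_i are needed, by `wt_pow_le`. -/
lemma sobolev_inH (G : Sobolev d κ) :
    InH κ (four (sobFn G)) ∧ hsum κ (four (sobFn G)) ≤ 2 ^ (2 * κ) * (1 + d) * ‖G‖ ^ 2 := by
  have h1 : ∀ i : Fin d, HasSum (fun k => ‖(2 * Real.pi * I * k i : ℂ) ^ κ * four (sobFn G) k‖ ^ 2)
      (‖G.1 (MultiIdx.single d κ i)‖ ^ 2) := fun i => by
    have := hasSum_sq_four_lp (G.1 (MultiIdx.single d κ i))
    simpa only [four_sobolev, symb_single] using this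
  have h0 : HasSum (fun k => ‖four (sobFn G) k‖ ^ 2) (‖G.1 (MultiIdx.zero d κ)‖ ^ 2) :=
    hasSum_sq_four_lp _
  have h2 := (h0.add (hasSum_sum (s := Finset.univ) fun i _ => h1 i)).mul_left (2 ^ (2 * κ))
  have hle : ∀ k, wt k ^ (2 * κ) * ‖four (sobFn G) k‖ ^ 2 ≤ 2 ^ (2 * κ) *
      (‖four (sobFn G) k‖ ^ 2 +
        ∑ i, ‖(2 * Real.pi * I * k i : ℂ) ^ κ * four (sobFn G) k‖ ^ 2) := fun k => by
    calc wt k ^ (2 * κ) * ‖four (sobFn G) k‖ ^ 2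
        ≤ 2 ^ (2 * κ) * (1 + ∑ i, |(k i : ℝ)| ^ (2 * κ)) * ‖four (sobFn G) k‖ ^ 2 := by
          gcongr
          exact wt_pow_le k _
      _ = 2 ^ (2 * κ) * (‖four (sobFn G) k‖ ^ 2 +
            ∑ i, (|(k i : ℝ)| ^ κ * ‖four (sobFn G) k‖) ^ 2) := by
          rw [mul_assoc, add_mul, one_mul, Finset.sum_mul]
          congr 2
          refine Finset.sum_congr rfl fun i _ => ?_
          ring
      _ ≤ _ := by
          gcongr with i
          rw [norm_mul, norm_pow]
          gcongr
          exact abs_le_norm_symbol k i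
  have hs : InH κ (four (sobFn G)) :=
    Summable.of_nonneg_of_le (fun k => by have := wt_pos k; positivity) hle h2.summable
  refine ⟨hs, (hs.tsum_le_tsum hle h2.summable).trans ?_⟩
  rw [h2.tsum_eq, mul_assoc]
  gcongr
  calc ‖G.1 (MultiIdx.zero d κ)‖ ^ 2 + ∑ i : Fin d, ‖G.1 (MultiIdx.single d κ i)‖ ^ 2
      ≤ ‖G‖ ^ 2 + ∑ _i : Fin d, ‖G‖ ^ 2 := by
        gcongr
        · exact norm_sobolev_apply_le G _
        · exact norm_sobolev_apply_le G _
    _ = _ := by simp; ring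

/-- The constant of the Sobolev embedding `W^{κ,2} ⊂ C⁰`. -/
def sobConst (d κ : ℕ) : ℝ := embConst d κ 0 * √(2 ^ (2 * κ) * (1 + d))

lemma sobConst_nonneg (d κ : ℕ) : 0 ≤ sobConst d κ :=
  mul_nonneg (Real.sqrt_nonneg _) (Real.sqrt_nonneg _)

lemma abs_le_sobolev_norm (hκ : d < 2 * κ) (G : Sobolev d κ) {f : Torus d → ℝ} (hf : Continuous f)
    (hG : sobFn G =ᵐ[volume] f) (x : Torus d) : |f x| ≤ sobConst d κ * ‖G‖ := by
  have hfour : four (sobFn G) = four f := funext fun k => four_congr hG k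
  have h1 := sobolev_inH G
  rw [hfour] at h1
  have h2 := summable_four_of_InH h1.1 hκ
  refine (abs_le_tsum_four hf h2.1 x).trans (h2.2.trans ?_)
  have h3 : √(hsum κ (four f)) ≤ √(2 ^ (2 * κ) * (1 + d)) * ‖G‖ := by
    rw [← Real.sqrt_sq (norm_nonneg G), ← Real.sqrt_mul (by positivity)]
    exact Real.sqrt_le_sqrt h1.2
  unfold sobConst
  rw [mul_assoc]
  exact mul_le_mul_of_nonneg_left h3 (Real.sqrt_nonneg _)

lemma sobFn_add (G G' : Sobolev d κ) : sobFn (G + G') =ᵐ[volume] fun x => sobFn G x + sobFn G' x :=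
  Lp.coeFn_add _ _

lemma sobFn_sub (G G' : Sobolev d κ) : sobFn (G - G') =ᵐ[volume] fun x => sobFn G x - sobFn G' x :=
  Lp.coeFn_sub _ _

lemma sobFn_smul (c : ℝ) (G : Sobolev d κ) : sobFn (c • G) =ᵐ[volume] fun x => c * sobFn G x :=
  Lp.coeFn_smul _ _

lemma sobFn_zero : sobFn (0 : Sobolev d κ) =ᵐ[volume] fun _ => 0 :=
  Lp.coeFn_zero _ _ _

lemma sobFn_sum {ι : Type*} (s : Finset ι) (G : ι → Sobolev d κ) :
    sobFn (∑ j ∈ s, G j) =ᵐ[volume] fun x => ∑ j ∈ s, sobFn (G j) x := by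
  classical
  induction s using Finset.induction_on with
  | empty => simpa using sobFn_zero
  | insert a s ha ih =>
    rw [Finset.sum_insert ha]
    filter_upwards [sobFn_add (G a) (∑ j ∈ s, G j), ih] with x h1 h2
    rw [h1, h2, Finset.sum_insert ha]

lemma exists_lp_of_summable {c : (Fin d → ℤ) → ℂ} (hc : Summable fun k => ‖c k‖ ^ 2) :
    ∃ a : Lp ℂ 2 (volume : Measure (Torus d)), (∀ k, fourC a k = c k) := by
  have hm : Memℓp c 2 := memℓp_gen (by simpa using hc)
  refine ⟨(fourierBasis d).repr.symm ⟨c, hm⟩, fun k => ?_⟩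
  rw [← fourierBasis_repr]
  simp

/-- The constant of the converse of the Fourier characterization of `W^{κ,2}`. -/
def fourConst (d κ : ℕ) : ℝ := Fintype.card (MultiIdx d κ) * (2 * Real.pi) ^ (2 * κ)

/-- Converse of `sobolev_inH`: the candidate for D^α f is the L² function whose coefficients are
those of f times the symbol of ∂^α, and Parseval turns the weak identity into an identity of
coefficients. -/
lemma exists_sobolev {f : Torus d → ℝ} (hf : Continuous f) (h : InH κ (four f)) :
    ∃ G : Sobolev d κ, sobFn G =ᵐ[volume] f ∧ ‖G‖ ^ 2 ≤ fourConst d κ * hsum κ (four f) := by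
  have hle : ∀ (α : MultiIdx d κ) k, ‖symb α k * four f k‖ ^ 2 ≤
      (2 * Real.pi) ^ (2 * κ) * (wt k ^ (2 * κ) * ‖four f k‖ ^ 2) := fun α k => by
    rw [norm_mul, mul_pow, ← mul_assoc]
    gcongr
    calc ‖symb α k‖ ^ 2 ≤ ((2 * Real.pi * wt k) ^ κ) ^ 2 :=
          pow_le_pow_left₀ (norm_nonneg _) (norm_symb_le α k) 2
      _ = _ := by rw [← pow_mul, mul_comm κ 2, mul_pow]
  have hsα : ∀ α : MultiIdx d κ, Summable fun k => ‖symb α k * four f k‖ ^ 2 := fun α =>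
    Summable.of_nonneg_of_le (fun k => sq_nonneg _) (hle α) (h.mul_left _)
  choose a ha using fun α => exists_lp_of_summable (hsα α)
  have hnorm : ∀ α, ‖a α‖ ^ 2 ≤ (2 * Real.pi) ^ (2 * κ) * hsum κ (four f) := fun α => by
    have h1 := hasSum_sq_fourC (a α)
    simp only [ha] at h1
    rw [← h1.tsum_eq]
    refine ((hsα α).tsum_le_tsum (hle α) (h.mul_left _)).trans ?_
    rw [tsum_mul_left]
    rfl
  -- Taking real parts produces real components without having to check that the functions `a α` are
  -- real-valued; pairings with real functions commute with this operation.
  let g : MultiIdx d κ → Lp ℝ 2 (volume : Measure (Torus d)) := fun α =>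
    Complex.reCLM.compLp (a α)
  have hg : ∀ α, g α =ᵐ[volume] fun x => (a α x).re := fun α =>
    Complex.reCLM.coeFn_compLp (a α)
  have hgn : ∀ α, ‖g α‖ ≤ ‖a α‖ := fun α => by
    have := Complex.reCLM.norm_compLp_le (a α)
    rwa [Complex.reCLM_norm, one_mul] at this
  have hpair : ∀ (α : MultiIdx d κ) (ψ : Torus d → ℝ) (hψ : IsSmooth ψ),
      ∫ x, g α x * ψ x = (inner ℂ (toL2 (hψ.memLp 2)) (a α)).re := by
    intro α ψ hψ
    rw [inner_toL2, ← Complex.reCLM_apply, ← Complex.reCLM.integral_comp_comm]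
    · refine integral_congr_ae ?_
      filter_upwards [hg α] with x hx
      rw [hx, Complex.reCLM_apply, Complex.re_mul_ofReal]
    · exact (Lp.memLp (a α)).integrable_mul (hψ.memLp 2).ofReal
  have hzero : a (MultiIdx.zero d κ) = toL2 (hf.memLp_torus 2) := by
    refine (fourierBasis d).repr.injective (lp.ext (funext fun k => ?_))
    rw [fourierBasis_repr, fourierBasis_repr, ha, fourC_toL2, symb_zero, one_mul]
  refine ⟨⟨WithLp.toLp 2 g, ?_⟩, ?_, ?_⟩
  · intro α φ hφ
    change ∫ x, g (MultiIdx.zero d κ) x * pdMulti α φ x = (-1) ^ α.len * ∫ x, g α x * φ x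
    rw [hpair _ _ (hφ.pdMulti α), hpair _ _ hφ]
    have h1 := hasSum_inner_fourC (toL2 ((hφ.pdMulti α).memLp 2)) (a (MultiIdx.zero d κ))
    have h2 := (hasSum_inner_fourC (toL2 (hφ.memLp 2)) (a α)).mul_left ((-1 : ℂ) ^ α.len)
    have h3 : inner ℂ (toL2 ((hφ.pdMulti α).memLp 2)) (a (MultiIdx.zero d κ)) =
        (-1 : ℂ) ^ α.len * inner ℂ (toL2 (hφ.memLp 2)) (a α) := by
      refine h1.unique (h2.congr_fun fun k => ?_)
      rw [fourC_toL2, fourC_toL2, ha, ha, four_pdMulti α hφ, map_mul, conj_symb, symb_zero]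
      ring
    rw [h3]
    have : ((-1 : ℂ) ^ α.len) = (((-1 : ℝ) ^ α.len : ℝ) : ℂ) := by push_cast; rfl
    rw [this, Complex.re_ofReal_mul]
  · change g (MultiIdx.zero d κ) =ᵐ[volume] f
    filter_upwards [hg (MultiIdx.zero d κ), coeFn_toL2 (hf.memLp_torus 2)] with x h1 h2
    rw [h1, hzero, h2, Complex.ofReal_re]
  · change ‖WithLp.toLp 2 g‖ ^ 2 ≤ _
    rw [PiLp.norm_sq_eq_of_L2]
    calc ∑ α, ‖g α‖ ^ 2 ≤ ∑ _α : MultiIdx d κ, (2 * Real.pi) ^ (2 * κ) * hsum κ (four f) := by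
          refine Finset.sum_le_sum fun α _ => ?_
          exact (pow_le_pow_left₀ (norm_nonneg _) (hgn α) 2).trans (hnorm α)
      _ = _ := by simp [fourConst, mul_assoc]

end SobolevFourier

end RegMFG
end

noncomputable section

namespace RegMFG

open Filter Topology

/-! ### The nonlocal operator -/

section Nonlocal

variable {d : ℕ}

lemma bold_congr {m m' : Torus d → ℝ} (hm : m =ᵐ[volume] m') : bold m = bold m' := by
  by_cases h : Integrable m volume
  · have h' : Integrable m' volume := h.congr hm
    have e : bold m = ⟨volume.withDensity (fun x => ENNReal.ofReal (m x)),
      isFiniteMeasure_withDensity_ofReal h.2, withDensity_absolutelyContinuous _ _⟩ := dif_pos h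
    have e' : bold m' = ⟨volume.withDensity (fun x => ENNReal.ofReal (m' x)),
      isFiniteMeasure_withDensity_ofReal h'.2, withDensity_absolutelyContinuous _ _⟩ := dif_pos h'
    rw [e, e']
    refine Subtype.ext (withDensity_congr_ae ?_)
    filter_upwards [hm] with x hx
    rw [hx]
  · have h' : ¬ Integrable m' volume := fun h' => h (h'.congr hm.symm)
    have e : bold m = ⟨0, inferInstance, Measure.AbsolutelyContinuous.zero _⟩ := dif_neg h
    have e' : bold m' = ⟨0, inferInstance, Measure.AbsolutelyContinuous.zero _⟩ := dif_neg h'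
    rw [e, e']

lemma lt_two_mul_of_real {κ : ℕ} (hκ : (d : ℝ) / 2 + 1 < κ) : d + 2 < 2 * κ := by
  have : (d : ℝ) + 2 < 2 * κ := by linarith
  exact_mod_cast this

/-- Sobolev embedding turns closeness of h(𝐦) in W^{κ,2} into uniform closeness of the continuous
representatives. -/
lemma abs_nonlocal_sub_le {h : Mac d → C(Torus d, ℝ)} {κ : ℕ} (hκ : (d : ℝ) / 2 + 1 < κ)
    {F : Sobolev d κ → Sobolev d κ}
    (hF : ∀ m : Sobolev d κ, 0 ≤ᵐ[volume] sobFn m → sobFn (F m) =ᵐ[volume] h (bold (sobFn m)))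
    {m m' : Torus d → ℝ} (hm : ∀ x, 0 ≤ m x) (hm' : ∀ x, 0 ≤ m' x) {M M' : Sobolev d κ}
    (hM : sobFn M =ᵐ[volume] m) (hM' : sobFn M' =ᵐ[volume] m') (x : Torus d) :
    |h (bold m') x - h (bold m) x| ≤ sobConst d κ * ‖F M' - F M‖ := by
  have hpos : ∀ {m : Torus d → ℝ} {M : Sobolev d κ}, (∀ x, 0 ≤ m x) → sobFn M =ᵐ[volume] m →
      sobFn (F M) =ᵐ[volume] h (bold m) := by
    intro m M hm hM
    rw [← bold_congr hM]
    refine hF M ?_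
    filter_upwards [hM] with x hx
    rw [hx]
    exact hm x
  refine abs_le_sobolev_norm (by have := lt_two_mul_of_real hκ; omega) (F M' - F M)
    (f := fun x => h (bold m') x - h (bold m) x) ((map_continuous _).sub (map_continuous _)) ?_ x
  filter_upwards [sobFn_sub (F M') (F M), hpos hm hM, hpos hm' hM'] with x h1 h2 h3
  rw [h1, h2, h3]

lemma nonlocal_inH {h : Mac d → C(Torus d, ℝ)} (hh : AssumptionH h) {κ : ℕ}
    (hκ : (d : ℝ) / 2 + 1 < κ) {m : Torus d → ℝ} (hc : Continuous m) (hm : ∀ x, 0 ≤ m x)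
    (hH : InH κ (four m)) : InH κ (four (h (bold m))) := by
  obtain ⟨F, hF, -⟩ := hh κ hκ
  obtain ⟨M, hM, -⟩ := exists_sobolev hc hH
  have h1 : sobFn (F M) =ᵐ[volume] h (bold m) := by
    rw [← bold_congr hM]
    refine hF M ?_
    filter_upwards [hM] with x hx
    rw [hx]
    exact hm x
  have h2 := (sobolev_inH (F M)).1
  rwa [show four (sobFn (F M)) = four (h (bold m)) from funext fun k => four_congr h1 k] at h2

lemma IsSmooth.inH {f : Torus d → ℝ} (hf : IsSmooth f) (s : ℕ) : InH s (four f) :=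
  IsC.inH (hf.isC_nat s)

lemma isC_of_inH {f : Torus d → ℝ} (hf : Continuous f) {s n : ℕ} (h : InH s (four f))
    (hs : 2 * n + d < 2 * s) : IsC n f :=
  isC_of_summable hf (h.summable hs).1

lemma isSmooth_of_inH {f : Torus d → ℝ} (hf : Continuous f) {s₀ : ℕ}
    (h : ∀ s, s₀ ≤ s → InH s (four f)) : IsSmooth f :=
  isSmooth_of_forall fun n => isC_of_inH hf (h (s₀ + n + d + 1) (by omega)) (by omega)

/-- Assumption (h) holds for every large κ, so all Sobolev norms of h(𝐦) are finite. -/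
lemma isSmooth_nonlocal {h : Mac d → C(Torus d, ℝ)} (hh : AssumptionH h) {m : Torus d → ℝ}
    (hs : IsSmooth m) (hm : ∀ x, 0 ≤ m x) : IsSmooth (h (bold m)) := by
  refine isSmooth_of_inH (map_continuous _) (s₀ := d + 2) fun s hs' => ?_
  refine nonlocal_inH hh ?_ hs.continuous hm (hs.inH s)
  have : ((d + 2 : ℕ) : ℝ) ≤ s := by exact_mod_cast hs'
  push_cast at this
  have : (0 : ℝ) ≤ d := by positivity
  linarith

/-- Differentiability within the cone gives continuity within the cone, and all the approximants lie
in the cone. -/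
lemma tendsto_nonlocal {h : Mac d → C(Torus d, ℝ)} (hh : AssumptionH h) {κ : ℕ}
    (hκ : (d : ℝ) / 2 + 1 < κ) {m : Torus d → ℝ} (hc : Continuous m) (hm : ∀ x, 0 ≤ m x)
    (hH : InH κ (four m)) {mn : ℕ → Torus d → ℝ} (hcn : ∀ n, Continuous (mn n))
    (hmn : ∀ n x, 0 ≤ mn n x) (hHn : ∀ n, InH κ (four (mn n)))
    (hlim : Tendsto (fun n => hsum κ (four fun x => mn n x - m x)) atTop (𝓝 0)) :
    ∃ δ : ℕ → ℝ, Tendsto δ atTop (𝓝 0) ∧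
      ∀ n x, |h (bold (mn n)) x - h (bold m) x| ≤ δ n := by
  obtain ⟨F, hF, hdiff⟩ := hh κ hκ
  obtain ⟨M, hM, -⟩ := exists_sobolev hc hH
  have hD : ∀ n, ∃ D : Sobolev d κ, sobFn D =ᵐ[volume] (fun x => mn n x - m x) ∧
      ‖D‖ ^ 2 ≤ fourConst d κ * hsum κ (four fun x => mn n x - m x) := fun n => by
    refine exists_sobolev ((hcn n).sub hc) ?_
    rw [show (four fun x => mn n x - m x) = fun k => four (mn n) k - four m k from
      funext fun k => four_sub (hcn n).integrable_torus hc.integrable_torus k]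
    exact (hHn n).sub hH
  choose D hD1 hD2 using hD
  -- The approximants are represented as `M + D n`, so that their Sobolev distance to `M` is the
  -- norm of `D n`, which the coefficients control.
  have hMn : ∀ n, sobFn (M + D n) =ᵐ[volume] mn n := fun n => by
    filter_upwards [sobFn_add M (D n), hM, hD1 n] with x h1 h2 h3
    rw [h1, h2, h3]
    ring
  have hD0 : Tendsto D atTop (𝓝 0) := by
    rw [tendsto_zero_iff_norm_tendsto_zero]
    have h1 : Tendsto (fun n => ‖D n‖ ^ 2) atTop (𝓝 0) :=
      squeeze_zero (fun n => sq_nonneg _) hD2 (by simpa using hlim.const_mul (fourConst d κ))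
    simpa [Real.sqrt_sq (norm_nonneg _)] using h1.sqrt
  have hmem : ∀ {m : Torus d → ℝ} {M : Sobolev d κ}, (∀ x, 0 ≤ m x) → sobFn M =ᵐ[volume] m →
      M ∈ {m : Sobolev d κ | 0 ≤ᵐ[volume] sobFn m} := by
    intro m M hm hM
    change 0 ≤ᵐ[volume] sobFn M
    filter_upwards [hM] with x hx
    rw [hx]
    exact hm x
  have hMt : Tendsto (fun n => M + D n) atTop
      (𝓝[{m : Sobolev d κ | 0 ≤ᵐ[volume] sobFn m}] M) := by
    refine tendsto_nhdsWithin_iff.2 ⟨by simpa using hD0.const_add M, ?_⟩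
    exact Eventually.of_forall fun n => hmem (hmn n) (hMn n)
  have hFt : Tendsto (fun n => F (M + D n)) atTop (𝓝 (F M)) :=
    ((hdiff M (hmem hm hM)).continuousWithinAt).tendsto.comp hMt
  refine ⟨fun n => sobConst d κ * ‖F (M + D n) - F M‖, ?_, fun n x => ?_⟩
  · simpa using (tendsto_iff_norm_sub_tendsto_zero.1 hFt).const_mul (sobConst d κ)
  · exact abs_nonlocal_sub_le hκ hF hm (hmn n) hM (hMn n) x

/-- The increment of a differentiable map at a fixed point is O of the increment of its argument.
Differentiability gives no Lipschitz bound on a neighbourhood, so the estimate has `a` fixed and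
only `b` varying. -/
lemma nonlocal_lipschitzAt {h : Mac d → C(Torus d, ℝ)} (hh : AssumptionH h) {ι : Type*}
    [Fintype ι] {φ : ι → Torus d → ℝ} (hφ : ∀ j, IsSmooth (φ j)) {a : ι → ℝ}
    (ha : ∀ x, 0 ≤ ∑ j, a j * φ j x) :
    ∃ K : ℝ, 0 ≤ K ∧ ∀ᶠ b in 𝓝 a, (∀ x, 0 ≤ ∑ j, b j * φ j x) →
      ∀ x, |h (bold fun x => ∑ j, b j * φ j x) x - h (bold fun x => ∑ j, a j * φ j x) x| ≤
        K * ‖b - a‖ := by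
  have hκ : (d : ℝ) / 2 + 1 < (d + 2 : ℕ) := by
    push_cast
    have : (0 : ℝ) ≤ d := by positivity
    linarith
  obtain ⟨F, hF, hdiff⟩ := hh (d + 2) hκ
  choose Φ hΦ _ using fun j => exists_sobolev (hφ j).continuous ((hφ j).inH (d + 2))
  let M : (ι → ℝ) → Sobolev d (d + 2) := fun b => ∑ j, b j • Φ j
  have hM : ∀ b, sobFn (M b) =ᵐ[volume] fun x => ∑ j, b j * φ j x := fun b => by
    have h1 : ∀ᵐ x ∂(volume : Measure (Torus d)), ∀ j, sobFn (b j • Φ j) x = b j * φ j x := by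
      rw [ae_all_iff]
      intro j
      filter_upwards [sobFn_smul (b j) (Φ j), hΦ j] with x h1 h2
      rw [h1, h2]
    filter_upwards [sobFn_sum Finset.univ fun j => b j • Φ j, h1] with x h2 h3
    rw [h2]
    exact Finset.sum_congr rfl fun j _ => h3 j
  have hMc : Continuous M := by fun_prop
  have hMl : ∀ b, ‖M b - M a‖ ≤ (∑ j, ‖Φ j‖) * ‖b - a‖ := fun b => by
    have : M b - M a = ∑ j, (b j - a j) • Φ j := by
      simp only [M, ← Finset.sum_sub_distrib, sub_smul]
    rw [this, Finset.sum_mul]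
    refine (norm_sum_le _ _).trans (Finset.sum_le_sum fun j _ => ?_)
    rw [norm_smul, mul_comm]
    exact mul_le_mul_of_nonneg_left (norm_le_pi_norm (b - a) j) (norm_nonneg _)
  have hmem : ∀ b, (∀ x, 0 ≤ ∑ j, b j * φ j x) →
      M b ∈ {m : Sobolev d (d + 2) | 0 ≤ᵐ[volume] sobFn m} := by
    intro b hb
    change 0 ≤ᵐ[volume] sobFn (M b)
    filter_upwards [hM b] with x hx
    rw [hx]
    exact hb x
  obtain ⟨C, hC⟩ := ((hdiff (M a) (hmem a ha)).hasFDerivWithinAt.isBigO_sub).bound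
  rw [eventually_nhdsWithin_iff] at hC
  have hev := hMc.continuousAt.eventually hC
  refine ⟨sobConst d (d + 2) * (|C| * ∑ j, ‖Φ j‖), ?_, ?_⟩
  · exact mul_nonneg (sobConst_nonneg _ _) (by positivity)
  filter_upwards [hev] with b hb hpos x
  refine (abs_nonlocal_sub_le hκ hF ha hpos (hM a) (hM b) x).trans ?_
  rw [mul_assoc]
  refine mul_le_mul_of_nonneg_left ?_ (sobConst_nonneg _ _)
  calc ‖F (M b) - F (M a)‖ ≤ C * ‖M b - M a‖ := hb (hmem b hpos)
    _ ≤ |C| * ‖M b - M a‖ := mul_le_mul_of_nonneg_right (le_abs_self C) (norm_nonneg _)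
    _ ≤ |C| * ((∑ j, ‖Φ j‖) * ‖b - a‖) := mul_le_mul_of_nonneg_left (hMl b) (abs_nonneg C)
    _ = _ := by ring

end Nonlocal

/-! ### Superposition operators -/

section Superposition

variable {d : ℕ}

/-- The space of the arguments `(p, M, m, θ)` of a Hamiltonian. -/
abbrev JetSpace (d : ℕ) : Type := Vec d × Mat d × ℝ × ℝ

/-- The jet `(Du, D²u, m, θ)` at a point. -/
def jet {d : ℕ} (u m θ : Torus d → ℝ) (x : Torus d) : JetSpace d := (grad u x, hess u x, m x, θ x)

/-- `Ψ(x, p, M, m, θ)` is smooth for `m > 0`. -/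
def IsNice {d : ℕ} (Ψ : Torus d → JetSpace d → ℝ) : Prop :=
  ContDiffOn ℝ ∞ (fun z : (Fin d → ℝ) × JetSpace d => Ψ (proj z.1) z.2) {z | 0 < z.2.2.2.1}

lemma IsNice.add {Ψ Ψ' : Torus d → JetSpace d → ℝ} (h : IsNice Ψ) (h' : IsNice Ψ') :
    IsNice fun x z => Ψ x z + Ψ' x z := ContDiffOn.add h h'

lemma IsNice.neg {Ψ : Torus d → JetSpace d → ℝ} (h : IsNice Ψ) :
    IsNice fun x z => -Ψ x z := ContDiffOn.neg h

lemma IsNice.density_mul {Ψ : Torus d → JetSpace d → ℝ} (h : IsNice Ψ) :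
    IsNice fun x z => z.2.2.1 * Ψ x z :=
  ContDiffOn.mul (ContDiff.contDiffOn (by fun_prop)) h

lemma isNice_hamiltonian {E : Set ℝ} (hE : Set.Ioi 0 ⊆ E) {H : Hamiltonian d}
    (hH : AssumptionH2 E H) : IsNice fun x z => H x z.1 z.2.1 z.2.2.1 z.2.2.2 :=
  ContDiffOn.mono hH fun _ hz => hE hz

lemma isOpen_jetDomain : IsOpen {z : (Fin d → ℝ) × JetSpace d | 0 < z.2.2.2.1} :=
  isOpen_lt continuous_const (by fun_prop)

lemma IsNice.fderiv_apply {Ψ : Torus d → JetSpace d → ℝ} (h : IsNice Ψ) (w : JetSpace d) :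
    ContDiffOn ℝ ∞ (fun z : (Fin d → ℝ) × JetSpace d =>
      fderiv ℝ (fun z : (Fin d → ℝ) × JetSpace d => Ψ (proj z.1) z.2) z (0, w))
      {z | 0 < z.2.2.2.1} :=
  (ContDiffOn.fderiv_of_isOpen h isOpen_jetDomain (by simp)).clm_apply contDiffOn_const

/-- On the open set m > 0 the partial derivative is the full derivative applied to a fixed
direction, so it inherits smoothness in all variables. -/
lemma isNice_DpH {H : Hamiltonian d} (hH : IsNice fun x z => H x z.1 z.2.1 z.2.2.1 z.2.2.2)
    (i : Fin d) : IsNice fun x z => DpH H i x z.1 z.2.1 z.2.2.1 z.2.2.2 := by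
  refine (hH.fderiv_apply (EuclideanSpace.single i 1, 0, 0, 0)).congr ?_
  rintro ⟨y, p, M, m, θ⟩ hz
  have hd : DifferentiableAt ℝ (fun z : (Fin d → ℝ) × JetSpace d =>
      H (proj z.1) z.2.1 z.2.2.1 z.2.2.2.1 z.2.2.2.2) (y, p, M, m, θ) :=
    (ContDiffOn.differentiableOn hH (by simp)).differentiableAt (isOpen_jetDomain.mem_nhds hz)
  have h1 : HasFDerivAt (fun p' : Vec d => ((y, p', M, m, θ) : (Fin d → ℝ) × JetSpace d))
      ((0 : Vec d →L[ℝ] (Fin d → ℝ)).prod ((ContinuousLinearMap.id ℝ (Vec d)).prod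
        (0 : Vec d →L[ℝ] Mat d × ℝ × ℝ))) p :=
    (hasFDerivAt_const y p).prodMk ((hasFDerivAt_id p).prodMk (hasFDerivAt_const (M, m, θ) p))
  have h2 := hd.hasFDerivAt.comp p h1
  change fderiv ℝ (fun p' : Vec d => H (proj y) p' M m θ) p (EuclideanSpace.single i 1) = _
  rw [show (fun p' : Vec d => H (proj y) p' M m θ) = (fun z : (Fin d → ℝ) × JetSpace d =>
      H (proj z.1) z.2.1 z.2.2.1 z.2.2.2.1 z.2.2.2.2) ∘ fun p' : Vec d => (y, p', M, m, θ) from rfl,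
    h2.fderiv]
  rfl

lemma isNice_DMH {H : Hamiltonian d} (hH : IsNice fun x z => H x z.1 z.2.1 z.2.2.1 z.2.2.2)
    (i j : Fin d) : IsNice fun x z => DMH H i j x z.1 z.2.1 z.2.2.1 z.2.2.2 := by
  refine (hH.fderiv_apply (0, Pi.single i (Pi.single j 1), 0, 0)).congr ?_
  rintro ⟨y, p, M, m, θ⟩ hz
  have hd : DifferentiableAt ℝ (fun z : (Fin d → ℝ) × JetSpace d =>
      H (proj z.1) z.2.1 z.2.2.1 z.2.2.2.1 z.2.2.2.2) (y, p, M, m, θ) :=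
    (ContDiffOn.differentiableOn hH (by simp)).differentiableAt (isOpen_jetDomain.mem_nhds hz)
  have h1 : HasFDerivAt (fun M' : Mat d => ((y, p, M', m, θ) : (Fin d → ℝ) × JetSpace d))
      ((0 : Mat d →L[ℝ] (Fin d → ℝ)).prod ((0 : Mat d →L[ℝ] Vec d).prod
        ((ContinuousLinearMap.id ℝ (Mat d)).prod (0 : Mat d →L[ℝ] ℝ × ℝ)))) M :=
    (hasFDerivAt_const y M).prodMk ((hasFDerivAt_const p M).prodMk
      ((hasFDerivAt_id M).prodMk (hasFDerivAt_const (m, θ) M)))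
  have h2 := hd.hasFDerivAt.comp M h1
  change fderiv ℝ (fun M' : Mat d => H (proj y) p M' m θ) M (Pi.single i (Pi.single j 1)) = _
  rw [show (fun M' : Mat d => H (proj y) p M' m θ) = (fun z : (Fin d → ℝ) × JetSpace d =>
      H (proj z.1) z.2.1 z.2.2.1 z.2.2.2.1 z.2.2.2.2) ∘ fun M' : Mat d => (y, p, M', m, θ) from rfl,
    h2.fderiv]
  rfl

lemma isNice_penalization {ε₁ q : ℝ} {β : ℝ → ℝ} (hβ : IsPenalization ε₁ q β) :
    IsNice (d := d) fun _ z => β z.2.2.1 :=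
  hβ.smooth.comp (ContDiff.contDiffOn (by fun_prop)) fun _ hz => hz

lemma exists_lift_mem_Icc (x : Torus d) : ∃ y ∈ Set.Icc (0 : Fin d → ℝ) 1, proj y = x := by
  obtain ⟨y, rfl⟩ := proj_surjective x
  refine ⟨fun i => Int.fract (y i), ⟨fun i => Int.fract_nonneg _, fun i => (Int.fract_lt_one _).le⟩,
    ?_⟩
  funext i
  simp only [proj]
  exact AddCircle.coe_fract (y i)

/-- The arguments range over a compact convex set: a fundamental cube for x, and a ball cut by the
half-space m ≥ c for the jet. A C¹ function on such a set is Lipschitz. -/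
lemma IsNice.exists_lipschitz {Ψ : Torus d → JetSpace d → ℝ} (h : IsNice Ψ) {c : ℝ} (hc : 0 < c)
    (R : ℝ) : ∃ K : ℝ, 0 ≤ K ∧ ∀ (x : Torus d) (z z' : JetSpace d), ‖z‖ ≤ R → ‖z'‖ ≤ R →
      c ≤ z.2.2.1 → c ≤ z'.2.2.1 → |Ψ x z - Ψ x z'| ≤ K * ‖z - z'‖ := by
  let S : Set ((Fin d → ℝ) × JetSpace d) :=
    Set.Icc 0 1 ×ˢ (Metric.closedBall 0 R ∩ {z : JetSpace d | c ≤ z.2.2.1})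
  have hSc : IsCompact S := isCompact_Icc.prod
    ((isCompact_closedBall 0 R).inter_right (isClosed_le continuous_const (by fun_prop)))
  have hSv : Convex ℝ S := (convex_Icc 0 1).prod ((convex_closedBall 0 R).inter
    (convex_halfSpace_ge (f := fun z : JetSpace d => z.2.2.1)
      ⟨fun _ _ => rfl, fun _ _ => rfl⟩ c))
  have hS : S ⊆ {z | 0 < z.2.2.2.1} := fun z hz => hc.trans_le hz.2.2
  have h1 : ContDiffOn ℝ 1 (fun z : (Fin d → ℝ) × JetSpace d => Ψ (proj z.1) z.2) S :=
    (ContDiffOn.mono h hS).of_le (by exact_mod_cast le_top)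
  obtain ⟨K, hK⟩ := (h1.locallyLipschitzOn hSv).exists_lipschitzOnWith_of_compact hSc
  refine ⟨K, K.2, fun x z z' hz hz' hcz hcz' => ?_⟩
  obtain ⟨y, hy, rfl⟩ := exists_lift_mem_Icc x
  have := hK.dist_le_mul (y, z) ⟨hy, by simpa using hz, hcz⟩ (y, z') ⟨hy, by simpa using hz', hcz'⟩
  rw [Real.dist_eq, dist_eq_norm] at this
  refine this.trans (le_of_eq ?_)
  simp

lemma contDiff_jet {n : ℕ} {u m θ : Torus d → ℝ} (hu : IsC (n + 2 : ℕ) u) (hm : IsC n m)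
    (hθ : IsC n θ) : ContDiff ℝ n fun y : Fin d → ℝ => jet u m θ (proj y) := by
  have hu1 : IsC ((n + 1 : ℕ) + 1) u := by exact_mod_cast hu
  have h1 : ∀ i, IsC (n + 1 : ℕ) (pd i u) := fun i => hu1.pd i
  have h2 : ∀ i j, IsC n (pd i (pd j u)) := fun i j => IsC.pd (by exact_mod_cast h1 j) i
  refine ContDiff.prodMk ?_ (ContDiff.prodMk ?_ (ContDiff.prodMk hm hθ))
  · refine contDiff_euclidean.2 fun i => ?_
    exact (h1 i).of_le (by exact_mod_cast Nat.le_succ n)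
  · exact contDiff_pi.2 fun i => contDiff_pi.2 fun j => h2 i j

lemma IsNice.isC {Ψ : Torus d → JetSpace d → ℝ} (h : IsNice Ψ) {n : ℕ} {u m θ : Torus d → ℝ}
    (hu : IsC (n + 2 : ℕ) u) (hm : IsC n m) (hθ : IsC n θ) (hpos : ∀ x, 0 < m x) :
    IsC n fun x => Ψ x (jet u m θ x) := by
  have h1 : ContDiff ℝ n fun y : Fin d → ℝ => (y, jet u m θ (proj y)) :=
    contDiff_id.prodMk (contDiff_jet hu hm hθ)
  have h2 := (ContDiffOn.of_le h (m := (n : WithTop ℕ∞)) (by exact_mod_cast le_top)).comp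
    h1.contDiffOn (s := Set.univ) fun y _ => hpos (proj y)
  exact contDiffOn_univ.1 h2

lemma IsNice.isSmooth {Ψ : Torus d → JetSpace d → ℝ} (h : IsNice Ψ) {u m θ : Torus d → ℝ}
    (hu : IsSmooth u) (hm : IsSmooth m) (hθ : IsSmooth θ) (hpos : ∀ x, 0 < m x) :
    IsSmooth fun x => Ψ x (jet u m θ x) :=
  isSmooth_of_forall fun n => h.isC (hu.isC_nat _) (hm.isC_nat n) (hθ.isC_nat n) hpos

end Superposition

end RegMFG
end

noncomputable section

namespace RegMFG

open Filter Topology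

/-! ### The regularized problem -/

section Laplacian

variable {d : ℕ}

lemma IsSmooth.pd_sub {f f' : Torus d → ℝ} (hf : IsSmooth f) (hf' : IsSmooth f') (i : Fin d) :
    RegMFG.pd i (fun x => f x - f' x) = fun x => RegMFG.pd i f x - RegMFG.pd i f' x :=
  IsC.pd_sub (hf.isC_nat 1) (hf'.isC_nat 1) i

lemma IsSmooth.sub {f f' : Torus d → ℝ} (hf : IsSmooth f) (hf' : IsSmooth f') :
    IsSmooth (fun x => f x - f' x) := ContDiff.sub hf hf'

lemma IsSmooth.add {f f' : Torus d → ℝ} (hf : IsSmooth f) (hf' : IsSmooth f') :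
    IsSmooth (fun x => f x + f' x) := ContDiff.add hf hf'

lemma IsSmooth.mul {f f' : Torus d → ℝ} (hf : IsSmooth f) (hf' : IsSmooth f') :
    IsSmooth (fun x => f x * f' x) := ContDiff.mul hf hf'

lemma IsSmooth.neg {f : Torus d → ℝ} (hf : IsSmooth f) : IsSmooth (fun x => -f x) := ContDiff.neg hf

lemma isSmooth_const (c : ℝ) : IsSmooth (fun _ : Torus d => c) := contDiff_const

lemma IsSmooth.lap_sub {f f' : Torus d → ℝ} (hf : IsSmooth f) (hf' : IsSmooth f') :
    RegMFG.lap (fun x => f x - f' x) = fun x => RegMFG.lap f x - RegMFG.lap f' x := by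
  funext x
  simp only [RegMFG.lap, hf.pd_sub hf', (hf.pd _).pd_sub (hf'.pd _), Finset.sum_sub_distrib]

lemma IsSmooth.lap_iterate_sub {f f' : Torus d → ℝ} (hf : IsSmooth f) (hf' : IsSmooth f')
    (n : ℕ) : RegMFG.lap^[n] (fun x => f x - f' x) =
      fun x => RegMFG.lap^[n] f x - RegMFG.lap^[n] f' x := by
  induction n with
  | zero => rfl
  | succ n ih =>
    rw [Function.iterate_succ_apply', ih, (hf.lap_iterate n).lap_sub (hf'.lap_iterate n)]
    simp only [Function.iterate_succ_apply']

/-- The symbol `4π²|k|²` of `-Δ`. -/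
def nsq {d : ℕ} (k : Fin d → ℤ) : ℝ := 4 * Real.pi ^ 2 * ∑ i, (k i : ℝ) ^ 2

lemma nsq_nonneg (k : Fin d → ℤ) : 0 ≤ nsq k := by unfold nsq; positivity

lemma four_lap {f : Torus d → ℝ} (hf : IsSmooth f) (k : Fin d → ℤ) :
    four (lap f) k = -(nsq k : ℂ) * four f k := by
  unfold lap
  rw [four_sum _ fun i _ => ((hf.pd i).pd i).continuous.integrable_torus]
  simp only [four_pd ((hf.pd _).isC_nat 1), four_pd (hf.isC_nat 1)]
  unfold nsq
  push_cast
  rw [Finset.mul_sum, ← Finset.sum_neg_distrib, Finset.sum_mul]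
  refine Finset.sum_congr rfl fun i _ => ?_
  ring_nf
  rw [Complex.I_sq]
  ring

lemma four_lap_iterate {f : Torus d → ℝ} (hf : IsSmooth f) (n : ℕ) (k : Fin d → ℤ) :
    four (lap^[n] f) k = (-(nsq k : ℂ)) ^ n * four f k := by
  induction n with
  | zero => simp
  | succ n ih =>
    rw [Function.iterate_succ_apply', four_lap (hf.lap_iterate n), ih]
    ring

end Laplacian

/-- The data of the regularized mean-field game system. -/
structure RegProblem (d : ℕ) where
  /-- the nonlocal coupling -/
  h : Mac d → C(Torus d, ℝ)
  /-- the Hamiltonian -/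
  H : Hamiltonian d
  /-- half the order of the regularization -/
  p : ℕ
  /-- the exponent of the penalization -/
  q : ℝ
  /-- the parameter of the penalization and of the high order regularization -/
  ε₁ : ℝ
  /-- the parameter of the second order regularization -/
  ε₂ : ℝ
  /-- the penalization -/
  β : ℝ → ℝ
  assumptionH : AssumptionH h
  nice : IsNice fun x z => H x z.1 z.2.1 z.2.2.1 z.2.2.2
  monotone : AssumptionH3 (Set.Ioi 0) h H
  order : d + 10 < 4 * p
  lt_q : (d : ℝ) < q
  ε₁_pos : 0 < ε₁
  ε₁_lt : ε₁ < 1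
  ε₂_pos : 0 < ε₂
  penalization : IsPenalization ε₁ q β

/-! ### The regularizing operator, its symbol and its energy -/

namespace RegProblem

variable {d : ℕ} (D : RegProblem d)

/-- The regularizing operator `ε₁ (1 + Δ^{2p}) + ε₂ (1 - Δ)`. -/
def reg (f : Torus d → ℝ) (x : Torus d) : ℝ :=
  D.ε₁ * (f x + lap^[2 * D.p] f x) + D.ε₂ * (f x - lap f x)

/-- The symbol of the regularizing operator. -/
def lam (k : Fin d → ℤ) : ℝ := D.ε₁ * (1 + nsq k ^ (2 * D.p)) + D.ε₂ * (1 + nsq k)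

lemma isSmooth_reg {f : Torus d → ℝ} (hf : IsSmooth f) : IsSmooth (D.reg f) :=
  ((isSmooth_const D.ε₁).mul (hf.add (hf.lap_iterate _))).add
    ((isSmooth_const D.ε₂).mul (hf.sub hf.lap))

lemma reg_sub {f f' : Torus d → ℝ} (hf : IsSmooth f) (hf' : IsSmooth f') :
    D.reg (fun x => f x - f' x) = fun x => D.reg f x - D.reg f' x := by
  funext x
  simp only [reg, hf.lap_iterate_sub hf', hf.lap_sub hf']
  ring

lemma four_reg {f : Torus d → ℝ} (hf : IsSmooth f) (k : Fin d → ℤ) :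
    four (D.reg f) k = (D.lam k : ℂ) * four f k := by
  have i1 : Integrable f volume := hf.continuous.integrable_torus
  have i2 : Integrable (lap^[2 * D.p] f) volume := (hf.lap_iterate _).continuous.integrable_torus
  have i3 : Integrable (lap f) volume := hf.lap.continuous.integrable_torus
  have i4 : Integrable (fun x => D.ε₁ * (f x + lap^[2 * D.p] f x)) volume :=
    (i1.add i2).const_mul _
  have i5 : Integrable (fun x => D.ε₂ * (f x - lap f x)) volume := (i1.sub i3).const_mul _
  unfold reg
  rw [four_add i4 i5, four_const_mul, four_const_mul,
    four_add i1 i2, four_sub i1 i3, four_lap hf, four_lap_iterate hf, Even.neg_pow (even_two_mul _)]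
  unfold lam
  push_cast
  ring

lemma ε₁_le_lam (k : Fin d → ℤ) : D.ε₁ ≤ D.lam k := by
  have h1 := nsq_nonneg k
  have h2 : 0 ≤ nsq k ^ (2 * D.p) := pow_nonneg h1 _
  have := D.ε₁_pos
  have := D.ε₂_pos
  unfold lam
  nlinarith [mul_nonneg D.ε₁_pos.le h2, mul_nonneg D.ε₂_pos.le h1]

lemma lam_pos (k : Fin d → ℤ) : 0 < D.lam k := D.ε₁_pos.trans_le (D.ε₁_le_lam k)

/-- The ellipticity constant. -/
def lamConst : ℝ := 2 ^ (4 * D.p) * (1 + d) / D.ε₁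

lemma lamConst_pos : 0 < D.lamConst := by
  have := D.ε₁_pos
  unfold lamConst
  positivity

/-- Ellipticity of order 4p: the term ε₁Δ^{2p} alone dominates every |k_i|^{4p}. The same inequality
gives the H^{2p} bound from the energy and the gain of 4p derivatives. -/
lemma wt_pow_le_lam (k : Fin d → ℤ) : wt k ^ (4 * D.p) ≤ D.lamConst * D.lam k := by
  have h0 := D.ε₁_pos
  have hn := nsq_nonneg k
  have hn' : 0 ≤ nsq k ^ (2 * D.p) := pow_nonneg hn _
  have h1 : ∀ i, |(k i : ℝ)| ^ (4 * D.p) ≤ nsq k ^ (2 * D.p) := fun i => by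
    rw [show 4 * D.p = 2 * (2 * D.p) by ring, pow_mul, sq_abs]
    refine pow_le_pow_left₀ (sq_nonneg _) ?_ _
    have h2 : (k i : ℝ) ^ 2 ≤ ∑ i, (k i : ℝ) ^ 2 :=
      Finset.single_le_sum (f := fun i => (k i : ℝ) ^ 2) (fun i _ => sq_nonneg _)
        (Finset.mem_univ i)
    unfold nsq
    have h3 : 1 ≤ 4 * Real.pi ^ 2 := by nlinarith [Real.pi_gt_three]
    exact h2.trans (le_mul_of_one_le_left (Finset.sum_nonneg fun i _ => sq_nonneg _) h3)
  have h2 : D.ε₁ * (1 + nsq k ^ (2 * D.p)) ≤ D.lam k := by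
    have := D.ε₂_pos
    unfold lam
    nlinarith [mul_nonneg D.ε₂_pos.le hn]
  calc wt k ^ (4 * D.p) ≤ 2 ^ (4 * D.p) * (1 + ∑ i, |(k i : ℝ)| ^ (4 * D.p)) := wt_pow_le k _
    _ ≤ 2 ^ (4 * D.p) * (1 + ∑ _i : Fin d, nsq k ^ (2 * D.p)) := by
        gcongr with i
        exact h1 i
    _ ≤ 2 ^ (4 * D.p) * ((1 + d) * (1 + nsq k ^ (2 * D.p))) := by
        gcongr
        simp only [Finset.sum_const, Finset.card_univ, Fintype.card_fin, nsmul_eq_mul]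
        nlinarith [(Nat.cast_nonneg d : (0 : ℝ) ≤ d)]
    _ = D.lamConst * (D.ε₁ * (1 + nsq k ^ (2 * D.p))) := by
        unfold lamConst
        field_simp
    _ ≤ _ := mul_le_mul_of_nonneg_left h2 D.lamConst_pos.le

/-- The energy of the regularizing operator. -/
def energy (f : Torus d → ℝ) : ℝ := ∫ x, D.reg f x * f x

/-- Parseval, since `reg` multiplies Fourier coefficients by the real symbol `lam`. -/
lemma hasSum_energy {f : Torus d → ℝ} (hf : IsSmooth f) :
    HasSum (fun k => D.lam k * ‖four f k‖ ^ 2) (D.energy f) := by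
  have h := hasSum_four_mul (hf.memLp 2) ((D.isSmooth_reg hf).memLp 2)
  have h2 := Complex.hasSum_re h
  rw [Complex.ofReal_re] at h2
  refine h2.congr_fun fun k => ?_
  rw [D.four_reg hf, mul_left_comm, Complex.re_ofReal_mul, ← Complex.normSq_eq_conj_mul_self,
    Complex.ofReal_re, Complex.normSq_eq_norm_sq]

lemma hsum_le_energy {f : Torus d → ℝ} (hf : IsSmooth f) :
    hsum (2 * D.p) (four f) ≤ D.lamConst * D.energy f := by
  have h := (D.hasSum_energy hf).mul_left D.lamConst
  rw [← h.tsum_eq]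
  refine Summable.tsum_le_tsum (fun k => ?_) (hf.inH _) h.summable
  rw [show 2 * (2 * D.p) = 4 * D.p by ring, ← mul_assoc]
  exact mul_le_mul_of_nonneg_right (D.wt_pow_le_lam k) (sq_nonneg _)

lemma integral_sq_le_energy {f : Torus d → ℝ} (hf : IsSmooth f) :
    D.ε₁ * ∫ x, f x ^ 2 ≤ D.energy f :=
  hasSum_le (fun k => mul_le_mul_of_nonneg_right (D.ε₁_le_lam k) (sq_nonneg _))
    ((hasSum_sq_four (hf.memLp 2)).mul_left D.ε₁) (D.hasSum_energy hf)

lemma energy_nonneg {f : Torus d → ℝ} (hf : IsSmooth f) : 0 ≤ D.energy f :=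
  (mul_nonneg D.ε₁_pos.le (integral_nonneg fun _ => sq_nonneg _)).trans (D.integral_sq_le_energy hf)

/-! #### Residuals -/

/-- The residual of the first equation. -/
def res₁ (m u : Torus d → ℝ) (x : Torus d) : ℝ :=
  opA₁ D.h D.H m u x + D.reg m x + D.β (m x)

/-- The residual of the second equation. -/
def res₂ (m u : Torus d → ℝ) (x : Torus d) : ℝ := opA₂ D.h D.H m u x + D.reg u x

/-- The lower order nonlinearity of the first equation. -/
def nl₁ (x : Torus d) (z : JetSpace d) : ℝ := -D.H x z.1 z.2.1 z.2.2.1 z.2.2.2 + D.β z.2.2.1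

/-- The flux `m D_p H`. -/
def flux (i : Fin d) (x : Torus d) (z : JetSpace d) : ℝ :=
  z.2.2.1 * DpH D.H i x z.1 z.2.1 z.2.2.1 z.2.2.2

/-- The second order flux `m D_M H`. -/
def flux₂ (i j : Fin d) (x : Torus d) (z : JetSpace d) : ℝ :=
  z.2.2.1 * DMH D.H i j x z.1 z.2.1 z.2.2.1 z.2.2.2

lemma isNice_nl₁ : IsNice D.nl₁ := D.nice.neg.add (isNice_penalization D.penalization)

lemma isNice_flux (i : Fin d) : IsNice (D.flux i) := (isNice_DpH D.nice i).density_mul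

lemma isNice_flux₂ (i j : Fin d) : IsNice (D.flux₂ i j) := (isNice_DMH D.nice i j).density_mul

/-- The jet of `(m, u)`. -/
def jt (m u : Torus d → ℝ) (x : Torus d) : JetSpace d := jet u m (D.h (bold m)) x

lemma res₁_eq (m u : Torus d → ℝ) (x : Torus d) :
    D.res₁ m u x = -u x + D.reg m x + D.nl₁ x (D.jt m u x) := by
  simp only [res₁, opA₁, nl₁, jt, jet]
  ring

lemma res₂_eq (m u : Torus d → ℝ) (x : Torus d) :
    D.res₂ m u x = m x - 1 + D.reg u x - ∑ i, pd i (fun y => D.flux i y (D.jt m u y)) x +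
      ∑ i, ∑ j, pd i (pd j fun y => D.flux₂ i j y (D.jt m u y)) x := by
  simp only [res₂, opA₂, flux, flux₂, jt, jet]
  ring

variable {D}

lemma isSmooth_comp {Ψ : Torus d → JetSpace d → ℝ} (hΨ : IsNice Ψ) {m u : Torus d → ℝ}
    (hm : IsSmooth m) (hu : IsSmooth u) (hpos : ∀ x, 0 < m x) :
    IsSmooth fun x => Ψ x (D.jt m u x) :=
  hΨ.isSmooth hu hm (isSmooth_nonlocal D.assumptionH hm fun x => (hpos x).le) hpos

lemma isSmooth_res₁ {m u : Torus d → ℝ} (hm : IsSmooth m) (hu : IsSmooth u)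
    (hpos : ∀ x, 0 < m x) : IsSmooth (D.res₁ m u) := by
  have := (hu.neg.add (D.isSmooth_reg hm)).add
    (isSmooth_comp (D := D) D.isNice_nl₁ hm hu hpos)
  rwa [show (fun x => -u x + D.reg m x + D.nl₁ x (D.jt m u x)) = D.res₁ m u from
    funext fun x => (D.res₁_eq m u x).symm] at this

lemma isSmooth_flux {m u : Torus d → ℝ} (hm : IsSmooth m) (hu : IsSmooth u)
    (hpos : ∀ x, 0 < m x) (i : Fin d) : IsSmooth fun x => D.flux i x (D.jt m u x) :=
  isSmooth_comp (D.isNice_flux i) hm hu hpos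

lemma isSmooth_flux₂ {m u : Torus d → ℝ} (hm : IsSmooth m) (hu : IsSmooth u)
    (hpos : ∀ x, 0 < m x) (i j : Fin d) : IsSmooth fun x => D.flux₂ i j x (D.jt m u x) :=
  isSmooth_comp (D.isNice_flux₂ i j) hm hu hpos

lemma isSmooth_sum {ι : Type*} (s : Finset ι) {f : ι → Torus d → ℝ}
    (hf : ∀ j ∈ s, IsSmooth (f j)) : IsSmooth (fun x => ∑ j ∈ s, f j x) :=
  IsC.sum (n := ∞) hf

lemma isSmooth_res₂ {m u : Torus d → ℝ} (hm : IsSmooth m) (hu : IsSmooth u)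
    (hpos : ∀ x, 0 < m x) : IsSmooth (D.res₂ m u) := by
  have := (((hm.sub (isSmooth_const 1)).add (D.isSmooth_reg hu)).sub
    (isSmooth_sum Finset.univ fun i _ => (isSmooth_flux (D := D) hm hu hpos i).pd i)).add
    (isSmooth_sum Finset.univ fun i _ => isSmooth_sum Finset.univ fun j _ =>
      ((isSmooth_flux₂ (D := D) hm hu hpos i j).pd j).pd i)
  rwa [show (fun x => m x - 1 + D.reg u x - ∑ i, pd i (fun y => D.flux i y (D.jt m u y)) x +
      ∑ i, ∑ j, pd i (pd j fun y => D.flux₂ i j y (D.jt m u y)) x) = D.res₂ m u from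
    funext fun x => (D.res₂_eq m u x).symm] at this

lemma integral_pd_mul_smooth {f φ : Torus d → ℝ} (hf : IsSmooth f) (hφ : IsSmooth φ) (i : Fin d) :
    ∫ x, pd i f x * φ x = -∫ x, f x * pd i φ x :=
  integral_pd_mul (hf.isC_nat 1) (hφ.isC_nat 1) i

lemma integral_res₁_mul {m u w : Torus d → ℝ} (hm : IsSmooth m) (hu : IsSmooth u)
    (hpos : ∀ x, 0 < m x) (hw : IsSmooth w) :
    ∫ x, D.res₁ m u x * w x =
      (∫ x, (-u x + D.reg m x) * w x) + ∫ x, D.nl₁ x (D.jt m u x) * w x := by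
  rw [← integral_add]
  · congr 1
    funext x
    rw [res₁_eq]
    ring
  · exact ((hu.neg.add
      (D.isSmooth_reg hm)).mul hw).continuous.integrable_torus
  · exact ((isSmooth_comp D.isNice_nl₁ hm hu hpos).mul hw).continuous.integrable_torus

/-- Integration by parts moves all derivatives of the fluxes to the test function, so that the
nonlinear terms depend on (m,u) only through the values of the jet. -/
lemma integral_res₂_mul {m u w : Torus d → ℝ} (hm : IsSmooth m) (hu : IsSmooth u)
    (hpos : ∀ x, 0 < m x) (hw : IsSmooth w) :
    ∫ x, D.res₂ m u x * w x = (∫ x, (m x - 1 + D.reg u x) * w x) +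
      (∑ i, ∫ x, D.flux i x (D.jt m u x) * pd i w x) +
      ∑ i, ∑ j, ∫ x, D.flux₂ i j x (D.jt m u x) * pd j (pd i w) x := by
  have s0 := ((hm.sub (isSmooth_const 1)).add (D.isSmooth_reg hu)).mul hw
  have s1 : ∀ i, IsSmooth fun x => pd i (fun y => D.flux i y (D.jt m u y)) x * w x := fun i =>
    ((isSmooth_flux (D := D) hm hu hpos i).pd i).mul hw
  have s2 : ∀ i j, IsSmooth fun x =>
      pd i (pd j fun y => D.flux₂ i j y (D.jt m u y)) x * w x := fun i j =>
    (((isSmooth_flux₂ (D := D) hm hu hpos i j).pd j).pd i).mul hw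
  have h1 : ∀ i, ∫ x, D.flux i x (D.jt m u x) * pd i w x =
      -∫ x, pd i (fun y => D.flux i y (D.jt m u y)) x * w x := fun i => by
    rw [integral_pd_mul_smooth (isSmooth_flux (D := D) hm hu hpos i) hw, neg_neg]
  have h2 : ∀ i j, ∫ x, D.flux₂ i j x (D.jt m u x) * pd j (pd i w) x =
      ∫ x, pd i (pd j fun y => D.flux₂ i j y (D.jt m u y)) x * w x := fun i j => by
    rw [integral_pd_mul_smooth ((isSmooth_flux₂ (D := D) hm hu hpos i j).pd j) hw,
      integral_pd_mul_smooth (isSmooth_flux₂ (D := D) hm hu hpos i j) (hw.pd i), neg_neg]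
  simp only [h1, h2]
  rw [Finset.sum_neg_distrib, ← integral_finsetSum _ fun i _ => (s1 i).continuous.integrable_torus]
  simp_rw [← integral_finsetSum Finset.univ fun j _ => (s2 _ j).continuous.integrable_torus]
  rw [← integral_finsetSum _ fun i _ =>
    (isSmooth_sum Finset.univ fun j _ => s2 i j).continuous.integrable_torus,
    ← sub_eq_add_neg, ← integral_sub s0.continuous.integrable_torus
      (isSmooth_sum Finset.univ fun i _ => s1 i).continuous.integrable_torus,
    ← integral_add]
  · congr 1
    funext x
    rw [res₂_eq]
    simp only [← Finset.sum_mul]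
    ring
  · exact (s0.sub (isSmooth_sum Finset.univ fun i _ => s1 i)).continuous.integrable_torus
  · exact (isSmooth_sum Finset.univ fun i _ =>
      isSmooth_sum Finset.univ fun j _ => s2 i j).continuous.integrable_torus

/-! #### Monotonicity and the a priori estimate -/

lemma penalization_mono {s t : ℝ} (hs : 0 < s) (ht : 0 < t) :
    0 ≤ (D.β s - D.β t) * (s - t) := by
  rcases le_total s t with h | h
  · exact mul_nonneg_of_nonpos_of_nonpos
      (sub_nonpos.2 (D.penalization.mono hs ht h)) (sub_nonpos.2 h)
  · exact mul_nonneg (sub_nonneg.2 (D.penalization.mono ht hs h)) (sub_nonneg.2 h)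

lemma isSmooth_beta {m : Torus d → ℝ} (hm : IsSmooth m) (hpos : ∀ x, 0 < m x) :
    IsSmooth fun x => D.β (m x) :=
  (isNice_penalization D.penalization).isSmooth (u := fun _ => 0) (θ := fun _ => 0)
    (isSmooth_const 0) hm (isSmooth_const 0) hpos

/-- Assumption (H3), rewritten for the residuals: `reg` is linear and contributes exactly the
energies of the differences. -/
lemma res_monotone {m u m' u' : Torus d → ℝ} (hm : IsSmooth m) (hu : IsSmooth u)
    (hpos : ∀ x, 0 < m x) (hm' : IsSmooth m') (hu' : IsSmooth u') (hpos' : ∀ x, 0 < m' x) :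
    D.energy (fun x => m x - m' x) + D.energy (fun x => u x - u' x) +
      ∫ x, (D.β (m x) - D.β (m' x)) * (m x - m' x) ≤
    (∫ x, (D.res₁ m u x - D.res₁ m' u' x) * (m x - m' x)) +
      ∫ x, (D.res₂ m u x - D.res₂ m' u' x) * (u x - u' x) := by
  have hA := D.monotone m u m' u' hm hu hm' hu' hpos hpos'
  have sm := hm.sub hm'
  have su := hu.sub hu'
  have r1 := (isSmooth_res₁ (D := D) hm hu hpos).sub (isSmooth_res₁ (D := D) hm' hu' hpos')
  have r2 := (isSmooth_res₂ (D := D) hm hu hpos).sub (isSmooth_res₂ (D := D) hm' hu' hpos')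
  have e1 := D.isSmooth_reg sm
  have e2 := D.isSmooth_reg su
  have b := (isSmooth_beta (D := D) hm hpos).sub (isSmooth_beta (D := D) hm' hpos')
  have h1 : ∫ x, (opA₁ D.h D.H m u x - opA₁ D.h D.H m' u' x) * (m x - m' x) =
      (∫ x, (D.res₁ m u x - D.res₁ m' u' x) * (m x - m' x)) -
        D.energy (fun x => m x - m' x) -
        ∫ x, (D.β (m x) - D.β (m' x)) * (m x - m' x) := by
    unfold energy
    rw [← integral_sub (r1.mul sm).continuous.integrable_torus
        (e1.mul sm).continuous.integrable_torus,
      ← integral_sub ((r1.mul sm).sub (e1.mul sm)).continuous.integrable_torus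
        (b.mul sm).continuous.integrable_torus]
    congr 1
    funext x
    rw [D.reg_sub hm hm']
    simp only [res₁]
    ring
  have h2 : ∫ x, (opA₂ D.h D.H m u x - opA₂ D.h D.H m' u' x) * (u x - u' x) =
      (∫ x, (D.res₂ m u x - D.res₂ m' u' x) * (u x - u' x)) -
        D.energy (fun x => u x - u' x) := by
    unfold energy
    rw [← integral_sub (r2.mul su).continuous.integrable_torus
        (e2.mul su).continuous.integrable_torus]
    congr 1
    funext x
    rw [D.reg_sub hu hu']
    simp only [res₂]
    ring
  rw [h1, h2] at hA
  linarith

/-- Young's inequality, weighted so that the term in w costs exactly half of the energy. -/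
lemma integral_mul_ge {f w : Torus d → ℝ} (hf : IsSmooth f) (hw : IsSmooth w) :
    -((∫ x, f x ^ 2) / (2 * D.ε₁)) - D.energy w / 2 ≤ ∫ x, f x * w x := by
  have h0 := D.ε₁_pos
  have h1 := D.integral_sq_le_energy hw
  have i1 : Integrable (fun x => f x ^ 2) (volume : Measure (Torus d)) :=
    (hf.continuous.pow 2).integrable_torus
  have i2 : Integrable (fun x => w x ^ 2) (volume : Measure (Torus d)) :=
    (hw.continuous.pow 2).integrable_torus
  have h2 : ∫ x, (-(1 / (2 * D.ε₁)) * f x ^ 2 + -(D.ε₁ / 2) * w x ^ 2) ≤ ∫ x, f x * w x := by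
    refine integral_mono ((i1.const_mul _).add (i2.const_mul _))
      (hf.mul hw).continuous.integrable_torus fun x => ?_
    have : 0 ≤ (f x + D.ε₁ * w x) ^ 2 / (2 * D.ε₁) := by positivity
    have h3 : (f x + D.ε₁ * w x) ^ 2 / (2 * D.ε₁) =
        1 / (2 * D.ε₁) * f x ^ 2 + f x * w x + D.ε₁ / 2 * w x ^ 2 := by
      field_simp
      ring
    simp only
    linarith
  rw [integral_add (i1.const_mul _) (i2.const_mul _), integral_const_mul, integral_const_mul] at h2
  have h3 : (∫ x, f x ^ 2) / (2 * D.ε₁) = 1 / (2 * D.ε₁) * ∫ x, f x ^ 2 := by ring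
  rw [h3]
  linarith

variable (D) in
/-- The constant of the a priori estimate. -/
def apConst : ℝ := (∫ x, D.res₁ (fun _ => 1) (fun _ => 0) x ^ 2) / (2 * D.ε₁) +
  (∫ x, D.res₂ (fun _ => 1) (fun _ => 0) x ^ 2) / (2 * D.ε₁)

/-- Monotonicity against the pair (1,0). The residuals of that pair are fixed smooth functions, so
half of the energies absorbs their contribution. -/
lemma a_priori {m u : Torus d → ℝ} (hm : IsSmooth m) (hu : IsSmooth u) (hpos : ∀ x, 0 < m x) :
    (D.energy (fun x => m x - 1) + D.energy u) / 2 + (∫ x, D.β (m x) * (m x - 1)) - D.apConst ≤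
      (∫ x, D.res₁ m u x * (m x - 1)) + ∫ x, D.res₂ m u x * u x := by
  have p1 : ∀ x : Torus d, (0 : ℝ) < (fun _ => 1) x := fun _ => one_pos
  have h := res_monotone (D := D) hm hu hpos (isSmooth_const 1) (isSmooth_const 0) p1
  have sm := hm.sub (isSmooth_const 1)
  have r1 := isSmooth_res₁ (D := D) hm hu hpos
  have r2 := isSmooth_res₂ (D := D) hm hu hpos
  have r1' := isSmooth_res₁ (D := D) (isSmooth_const 1) (isSmooth_const 0) p1
  have r2' := isSmooth_res₂ (D := D) (isSmooth_const 1) (isSmooth_const 0) p1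
  have b1 : D.β 1 = 0 := D.penalization.eq_zero 1 D.ε₁_lt.le
  simp only [b1, sub_zero, sub_mul] at h
  rw [integral_sub (r1.mul sm).continuous.integrable_torus
      (r1'.mul sm).continuous.integrable_torus,
    integral_sub (r2.mul hu).continuous.integrable_torus
      (r2'.mul hu).continuous.integrable_torus] at h
  have k1 := integral_mul_ge (D := D) r1' sm
  have k2 := integral_mul_ge (D := D) r2' hu
  unfold apConst
  linarith

end RegProblem

end RegMFG
end

noncomputable section

namespace RegMFG

open Filter Topology

/-! ### Lower bounds for the density -/

section Lipschitz

variable {d : ℕ}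

lemma exists_lift_norm_eq (x : Torus d) : ∃ t : Fin d → ℝ, proj t = x ∧ ‖t‖ ≤ ‖x‖ := by
  obtain ⟨y, rfl⟩ := proj_surjective x
  refine ⟨fun i => y i - round (y i), ?_, ?_⟩
  · funext i
    simp [proj]
  · refine (pi_norm_le_iff_of_nonneg (norm_nonneg _)).2 fun i => ?_
    have h1 := norm_le_pi_norm (proj y) i
    rwa [proj, UnitAddCircle.norm_eq] at h1

/-- Mean value inequality on the cover, along a lift of x - x₀ no longer than its norm on the torus.
For the sup norm the derivative is bounded by the sum of the partial derivatives, whence the factor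
d. -/
lemma abs_sub_le_of_abs_pd_le {f : Torus d → ℝ} (hf : IsC 1 f) {Λ : ℝ} (hΛ : ∀ i x, |pd i f x| ≤ Λ)
    (x x₀ : Torus d) : |f x - f x₀| ≤ d * Λ * ‖x - x₀‖ := by
  rcases Nat.eq_zero_or_pos d with rfl | hd
  · rw [Subsingleton.elim x x₀]; simp
  have hΛ0 : 0 ≤ Λ := (abs_nonneg _).trans (hΛ ⟨0, hd⟩ x)
  obtain ⟨t, ht, htn⟩ := exists_lift_norm_eq (x - x₀)
  obtain ⟨y, rfl⟩ := proj_surjective x₀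
  have hx : x = proj (y + t) := by
    have : proj (y + t) = proj y + proj t := by
      funext i
      simp [proj]
    rw [this, ht]
    abel
  have hbound : ∀ z : Fin d → ℝ, ‖fderiv ℝ (fun y : Fin d → ℝ => f (proj y)) z‖ ≤ d * Λ := by
    intro z
    refine ContinuousLinearMap.opNorm_le_bound _ (by positivity) fun v => ?_
    have h1 : fderiv ℝ (fun y : Fin d → ℝ => f (proj y)) z v = ∑ i, v i * pd i f (proj z) := by
      conv_lhs => rw [← Finset.univ_sum_single v]
      rw [map_sum]
      refine Finset.sum_congr rfl fun i _ => ?_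
      rw [hf.pd_proj le_rfl, ← smul_eq_mul, ← map_smul]
      congr 1
      rw [← Pi.single_smul, smul_eq_mul, mul_one]
    rw [h1]
    refine (norm_sum_le _ _).trans ?_
    calc ∑ i, ‖v i * pd i f (proj z)‖ ≤ ∑ _i : Fin d, ‖v‖ * Λ := by
          refine Finset.sum_le_sum fun i _ => ?_
          rw [norm_mul]
          exact mul_le_mul (norm_le_pi_norm v i) (hΛ i _) (norm_nonneg _) (norm_nonneg _)
      _ = d * Λ * ‖v‖ := by simp; ring
  have h2 := Convex.norm_image_sub_le_of_norm_fderiv_le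
    (f := fun y : Fin d → ℝ => f (proj y)) (s := Set.univ)
    (fun z _ => (ContDiff.differentiable hf one_ne_zero) z) (fun z _ => hbound z) convex_univ
    (Set.mem_univ y) (Set.mem_univ (y + t))
  rw [add_sub_cancel_left, Real.norm_eq_abs, ← hx] at h2
  exact h2.trans (mul_le_mul_of_nonneg_left htn (by positivity))

lemma volume_real_closedBall (x : Torus d) {r : ℝ} (hr : 0 ≤ r) (hr' : r ≤ 1 / 2) :
    (volume : Measure (Torus d)).real (Metric.closedBall x r) = (2 * r) ^ d := by
  rw [measureReal_def, volume_pi, Measure.pi_closedBall _ x hr]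
  simp only [AddCircle.volume_closedBall, Finset.prod_const, Finset.card_univ, Fintype.card_fin]
  rw [min_eq_right (by linarith), ← ENNReal.ofReal_pow (by linarith),
    ENNReal.toReal_ofReal (by positivity)]

end Lipschitz

namespace RegProblem

variable {d : ℕ} {D : RegProblem d}

lemma penalization_mul_nonneg {s : ℝ} (hs : 0 < s) : 0 ≤ D.β s * (s - 1) := by
  have h := penalization_mono (D := D) hs one_pos
  rwa [D.penalization.eq_zero 1 D.ε₁_lt.le, sub_zero] at h

variable (D) in
lemma exists_lower_bound (Λ B : ℝ) : ∃ c : ℝ, 0 < c ∧ ∀ m : Torus d → ℝ, IsSmooth m →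
    (∀ x, 0 < m x) → (∀ i x, |pd i m x| ≤ Λ) → ∫ x, D.β (m x) * (m x - 1) ≤ B →
    ∀ x, c ≤ m x := by
  have hqd : 0 < D.q - d := sub_pos.2 D.lt_q
  -- `A` is a Lipschitz constant kept at least one, so that the radius s/A stays below s and the
  -- ball volume formula applies.
  set A : ℝ := max (d * Λ) 1
  have hA : 1 ≤ A := le_max_right _ _
  have hA0 : 0 < A := one_pos.trans_le hA
  set B' : ℝ := max (B * (2 * 2 ^ D.q * A ^ d)) 1
  have hB' : 0 < B' := one_pos.trans_le (le_max_right _ _)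
  -- Below ε₁/4, doubling the value remains in the range where β is exactly the negative power. The
  -- other entry is the threshold at which s^{-(q-d)} equals `B'`.
  refine ⟨min (D.ε₁ / 4) (B' ^ (-(D.q - d)⁻¹)),
    lt_min (by have := D.ε₁_pos; positivity) (Real.rpow_pos_of_pos hB' _), ?_⟩
  intro m hm hpos hLip hB x₀
  by_contra hlt
  rw [not_le, lt_min_iff] at hlt
  obtain ⟨hs1, hs2⟩ := hlt
  set s := m x₀
  have hs : 0 < s := hpos x₀
  have hε := D.ε₁_lt
  have hr0 : 0 ≤ s / A := by positivity
  have hrs : s / A ≤ s := div_le_self hs.le hA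
  have hball : ∀ x ∈ Metric.closedBall x₀ (s / A), 1 / 2 * (2 * s) ^ (-D.q) ≤
      D.β (m x) * (m x - 1) := by
    intro x hx
    rw [Metric.mem_closedBall, dist_eq_norm] at hx
    have h1 : |m x - s| ≤ s := by
      refine (abs_sub_le_of_abs_pd_le (hm.isC_nat 1) hLip x x₀).trans ?_
      calc d * Λ * ‖x - x₀‖ ≤ A * (s / A) :=
            mul_le_mul (le_max_left _ _) hx (norm_nonneg _) hA0.le
        _ = s := by field_simp
    have h2 : m x ≤ 2 * s := by linarith [(abs_le.1 h1).2]
    have h3 := hpos x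
    rw [D.penalization.eq_neg (m x) h3 (by linarith), one_div (m x ^ D.q),
      ← Real.rpow_neg h3.le]
    have hq : (0 : ℝ) ≤ D.q := by linarith [(Nat.cast_nonneg d : (0 : ℝ) ≤ d)]
    have h4 : (2 * s) ^ (-D.q) ≤ m x ^ (-D.q) :=
      Real.rpow_le_rpow_of_nonpos h3 h2 (by linarith)
    have h5 : 0 < (2 * s) ^ (-D.q) := Real.rpow_pos_of_pos (by positivity) _
    nlinarith
  have hc : Continuous fun x => D.β (m x) * (m x - 1) :=
    (isSmooth_beta (D := D) hm hpos).continuous.mul (hm.continuous.sub continuous_const)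
  -- Volume of the ball times the pointwise lower bound there; the rest of the integral is
  -- nonnegative.
  have h1 : (2 * (s / A)) ^ d * (1 / 2 * (2 * s) ^ (-D.q)) ≤ B := by
    refine le_trans ?_ hB
    rw [← volume_real_closedBall x₀ hr0 (by linarith), ← smul_eq_mul, ← setIntegral_const]
    refine (setIntegral_mono_on (integrable_const _).integrableOn hc.integrable_torus.integrableOn
      measurableSet_closedBall hball).trans ?_
    exact setIntegral_le_integral hc.integrable_torus
      (Eventually.of_forall fun x => penalization_mul_nonneg (hpos x))
  have h2 : s ^ (-(D.q - d)) ≤ B' := by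
    refine le_trans ?_ (le_max_left _ _)
    have e1 : (2 * s) ^ (-D.q) = (2 ^ D.q)⁻¹ * s ^ (-D.q) := by
      rw [Real.mul_rpow (by norm_num) hs.le, Real.rpow_neg (by norm_num)]
    have e2 : s ^ (-(D.q - d)) = s ^ d * s ^ (-D.q) := by
      rw [← Real.rpow_natCast, ← Real.rpow_add hs]
      congr 1
      ring
    have hsq : 0 < s ^ (-D.q) := Real.rpow_pos_of_pos hs _
    have h2q : (0 : ℝ) < 2 ^ D.q := Real.rpow_pos_of_pos (by norm_num) _
    have h3 : (s / A) ^ d * (1 / 2 * (2 * s) ^ (-D.q)) ≤ B := by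
      refine le_trans (mul_le_mul_of_nonneg_right
        (pow_le_pow_left₀ hr0 (by linarith) d) ?_) h1
      have := Real.rpow_pos_of_pos (show 0 < 2 * s by positivity) (-D.q)
      positivity
    rw [e1, div_pow] at h3
    rw [e2]
    have h4 := mul_le_mul_of_nonneg_right h3 (show 0 ≤ 2 * 2 ^ D.q * A ^ d by positivity)
    refine le_trans (le_of_eq ?_) h4
    field_simp
  have h3 : B' < s ^ (-(D.q - d)) := by
    have h4 := Real.rpow_lt_rpow_of_neg hs hs2 (neg_lt_zero.2 hqd)
    rwa [← Real.rpow_mul hB'.le, neg_mul_neg, inv_mul_cancel₀ hqd.ne', Real.rpow_one] at h4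
  linarith

end RegProblem

end RegMFG
end

noncomputable section

namespace RegMFG

open Filter Topology

/-! ### Zeros of strongly monotone maps -/

/-- A minimizer of the norm of F must be a zero: from x₀, a short step along v = -F(x₀) changes F by
Δ with ⟨Δ,v⟩ ≥ ct‖v‖² and ‖Δ‖ ≤ Ct‖v‖, so the first-order decrease of ‖F‖² beats the second-order
error. -/
lemma exists_zero_of_stronglyMonotone {V : Type*} [NormedAddCommGroup V] [InnerProductSpace ℝ V]
    {U K : Set V} {F : V → V} {c : ℝ} (hc : 0 < c) (hU : IsOpen U)
    (hLip : ∀ x ∈ U, ∃ C : ℝ, ∀ᶠ y in 𝓝 x, ‖F y - F x‖ ≤ C * ‖y - x‖)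
    (hmono : ∀ x ∈ U, ∀ y ∈ U, c * ‖x - y‖ ^ 2 ≤ inner ℝ (F x - F y) (x - y))
    (hK : IsCompact K) (hKU : K ⊆ U) {a : V} (ha : a ∈ U)
    (hsub : ∀ x ∈ U, ‖F x‖ ≤ ‖F a‖ → x ∈ K) : ∃ x ∈ U, F x = 0 := by
  have hcont : ContinuousOn F K := by
    intro x hx
    obtain ⟨C, hC⟩ := hLip x (hKU hx)
    refine ContinuousAt.continuousWithinAt ?_
    rw [ContinuousAt, tendsto_iff_norm_sub_tendsto_zero]
    refine squeeze_zero' (Eventually.of_forall fun _ => norm_nonneg _) hC ?_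
    have : Tendsto (fun y => C * ‖y - x‖) (𝓝 x) (𝓝 (C * ‖x - x‖)) :=
      ((continuous_id.sub continuous_const).norm.const_mul C).tendsto x
    simpa using this
  have haK : a ∈ K := hsub a ha le_rfl
  obtain ⟨x₀, hx₀, hmin⟩ := hK.exists_isMinOn ⟨a, haK⟩ hcont.norm
  -- Points of U outside K have larger norm than at `a`, so the minimum over K is a minimum over the
  -- open set U and every direction is admissible at x₀.
  have hminU : ∀ x ∈ U, ‖F x₀‖ ≤ ‖F x‖ := by
    intro x hx
    rcases le_total ‖F x‖ ‖F a‖ with h | h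
    · exact hmin (hsub x hx h)
    · exact (hmin haK).trans h
  refine ⟨x₀, hKU hx₀, ?_⟩
  by_contra hne
  set v := -F x₀ with hv
  have hvn : 0 < ‖v‖ := by rw [hv, norm_neg]; exact norm_pos_iff.2 hne
  obtain ⟨C, hC⟩ := hLip x₀ (hKU hx₀)
  have hpath : Tendsto (fun t : ℝ => x₀ + t • v) (𝓝[>] 0) (𝓝 x₀) := by
    have : Tendsto (fun t : ℝ => x₀ + t • v) (𝓝 0) (𝓝 (x₀ + (0 : ℝ) • v)) :=
      (continuous_const.add (continuous_id.smul continuous_const)).tendsto 0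
    simpa using this.mono_left nhdsWithin_le_nhds
  -- The change of ‖F‖² along the step is at most t‖v‖²(tC² - 2c), which is negative for these t.
  have hsmall : ∀ᶠ t : ℝ in 𝓝[>] 0, t * C ^ 2 < 2 * c := by
    have : Tendsto (fun t : ℝ => t * C ^ 2) (𝓝 0) (𝓝 (0 * C ^ 2)) :=
      (continuous_id.mul continuous_const).tendsto 0
    rw [zero_mul] at this
    exact (this.mono_left nhdsWithin_le_nhds).eventually (gt_mem_nhds (by positivity))
  obtain ⟨t, ht1, ht2, ht3, ht4⟩ := ((hpath.eventually hC).and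
    ((hpath.eventually (hU.mem_nhds (hKU hx₀))).and
      (hsmall.and self_mem_nhdsWithin))).exists
  have ht : 0 < t := ht4
  set Δ := F (x₀ + t • v) - F x₀ with hΔ
  have e1 : x₀ + t • v - x₀ = t • v := by abel
  rw [e1, norm_smul, Real.norm_of_nonneg ht.le] at ht1
  have h1 := hmono _ ht2 _ (hKU hx₀)
  rw [e1, norm_smul, Real.norm_of_nonneg ht.le, ← hΔ, real_inner_smul_right] at h1
  have h2 : c * t * ‖v‖ ^ 2 ≤ inner ℝ Δ v := by
    have : t * (c * t * ‖v‖ ^ 2) ≤ t * inner ℝ Δ v := by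
      refine le_trans (le_of_eq ?_) h1
      ring
    exact le_of_mul_le_mul_left this ht
  have h3 := hminU _ ht2
  have e2 : F (x₀ + t • v) = Δ - v := by rw [hΔ, hv]; abel
  have h4 : ‖F (x₀ + t • v)‖ ^ 2 = ‖Δ‖ ^ 2 - 2 * inner ℝ Δ v + ‖v‖ ^ 2 := by
    rw [e2, norm_sub_sq_real]
  have h5 : ‖v‖ ^ 2 ≤ ‖F (x₀ + t • v)‖ ^ 2 := by
    have : ‖v‖ = ‖F x₀‖ := norm_neg _
    rw [this]
    exact pow_le_pow_left₀ (norm_nonneg _) h3 2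
  have h6 : ‖Δ‖ ^ 2 ≤ (C * (t * ‖v‖)) ^ 2 := pow_le_pow_left₀ (norm_nonneg _) ht1 2
  have h7 : t * ‖v‖ ^ 2 * (2 * c - t * C ^ 2) ≤ 0 := by nlinarith
  have h8 : 0 < t * ‖v‖ ^ 2 * (2 * c - t * C ^ 2) :=
    mul_pos (by positivity) (by linarith)
  linarith

/-! ### Linear combinations -/

section Comb

variable {d : ℕ} {ι : Type*} [Fintype ι]

/-- The linear combination `∑ a_j φ_j`. -/
def comb (φ : ι → Torus d → ℝ) (a : ι → ℝ) (x : Torus d) : ℝ := ∑ j, a j * φ j x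

lemma isSmooth_comb {φ : ι → Torus d → ℝ} (hφ : ∀ j, IsSmooth (φ j)) (a : ι → ℝ) :
    IsSmooth (comb φ a) :=
  RegProblem.isSmooth_sum Finset.univ fun j _ => (isSmooth_const (a j)).mul (hφ j)

lemma pd_comb {φ : ι → Torus d → ℝ} (hφ : ∀ j, IsSmooth (φ j)) (a : ι → ℝ) (i : Fin d) :
    pd i (comb φ a) = comb (fun j => pd i (φ j)) a := by
  funext x
  refine pd_eq_of_hasDerivAt ?_
  unfold comb
  exact HasDerivAt.fun_sum fun j _ => (((hφ j).isC_nat 1).hasDerivAt_zero i x).const_mul (a j)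

lemma comb_sub (φ : ι → Torus d → ℝ) (a b : ι → ℝ) (x : Torus d) :
    comb φ a x - comb φ b x = comb φ (a - b) x := by
  simp [comb, sub_mul, Finset.sum_sub_distrib]

lemma lap_comb {φ : ι → Torus d → ℝ} (hφ : ∀ j, IsSmooth (φ j)) (a : ι → ℝ) :
    lap (comb φ a) = comb (fun j => lap (φ j)) a := by
  funext x
  unfold lap
  simp only [pd_comb hφ, pd_comb (fun j => (hφ j).pd _)]
  unfold comb
  simp only [Finset.mul_sum]
  exact Finset.sum_comm

lemma lap_iterate_comb {φ : ι → Torus d → ℝ} (hφ : ∀ j, IsSmooth (φ j)) (a : ι → ℝ) (n : ℕ) :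
    lap^[n] (comb φ a) = comb (fun j => lap^[n] (φ j)) a := by
  induction n with
  | zero => rfl
  | succ n ih =>
    rw [Function.iterate_succ_apply', ih, lap_comb fun j => (hφ j).lap_iterate n]
    simp only [Function.iterate_succ_apply']

lemma RegProblem.reg_comb (D : RegProblem d) {φ : ι → Torus d → ℝ} (hφ : ∀ j, IsSmooth (φ j))
    (a : ι → ℝ) : D.reg (comb φ a) = comb (fun j => D.reg (φ j)) a := by
  funext x
  unfold RegProblem.reg
  rw [lap_comb hφ, lap_iterate_comb hφ]
  unfold comb
  rw [← Finset.sum_add_distrib, ← Finset.sum_sub_distrib, Finset.mul_sum, Finset.mul_sum,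
    ← Finset.sum_add_distrib]
  refine Finset.sum_congr rfl fun j _ => ?_
  ring

lemma exists_abs_comb_le {φ : ι → Torus d → ℝ} (hφ : ∀ j, Continuous (φ j)) :
    ∃ B : ℝ, 0 ≤ B ∧ ∀ (a : ι → ℝ) x, |comb φ a x| ≤ B * ‖a‖ := by
  choose C hC using fun j => isCompact_univ.exists_bound_of_continuousOn (hφ j).continuousOn
  refine ⟨∑ j, |C j|, by positivity, fun a x => ?_⟩
  refine (Finset.abs_sum_le_sum_abs _ _).trans ?_
  rw [Finset.sum_mul]
  refine Finset.sum_le_sum fun j _ => ?_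
  rw [abs_mul, mul_comm]
  exact mul_le_mul ((hC j x (Set.mem_univ x)).trans (le_abs_self _)) (norm_le_pi_norm a j)
    (abs_nonneg _) (abs_nonneg _)

lemma integral_mul_comb {r : Torus d → ℝ} (hr : Continuous r) {φ : ι → Torus d → ℝ}
    (hφ : ∀ j, Continuous (φ j)) (a : ι → ℝ) :
    ∫ x, r x * comb φ a x = ∑ j, (∫ x, r x * φ j x) * a j := by
  simp_rw [← integral_mul_const]
  rw [← integral_finsetSum]
  · congr 1
    funext x
    unfold comb
    rw [Finset.mul_sum]
    refine Finset.sum_congr rfl fun j _ => ?_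
    ring
  · intro j _
    exact ((hr.mul (hφ j)).mul continuous_const).integrable_torus

/-- An injective linear map from a finite-dimensional space is bounded below. Injectivity into L²
holds because a continuous combination that vanishes almost everywhere vanishes identically. -/
lemma exists_sq_le_integral {φ : ι → Torus d → ℝ} (hφ : ∀ j, Continuous (φ j))
    (hli : LinearIndependent ℝ φ) :
    ∃ c : ℝ, 0 < c ∧ ∀ a : ι → ℝ, c * ∑ j, a j ^ 2 ≤ ∫ x, comb φ a x ^ 2 := by
  let T : EuclideanSpace ℝ ι →ₗ[ℝ] Lp ℝ 2 (volume : Measure (Torus d)) :=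
    { toFun := fun a => ∑ j, a j • ((hφ j).memLp_torus 2).toLp
      map_add' := fun a b => by simp [add_smul, Finset.sum_add_distrib]
      map_smul' := fun c a => by simp [Finset.smul_sum, smul_smul] }
  have hT : ∀ a, T a =ᵐ[volume] comb φ a := by
    intro a
    have h1 : ∀ s : Finset ι, (∑ j ∈ s, a j • ((hφ j).memLp_torus 2).toLp :
        Lp ℝ 2 (volume : Measure (Torus d))) =ᵐ[volume] fun x => ∑ j ∈ s, a j * φ j x := by
      classical
      intro s
      induction s using Finset.induction_on with
      | empty =>
        simp only [Finset.sum_empty]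
        exact Lp.coeFn_zero ℝ 2 (volume : Measure (Torus d))
      | insert j s hj ih =>
        rw [Finset.sum_insert hj]
        filter_upwards [Lp.coeFn_add (a j • ((hφ j).memLp_torus 2).toLp)
          (∑ j ∈ s, a j • ((hφ j).memLp_torus 2).toLp), ih,
          Lp.coeFn_smul (a j) ((hφ j).memLp_torus 2).toLp,
          ((hφ j).memLp_torus 2).coeFn_toLp] with x e1 e2 e3 e4
        rw [e1, Pi.add_apply, e2, e3, Pi.smul_apply, e4, Finset.sum_insert hj, smul_eq_mul]
    exact h1 Finset.univ
  have hcomb : ∀ a : ι → ℝ, Continuous (comb φ a) := fun a =>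
    continuous_finsetSum _ fun j _ => continuous_const.mul (hφ j)
  have hker : LinearMap.ker T = ⊥ := by
    rw [LinearMap.ker_eq_bot']
    intro a ha
    have h1 : comb φ a = fun _ => 0 := by
      refine (Continuous.ae_eq_iff_eq (volume : Measure (Torus d)) (hcomb a) continuous_const).1 ?_
      have h2 := hT a
      rw [ha] at h2
      exact h2.symm.trans (Lp.coeFn_zero ℝ 2 (volume : Measure (Torus d)))
    ext j
    refine Fintype.linearIndependent_iff.1 hli (fun j => a j) ?_ j
    funext x
    simpa [comb] using congrFun h1 x
  obtain ⟨K, hK, hKT⟩ := T.exists_antilipschitzWith hker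
  have hK0 : (0 : ℝ) < K := hK
  refine ⟨((K : ℝ) ^ 2)⁻¹, by positivity, fun a => ?_⟩
  have h1 := hKT.le_mul_norm (map_zero T) (WithLp.toLp 2 a)
  have h2 : ‖T (WithLp.toLp 2 a)‖ ^ 2 = ∫ x, comb φ a x ^ 2 := by
    rw [← real_inner_self_eq_norm_sq, L2.inner_def]
    refine integral_congr_ae ?_
    filter_upwards [hT (WithLp.toLp 2 a)] with x hx
    rw [hx]
    simp [pow_two]
  have h3 : ‖(WithLp.toLp 2 a : EuclideanSpace ℝ ι)‖ ^ 2 = ∑ j, a j ^ 2 := by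
    rw [EuclideanSpace.norm_sq_eq]
    simp
  rw [← h2, ← h3, inv_mul_le_iff₀ (by positivity), ← mul_pow]
  exact pow_le_pow_left₀ (norm_nonneg _) h1 2

end Comb

/-! ### Estimates for jets -/

section Jet

variable {d : ℕ}

lemma norm_jet_sub_le {u u' m m' θ θ' : Torus d → ℝ} {x : Torus d} {δ : ℝ} (hδ : 0 ≤ δ)
    (h1 : ∀ i, |pd i u x - pd i u' x| ≤ δ) (h2 : ∀ i j, |pd i (pd j u) x - pd i (pd j u') x| ≤ δ)
    (hm : |m x - m' x| ≤ δ) (hθ : |θ x - θ' x| ≤ δ) :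
    ‖jet u m θ x - jet u' m' θ' x‖ ≤ (d + 1) * δ := by
  have hδ' : δ ≤ (d + 1) * δ := le_mul_of_one_le_left hδ (by simp)
  refine max_le ?_ (max_le ?_ (max_le (hm.trans hδ') (hθ.trans hδ')))
  · refine (pow_le_pow_iff_left₀ (norm_nonneg _) (by positivity) two_ne_zero).1 ?_
    rw [EuclideanSpace.norm_sq_eq]
    calc ∑ i, ‖(grad u x - grad u' x) i‖ ^ 2 ≤ ∑ _i : Fin d, δ ^ 2 := by
          refine Finset.sum_le_sum fun i _ => ?_
          exact pow_le_pow_left₀ (norm_nonneg _) (h1 i) 2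
      _ = d * δ ^ 2 := by simp
      _ ≤ ((d + 1) * δ) ^ 2 := by
          rw [mul_pow]
          refine mul_le_mul_of_nonneg_right ?_ (sq_nonneg _)
          nlinarith [(Nat.cast_nonneg d : (0 : ℝ) ≤ d)]
  · refine (pi_norm_le_iff_of_nonneg (by positivity)).2 fun i =>
      (pi_norm_le_iff_of_nonneg (by positivity)).2 fun j => ?_
    exact (h2 i j).trans hδ'

lemma exists_norm_jet_le {u m θ : Torus d → ℝ} (hu : IsC 2 u) (hm : Continuous m)
    (hθ : Continuous θ) : ∃ R : ℝ, ∀ x, ‖jet u m θ x‖ ≤ R := by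
  have hc : Continuous (jet u m θ) := by
    refine isQuotientMap_proj.continuous_iff.2 (ContDiff.continuous (𝕜 := ℝ) (n := 0) ?_)
    refine contDiff_jet (n := 0) (by simpa using hu) ?_ ?_
    · exact contDiff_zero.2 (hm.comp continuous_proj)
    · exact contDiff_zero.2 (hθ.comp continuous_proj)
  obtain ⟨R, hR⟩ := isCompact_univ.exists_bound_of_continuousOn hc.continuousOn
  exact ⟨R, fun x => hR x (Set.mem_univ x)⟩

lemma exists_pos_le {m : Torus d → ℝ} (hm : Continuous m) (hpos : ∀ x, 0 < m x) :
    ∃ c : ℝ, 0 < c ∧ ∀ x, c ≤ m x := by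
  obtain ⟨x₀, -, hx₀⟩ := isCompact_univ.exists_isMinOn ⟨0, Set.mem_univ _⟩ hm.continuousOn
  exact ⟨m x₀, hpos x₀, fun x => hx₀ (Set.mem_univ x)⟩

end Jet

end RegMFG
end

noncomputable section

namespace RegMFG

open Filter Topology

/-! ### The Galerkin approximation -/

namespace RegProblem

variable {d : ℕ} (D : RegProblem d) {ι : Type*} [Fintype ι] (φ : ι → Torus d → ℝ)

/-- Coordinates of pairs `(m, u)` in a Galerkin space. -/
abbrev Coord (ι : Type*) : Type _ := EuclideanSpace ℝ (ι ⊕ ι)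

/-- The coordinates of the density. -/
def cl {ι : Type*} (x : Coord ι) (j : ι) : ℝ := x (Sum.inl j)

/-- The coordinates of the value function. -/
def cr {ι : Type*} (x : Coord ι) (j : ι) : ℝ := x (Sum.inr j)

lemma norm_cl_sub_le (x y : Coord ι) : ‖cl x - cl y‖ ≤ ‖x - y‖ :=
  (pi_norm_le_iff_of_nonneg (norm_nonneg _)).2 fun j => PiLp.norm_apply_le (x - y) (Sum.inl j)

lemma norm_cr_sub_le (x y : Coord ι) : ‖cr x - cr y‖ ≤ ‖x - y‖ :=
  (pi_norm_le_iff_of_nonneg (norm_nonneg _)).2 fun j => PiLp.norm_apply_le (x - y) (Sum.inr j)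

lemma norm_cl_le (x : Coord ι) : ‖cl x‖ ≤ ‖x‖ :=
  (pi_norm_le_iff_of_nonneg (norm_nonneg _)).2 fun j => PiLp.norm_apply_le x (Sum.inl j)

lemma continuous_cl {ι : Type*} : Continuous (cl : Coord ι → ι → ℝ) := by
  unfold cl
  fun_prop

/-- The Galerkin map: the residuals tested with the basis. -/
def gal (x : Coord ι) : Coord ι := WithLp.toLp 2 <| Sum.elim
  (fun j => ∫ t, D.res₁ (comb φ (cl x)) (comb φ (cr x)) t * φ j t)
  (fun j => ∫ t, D.res₂ (comb φ (cl x)) (comb φ (cr x)) t * φ j t)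

/-- The coordinates of positive densities. -/
def posCone : Set (Coord ι) := {x | ∀ t, 0 < comb φ (cl x) t}

variable {D φ}

lemma exists_near (hφ : ∀ j, IsSmooth (φ j)) {x : Coord ι} (hx : x ∈ posCone φ) :
    ∃ c : ℝ, 0 < c ∧ ∀ᶠ y in 𝓝 x, ∀ t, c ≤ comb φ (cl y) t := by
  obtain ⟨c, hc, hcm⟩ := exists_pos_le (isSmooth_comb hφ (cl x)).continuous hx
  obtain ⟨B, hB, hBφ⟩ := exists_abs_comb_le fun j => (hφ j).continuous
  refine ⟨c / 2, by positivity, ?_⟩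
  have h1 : ∀ᶠ y in 𝓝 x, B * ‖y - x‖ < c / 2 := by
    have : Tendsto (fun y => B * ‖y - x‖) (𝓝 x) (𝓝 (B * ‖x - x‖)) :=
      ((continuous_id.sub continuous_const).norm.const_mul B).tendsto x
    rw [sub_self, norm_zero, mul_zero] at this
    exact this.eventually (gt_mem_nhds (by positivity))
  filter_upwards [h1] with y hy t
  have h2 := hBφ (cl y - cl x) t
  rw [← comb_sub] at h2
  have h3 := mul_le_mul_of_nonneg_left (norm_cl_sub_le y x) hB
  have h4 := (abs_le.1 h2).1
  have h5 := hcm t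
  linarith

lemma isOpen_posCone (hφ : ∀ j, IsSmooth (φ j)) : IsOpen (posCone φ) := by
  rw [isOpen_iff_mem_nhds]
  intro x hx
  obtain ⟨c, hc, hev⟩ := exists_near hφ hx
  filter_upwards [hev] with y hy t
  exact hc.trans_le (hy t)

/-- All entries of the jet except h(𝐦) are linear in the coordinates; for that entry
`nonlocal_lipschitzAt` is used at the base point. -/
lemma jt_lipschitzAt (hφ : ∀ j, IsSmooth (φ j)) {x : Coord ι} (hx : x ∈ posCone φ) :
    ∃ C : ℝ, 0 ≤ C ∧ ∀ᶠ y in 𝓝 x, ∀ t, ‖D.jt (comb φ (cl y)) (comb φ (cr y)) t -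
      D.jt (comb φ (cl x)) (comb φ (cr x)) t‖ ≤ C * ‖y - x‖ := by
  obtain ⟨B, hB, hBφ⟩ := exists_abs_comb_le fun j => (hφ j).continuous
  choose B₁ hB₁ hBφ₁ using fun i => exists_abs_comb_le fun j => ((hφ j).pd i).continuous
  choose B₂ hB₂ hBφ₂ using fun i k => exists_abs_comb_le fun j => (((hφ j).pd k).pd i).continuous
  obtain ⟨K, hK, hKh⟩ := nonlocal_lipschitzAt D.assumptionH hφ (a := cl x) fun t => (hx t).le
  have hev := (continuous_cl.tendsto x).eventually hKh
  set C := B + (∑ i, B₁ i) + (∑ i, ∑ k, B₂ i k) + K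
  have s1 : 0 ≤ ∑ i, B₁ i := Finset.sum_nonneg fun i _ => hB₁ i
  have s2 : 0 ≤ ∑ i, ∑ k, B₂ i k := Finset.sum_nonneg fun i _ => Finset.sum_nonneg fun k _ => hB₂ i k
  have hC : 0 ≤ C := by positivity
  have c1 : ∀ i, B₁ i ≤ C := fun i => by
    have := Finset.single_le_sum (f := B₁) (fun i _ => hB₁ i) (Finset.mem_univ i)
    simp only [C]
    linarith
  have c2 : ∀ i k, B₂ i k ≤ C := fun i k => by
    have h1 := Finset.single_le_sum (f := B₂ i) (fun k _ => hB₂ i k) (Finset.mem_univ k)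
    have h2 := Finset.single_le_sum (f := fun i => ∑ k, B₂ i k)
      (fun i _ => Finset.sum_nonneg fun k _ => hB₂ i k) (Finset.mem_univ i)
    simp only [C]
    linarith
  refine ⟨(d + 1) * C, by positivity, ?_⟩
  filter_upwards [hev, isOpen_posCone hφ |>.mem_nhds hx] with y hy hypos t
  rw [mul_assoc]
  have hn : 0 ≤ ‖y - x‖ := norm_nonneg _
  refine norm_jet_sub_le (by positivity) (fun i => ?_) (fun i k => ?_) ?_ ?_
  · rw [pd_comb hφ, pd_comb hφ, comb_sub]
    refine (hBφ₁ i _ t).trans ?_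
    exact mul_le_mul (c1 i) (norm_cr_sub_le y x) (norm_nonneg _) hC
  · rw [pd_comb hφ, pd_comb hφ, pd_comb fun j => (hφ j).pd k, pd_comb fun j => (hφ j).pd k, comb_sub]
    refine (hBφ₂ i k _ t).trans ?_
    exact mul_le_mul (c2 i k) (norm_cr_sub_le y x) (norm_nonneg _) hC
  · rw [comb_sub]
    refine (hBφ _ t).trans ?_
    exact mul_le_mul (by simp only [C]; linarith) (norm_cl_sub_le y x) (norm_nonneg _) hC
  · refine (hy (fun t => (hypos t).le) t).trans ?_
    exact mul_le_mul (by simp only [C]; linarith) (norm_cl_sub_le y x) (norm_nonneg _) hC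

lemma comp_lipschitzAt (hφ : ∀ j, IsSmooth (φ j)) {Ψ : Torus d → JetSpace d → ℝ} (hΨ : IsNice Ψ)
    {x : Coord ι} (hx : x ∈ posCone φ) :
    ∃ C : ℝ, 0 ≤ C ∧ ∀ᶠ y in 𝓝 x, ∀ t, |Ψ t (D.jt (comb φ (cl y)) (comb φ (cr y)) t) -
      Ψ t (D.jt (comb φ (cl x)) (comb φ (cr x)) t)| ≤ C * ‖y - x‖ := by
  obtain ⟨c, hc, hev⟩ := exists_near hφ hx
  obtain ⟨C, hC, hCj⟩ := jt_lipschitzAt (D := D) hφ hx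
  obtain ⟨R, hR⟩ := exists_norm_jet_le ((isSmooth_comb hφ (cr x)).isC_nat 2)
    (isSmooth_comb hφ (cl x)).continuous (map_continuous (D.h (bold (comb φ (cl x)))))
  -- For ‖y - x‖ < 1 the nearby jets stay within distance `C` of those at x, so one compact region
  -- serves all of them.
  obtain ⟨K, hK, hKΨ⟩ := hΨ.exists_lipschitz hc (R + C)
  refine ⟨K * C, by positivity, ?_⟩
  have h1 : ∀ᶠ y in 𝓝 x, ‖y - x‖ < 1 := by
    filter_upwards [Metric.ball_mem_nhds x one_pos] with y hy
    rwa [← dist_eq_norm]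
  filter_upwards [hev, hCj, h1] with y hy1 hy2 hy3 t
  have hxc := hev.self_of_nhds
  have h2 : C * ‖y - x‖ ≤ C := mul_le_of_le_one_right hC hy3.le
  refine (hKΨ t _ _ ?_ ?_ (hy1 t) (hxc t)).trans ?_
  · calc ‖D.jt (comb φ (cl y)) (comb φ (cr y)) t‖ ≤
        ‖D.jt (comb φ (cl x)) (comb φ (cr x)) t‖ + ‖D.jt (comb φ (cl y)) (comb φ (cr y)) t -
          D.jt (comb φ (cl x)) (comb φ (cr x)) t‖ := norm_le_insert' _ _
      _ ≤ R + C := add_le_add (hR t) ((hy2 t).trans h2)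
  · exact (hR t).trans (by linarith)
  · rw [mul_assoc]
    exact mul_le_mul_of_nonneg_left (hy2 t) hK

lemma abs_integral_mul_sub_le {f f' w : Torus d → ℝ} (hf : Continuous f) (hf' : Continuous f')
    (hw : Continuous w) {δ B : ℝ} (hδ : ∀ t, |f t - f' t| ≤ δ) (hB : ∀ t, |w t| ≤ B) :
    |(∫ t, f t * w t) - ∫ t, f' t * w t| ≤ δ * B := by
  have i1 : Integrable (fun t => f t * w t) (volume : Measure (Torus d)) :=
    (hf.mul hw).integrable_torus
  have i2 : Integrable (fun t => f' t * w t) (volume : Measure (Torus d)) :=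
    (hf'.mul hw).integrable_torus
  rw [← integral_sub i1 i2, ← Real.norm_eq_abs]
  refine (norm_integral_le_of_norm_le_const (μ := (volume : Measure (Torus d))) (C := δ * B)
    (Eventually.of_forall fun t => ?_)).trans ?_
  · rw [← sub_mul, norm_mul]
    exact mul_le_mul (hδ t) (hB t) (abs_nonneg _) ((abs_nonneg _).trans (hδ t))
  · rw [probReal_univ, mul_one]

lemma exists_abs_le {w : Torus d → ℝ} (hw : Continuous w) : ∃ B : ℝ, 0 ≤ B ∧ ∀ t, |w t| ≤ B := by
  obtain ⟨C, hC⟩ := isCompact_univ.exists_bound_of_continuousOn hw.continuousOn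
  exact ⟨C, (norm_nonneg _).trans (hC 0 (Set.mem_univ _)), fun t => hC t (Set.mem_univ t)⟩

lemma integral_comp_lipschitzAt (hφ : ∀ j, IsSmooth (φ j)) {Ψ : Torus d → JetSpace d → ℝ}
    (hΨ : IsNice Ψ) {w : Torus d → ℝ} (hw : IsSmooth w) {x : Coord ι} (hx : x ∈ posCone φ) :
    ∃ C : ℝ, ∀ᶠ y in 𝓝 x, |(∫ t, Ψ t (D.jt (comb φ (cl y)) (comb φ (cr y)) t) * w t) -
      ∫ t, Ψ t (D.jt (comb φ (cl x)) (comb φ (cr x)) t) * w t| ≤ C * ‖y - x‖ := by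
  obtain ⟨C, hC, hev⟩ := comp_lipschitzAt (D := D) hφ hΨ hx
  obtain ⟨B, hB, hBw⟩ := exists_abs_le hw.continuous
  refine ⟨C * B, ?_⟩
  filter_upwards [hev, (isOpen_posCone hφ).mem_nhds hx] with y hy hypos
  have hc : ∀ {y : Coord ι}, y ∈ posCone φ → Continuous fun t =>
      Ψ t (D.jt (comb φ (cl y)) (comb φ (cr y)) t) := fun hy =>
    (isSmooth_comp hΨ (isSmooth_comb hφ _) (isSmooth_comb hφ _) hy).continuous
  refine (abs_integral_mul_sub_le (hc hypos) (hc hx) hw.continuous hy hBw).trans (le_of_eq ?_)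
  ring

/-- Each coordinate is an integral of an affine expression in the coordinates plus nonlinear
functions of the jet, all paired with fixed smooth functions after integration by parts. -/
lemma gal_lipschitzAt (hφ : ∀ j, IsSmooth (φ j)) {x : Coord ι} (hx : x ∈ posCone φ) :
    ∃ C : ℝ, ∀ᶠ y in 𝓝 x, ‖D.gal φ y - D.gal φ x‖ ≤ C * ‖y - x‖ := by
  obtain ⟨B, hB, hBφ⟩ := exists_abs_comb_le fun j => (hφ j).continuous
  obtain ⟨B', hB', hBφ'⟩ := exists_abs_comb_le fun j => (D.isSmooth_reg (hφ j)).continuous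
  have hlin₁ : ∀ (y : Coord ι) t, |(-comb φ (cr y) t + D.reg (comb φ (cl y)) t) -
      (-comb φ (cr x) t + D.reg (comb φ (cl x)) t)| ≤ (B + B') * ‖y - x‖ := by
    intro y t
    have h1 : (-comb φ (cr y) t + D.reg (comb φ (cl y)) t) -
        (-comb φ (cr x) t + D.reg (comb φ (cl x)) t) =
        -comb φ (cr y - cr x) t + comb (fun j => D.reg (φ j)) (cl y - cl x) t := by
      rw [← comb_sub, ← comb_sub, D.reg_comb hφ, D.reg_comb hφ]
      ring
    rw [h1, add_mul]
    refine (abs_add_le _ _).trans (add_le_add ?_ ?_)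
    · rw [abs_neg]
      exact (hBφ _ t).trans (mul_le_mul_of_nonneg_left (norm_cr_sub_le y x) hB)
    · exact (hBφ' _ t).trans (mul_le_mul_of_nonneg_left (norm_cl_sub_le y x) hB')
  have hlin₂ : ∀ (y : Coord ι) t, |(comb φ (cl y) t - 1 + D.reg (comb φ (cr y)) t) -
      (comb φ (cl x) t - 1 + D.reg (comb φ (cr x)) t)| ≤ (B + B') * ‖y - x‖ := by
    intro y t
    have h1 : (comb φ (cl y) t - 1 + D.reg (comb φ (cr y)) t) -
        (comb φ (cl x) t - 1 + D.reg (comb φ (cr x)) t) =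
        comb φ (cl y - cl x) t + comb (fun j => D.reg (φ j)) (cr y - cr x) t := by
      rw [← comb_sub, ← comb_sub, D.reg_comb hφ, D.reg_comb hφ]
      ring
    rw [h1, add_mul]
    refine (abs_add_le _ _).trans (add_le_add ?_ ?_)
    · exact (hBφ _ t).trans (mul_le_mul_of_nonneg_left (norm_cl_sub_le y x) hB)
    · exact (hBφ' _ t).trans (mul_le_mul_of_nonneg_left (norm_cr_sub_le y x) hB')
  have hs : ∀ a, IsSmooth (comb φ a) := fun a => isSmooth_comb hφ a
  have hcoord : ∀ j : ι ⊕ ι, ∃ C : ℝ, ∀ᶠ y in 𝓝 x,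
      |D.gal φ y j - D.gal φ x j| ≤ C * ‖y - x‖ := by
    rintro (j | j)
    · obtain ⟨Bw, hBw, hw⟩ := exists_abs_le (hφ j).continuous
      obtain ⟨C, hC⟩ := integral_comp_lipschitzAt (D := D) hφ D.isNice_nl₁ (hφ j) hx
      refine ⟨(B + B') * Bw + C, ?_⟩
      filter_upwards [hC, (isOpen_posCone hφ).mem_nhds hx] with y hy hypos
      change |(∫ t, D.res₁ (comb φ (cl y)) (comb φ (cr y)) t * φ j t) -
        ∫ t, D.res₁ (comb φ (cl x)) (comb φ (cr x)) t * φ j t| ≤ _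
      rw [integral_res₁_mul (hs _) (hs _) hypos (hφ j), integral_res₁_mul (hs _) (hs _) hx (hφ j),
        add_sub_add_comm]
      have h1 := abs_integral_mul_sub_le ((hs (cr y)).neg.add (D.isSmooth_reg (hs (cl y)))).continuous
        ((hs (cr x)).neg.add (D.isSmooth_reg (hs (cl x)))).continuous (hφ j).continuous (hlin₁ y) hw
      refine (abs_add_le _ _).trans ?_
      linarith
    · obtain ⟨Bw, hBw, hw⟩ := exists_abs_le (hφ j).continuous
      choose C₁ hC₁ using fun i =>
        integral_comp_lipschitzAt (D := D) hφ (D.isNice_flux i) ((hφ j).pd i) hx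
      choose C₂ hC₂ using fun i k =>
        integral_comp_lipschitzAt (D := D) hφ (D.isNice_flux₂ i k) (((hφ j).pd i).pd k) hx
      refine ⟨(B + B') * Bw + ∑ i, C₁ i + ∑ i, ∑ k, C₂ i k, ?_⟩
      have e1 := eventually_all.2 hC₁
      have e2 := eventually_all.2 fun i => eventually_all.2 (hC₂ i)
      filter_upwards [e1, e2, (isOpen_posCone hφ).mem_nhds hx] with y hy1 hy2 hypos
      change |(∫ t, D.res₂ (comb φ (cl y)) (comb φ (cr y)) t * φ j t) -
        ∫ t, D.res₂ (comb φ (cl x)) (comb φ (cr x)) t * φ j t| ≤ _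
      rw [integral_res₂_mul (hs _) (hs _) hypos (hφ j), integral_res₂_mul (hs _) (hs _) hx (hφ j),
        add_sub_add_comm, add_sub_add_comm, ← Finset.sum_sub_distrib, ← Finset.sum_sub_distrib]
      simp_rw [← Finset.sum_sub_distrib]
      have h1 := abs_integral_mul_sub_le
        (((hs (cl y)).sub (isSmooth_const 1)).add (D.isSmooth_reg (hs (cr y)))).continuous
        (((hs (cl x)).sub (isSmooth_const 1)).add (D.isSmooth_reg (hs (cr x)))).continuous
        (hφ j).continuous (hlin₂ y) hw
      have h2 := (Finset.abs_sum_le_sum_abs _ Finset.univ).trans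
        (Finset.sum_le_sum fun i _ => hy1 i)
      have h3 := (Finset.abs_sum_le_sum_abs _ Finset.univ).trans
        (Finset.sum_le_sum fun i (_ : i ∈ Finset.univ) =>
          (Finset.abs_sum_le_sum_abs _ Finset.univ).trans
            (Finset.sum_le_sum fun k _ => hy2 i k))
      rw [← Finset.sum_mul] at h2
      simp_rw [← Finset.sum_mul] at h3
      refine (abs_add_three _ _ _).trans ?_
      rw [add_mul, add_mul]
      refine add_le_add (add_le_add (h1.trans (le_of_eq (by ring))) h2) h3
  choose C hC using hcoord
  refine ⟨∑ j, |C j|, ?_⟩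
  filter_upwards [eventually_all.2 hC] with y hy
  have h1 : ‖D.gal φ y - D.gal φ x‖ ≤ ∑ j, ‖(D.gal φ y - D.gal φ x) j‖ := by
    rw [EuclideanSpace.norm_eq]
    refine Real.sqrt_le_iff.2 ⟨by positivity, ?_⟩
    exact Finset.sum_sq_le_sq_sum_of_nonneg fun i _ => norm_nonneg _
  refine h1.trans ?_
  rw [Finset.sum_mul]
  refine Finset.sum_le_sum fun j _ => (hy j).trans ?_
  exact mul_le_mul_of_nonneg_right (le_abs_self _) (norm_nonneg _)

lemma inner_coord (x y : Coord ι) :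
    inner ℝ x y = ∑ j, cl x j * cl y j + ∑ j, cr x j * cr y j := by
  rw [PiLp.inner_apply, Fintype.sum_sum_type]
  simp [cl, cr, mul_comm]

lemma norm_sq_coord (x : Coord ι) : ‖x‖ ^ 2 = ∑ j, cl x j ^ 2 + ∑ j, cr x j ^ 2 := by
  rw [EuclideanSpace.norm_sq_eq, Fintype.sum_sum_type]
  simp [cl, cr]

lemma inner_gal_sub (hφ : ∀ j, IsSmooth (φ j)) {x y : Coord ι} (hx : x ∈ posCone φ)
    (hy : y ∈ posCone φ) :
    inner ℝ (D.gal φ x - D.gal φ y) (x - y) =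
      (∫ t, (D.res₁ (comb φ (cl x)) (comb φ (cr x)) t - D.res₁ (comb φ (cl y)) (comb φ (cr y)) t) *
        (comb φ (cl x) t - comb φ (cl y) t)) +
      ∫ t, (D.res₂ (comb φ (cl x)) (comb φ (cr x)) t - D.res₂ (comb φ (cl y)) (comb φ (cr y)) t) *
        (comb φ (cr x) t - comb φ (cr y) t) := by
  have hs : ∀ a, IsSmooth (comb φ a) := fun a => isSmooth_comb hφ a
  have hc : ∀ j, Continuous (φ j) := fun j => (hφ j).continuous
  have r1 := isSmooth_res₁ (D := D) (hs _) (hs (cr x)) hx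
  have r1' := isSmooth_res₁ (D := D) (hs _) (hs (cr y)) hy
  have r2 := isSmooth_res₂ (D := D) (hs _) (hs (cr x)) hx
  have r2' := isSmooth_res₂ (D := D) (hs _) (hs (cr y)) hy
  simp only [comb_sub]
  rw [integral_mul_comb (r1.sub r1').continuous hc, integral_mul_comb (r2.sub r2').continuous hc,
    inner_coord]
  have key : ∀ {r r' : Torus d → ℝ}, IsSmooth r → IsSmooth r' → ∀ j,
      ∫ t, (r t - r' t) * φ j t = (∫ t, r t * φ j t) - ∫ t, r' t * φ j t := by
    intro r r' hr hr' j
    rw [← integral_sub (hr.mul (hφ j)).continuous.integrable_torus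
      (hr'.mul (hφ j)).continuous.integrable_torus]
    simp only [sub_mul]
  simp only [key r1 r1', key r2 r2']
  rfl

lemma inner_gal (hφ : ∀ j, IsSmooth (φ j)) {x : Coord ι} (hx : x ∈ posCone φ) (z : Coord ι) :
    inner ℝ (D.gal φ x) z =
      (∫ t, D.res₁ (comb φ (cl x)) (comb φ (cr x)) t * comb φ (cl z) t) +
      ∫ t, D.res₂ (comb φ (cl x)) (comb φ (cr x)) t * comb φ (cr z) t := by
  have hs : ∀ a, IsSmooth (comb φ a) := fun a => isSmooth_comb hφ a
  have hc : ∀ j, Continuous (φ j) := fun j => (hφ j).continuous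
  rw [integral_mul_comb (isSmooth_res₁ (D := D) (hs _) (hs (cr x)) hx).continuous hc,
    integral_mul_comb (isSmooth_res₂ (D := D) (hs _) (hs (cr x)) hx).continuous hc, inner_coord]
  rfl

lemma apConst_nonneg : 0 ≤ D.apConst := by
  have := D.ε₁_pos
  have h1 : 0 ≤ ∫ x, D.res₁ (fun _ => 1) (fun _ => 0) x ^ 2 := integral_nonneg fun x => sq_nonneg _
  have h2 : 0 ≤ ∫ x, D.res₂ (fun _ => 1) (fun _ => 0) x ^ 2 := integral_nonneg fun x => sq_nonneg _
  unfold apConst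
  positivity

/-- The base point is the pair (1,0), so `a_priori` with small tested residuals becomes a bound on
‖x - a‖ and on the penalization integral. -/
lemma exists_galerkin_coord (hφ : ∀ j, IsSmooth (φ j)) (hli : LinearIndependent ℝ φ)
    {a₁ : ι → ℝ} (ha₁ : ∀ t, comb φ a₁ t = 1) :
    ∃ x ∈ posCone φ, D.gal φ x = 0 := by
  have hs : ∀ a, IsSmooth (comb φ a) := fun a => isSmooth_comb hφ a
  have hε := D.ε₁_pos
  obtain ⟨c₀, hc₀, hc₀φ⟩ := exists_sq_le_integral (fun j => (hφ j).continuous) hli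
  have henergy : ∀ z : Coord ι, D.ε₁ * c₀ * ‖z‖ ^ 2 ≤
      D.energy (comb φ (cl z)) + D.energy (comb φ (cr z)) := by
    intro z
    have h1 := D.integral_sq_le_energy (hs (cl z))
    have h2 := D.integral_sq_le_energy (hs (cr z))
    have h3 := mul_le_mul_of_nonneg_left (hc₀φ (cl z)) hε.le
    have h4 := mul_le_mul_of_nonneg_left (hc₀φ (cr z)) hε.le
    rw [norm_sq_coord]
    linarith
  let a : Coord ι := WithLp.toLp 2 (Sum.elim a₁ fun _ => 0)
  have hcla : comb φ (cl a) = fun _ => 1 := funext ha₁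
  have hcra : comb φ (cr a) = fun _ => 0 := funext fun t => by simp [comb, cr, a]
  have ha : a ∈ posCone φ := fun t => by rw [hcla]; exact one_pos
  set ρ := ‖D.gal φ a‖
  set C := D.apConst
  have hC : 0 ≤ C := apConst_nonneg
  -- The a priori estimate reads ε₁c₀R² ≤ 2(ρR + C) for R = ‖x - a‖; when R > 1 the constant C is at
  -- most CR, and R can be divided out.
  set r := max 1 (2 * (ρ + C) / (D.ε₁ * c₀))
  have hr : 1 ≤ r := le_max_left _ _
  choose B hB hBφ using fun i => exists_abs_comb_le fun j => ((hφ j).pd i).continuous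
  -- These bounds may depend on the basis: only compactness in this fixed finite-dimensional space
  -- is at stake.
  obtain ⟨c, hc, hlow⟩ := D.exists_lower_bound ((∑ i, B i) * (‖a‖ + r)) (ρ * r + C)
  have hest : ∀ x ∈ posCone φ, ‖D.gal φ x‖ ≤ ρ → ‖x - a‖ ≤ r ∧ ∀ t, c ≤ comb φ (cl x) t := by
    intro x hx hxρ
    have h1 := a_priori (D := D) (hs (cl x)) (hs (cr x)) hx
    have e1 : (fun t => comb φ (cl x) t - 1) = comb φ (cl (x - a)) := by
      funext t
      rw [← ha₁ t, comb_sub]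
      rfl
    have e2 : comb φ (cr x) = comb φ (cr (x - a)) := by
      funext t
      have : comb φ (cr x) t - comb φ (cr a) t = comb φ (cr (x - a)) t := comb_sub _ _ _ _
      rw [← this, hcra, sub_zero]
    have e3 : (∫ t, D.res₁ (comb φ (cl x)) (comb φ (cr x)) t * (comb φ (cl x) t - 1)) +
        (∫ t, D.res₂ (comb φ (cl x)) (comb φ (cr x)) t * comb φ (cr x) t) =
        inner ℝ (D.gal φ x) (x - a) := by
      rw [inner_gal hφ hx, ← e1, ← e2]
    have h2 := real_inner_le_norm (D.gal φ x) (x - a)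
    have h3 : ‖D.gal φ x‖ * ‖x - a‖ ≤ ρ * ‖x - a‖ :=
      mul_le_mul_of_nonneg_right hxρ (norm_nonneg _)
    have h4 := henergy (x - a)
    rw [← e1, ← e2] at h4
    have h5 : 0 ≤ ∫ t, D.β (comb φ (cl x) t) * (comb φ (cl x) t - 1) :=
      integral_nonneg fun t => penalization_mul_nonneg (hx t)
    rw [e3] at h1
    have hεc : 0 < D.ε₁ * c₀ := by positivity
    have h6 : ‖x - a‖ ≤ r := by
      by_contra hlt
      rw [not_le] at hlt
      have g1 : 1 < ‖x - a‖ := hr.trans_lt hlt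
      have g2 : 2 * (ρ + C) / (D.ε₁ * c₀) < ‖x - a‖ := (le_max_right _ _).trans_lt hlt
      rw [div_lt_iff₀ hεc] at g2
      have g3 : D.ε₁ * c₀ * ‖x - a‖ ^ 2 ≤ 2 * (ρ * ‖x - a‖ + C) := by linarith
      have g4 : C ≤ C * ‖x - a‖ := le_mul_of_one_le_right hC g1.le
      nlinarith
    refine ⟨h6, hlow _ (hs _) hx (fun i t => ?_) ?_⟩
    · rw [pd_comb hφ]
      refine (hBφ i _ t).trans ?_
      refine mul_le_mul (Finset.single_le_sum (f := B) (fun i _ => hB i) (Finset.mem_univ i))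
        ((norm_cl_le x).trans ?_) (norm_nonneg _) (Finset.sum_nonneg fun i _ => hB i)
      exact (norm_le_insert' x a).trans (by linarith)
    · have h7 : ρ * ‖x - a‖ ≤ ρ * r := mul_le_mul_of_nonneg_left h6 (norm_nonneg _)
      have h8 : 0 ≤ D.ε₁ * c₀ * ‖x - a‖ ^ 2 := by positivity
      linarith
  have hclosed : IsClosed {x : Coord ι | ∀ t, c ≤ comb φ (cl x) t} := by
    rw [Set.ofPred_forall]
    refine isClosed_iInter fun t => isClosed_le continuous_const ?_
    unfold comb cl
    fun_prop
  refine exists_zero_of_stronglyMonotone (U := posCone φ)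
    (K := Metric.closedBall a r ∩ {x | ∀ t, c ≤ comb φ (cl x) t}) (c := D.ε₁ * c₀) (by positivity)
    (isOpen_posCone hφ) (fun x hx => gal_lipschitzAt hφ hx) ?_
    ((isCompact_closedBall a r).inter_right hclosed) ?_ ha ?_
  · intro x hx y hy
    rw [inner_gal_sub hφ hx hy]
    refine le_trans ?_ (res_monotone (hs _) (hs _) hx (hs _) (hs _) hy)
    have h1 := henergy (x - y)
    have e1 : comb φ (cl (x - y)) = fun t => comb φ (cl x) t - comb φ (cl y) t :=
      funext fun t => (comb_sub φ (cl x) (cl y) t).symm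
    have e2 : comb φ (cr (x - y)) = fun t => comb φ (cr x) t - comb φ (cr y) t :=
      funext fun t => (comb_sub φ (cr x) (cr y) t).symm
    rw [e1, e2] at h1
    have h2 : 0 ≤ ∫ t, (D.β (comb φ (cl x) t) - D.β (comb φ (cl y) t)) *
        (comb φ (cl x) t - comb φ (cl y) t) :=
      integral_nonneg fun t => penalization_mono (hx t) (hy t)
    linarith
  · rintro x ⟨-, hx⟩ t
    exact hc.trans_le (hx t)
  · intro x hx hxρ
    obtain ⟨h1, h2⟩ := hest x hx hxρ
    exact ⟨by rwa [Metric.mem_closedBall, dist_eq_norm], h2⟩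

variable (D) in
/-- Solvability of the Galerkin approximation in a finite-dimensional space of smooth functions. -/
lemma exists_galerkin (V : Submodule ℝ (Torus d → ℝ)) [FiniteDimensional ℝ V]
    (hV : ∀ f ∈ V, IsSmooth f) (h1 : (fun _ => 1) ∈ V) :
    ∃ m ∈ V, ∃ u ∈ V, (∀ x, 0 < m x) ∧ ∀ v ∈ V,
      ∫ x, D.res₁ m u x * v x = 0 ∧ ∫ x, D.res₂ m u x * v x = 0 := by
  let b := Module.finBasis ℝ V
  let φ : Fin (Module.finrank ℝ V) → Torus d → ℝ := fun j => b j
  have hφ : ∀ j, IsSmooth (φ j) := fun j => hV _ (b j).2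
  have hli : LinearIndependent ℝ φ := b.linearIndependent.map' V.subtype V.ker_subtype
  have hrep : ∀ v ∈ V, ∃ a, comb φ a = v := by
    intro v hv
    refine ⟨b.repr ⟨v, hv⟩, ?_⟩
    have := congrArg Subtype.val (b.sum_repr ⟨v, hv⟩)
    rw [Submodule.coe_sum] at this
    funext x
    have h2 := congrFun this x
    rw [Finset.sum_apply] at h2
    exact h2
  have hmem : ∀ a, comb φ a ∈ V := by
    intro a
    have : comb φ a = ∑ j, a j • φ j := by
      funext x
      simp [comb, Finset.sum_apply]
    rw [this]
    exact V.sum_mem fun j _ => V.smul_mem _ (b j).2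
  obtain ⟨a₁, ha₁⟩ := hrep _ h1
  obtain ⟨x, hx, hx0⟩ := exists_galerkin_coord (D := D) hφ hli (a₁ := a₁) (congrFun ha₁)
  refine ⟨comb φ (cl x), hmem _, comb φ (cr x), hmem _, hx, ?_⟩
  intro v hv
  obtain ⟨a, rfl⟩ := hrep v hv
  have hc : ∀ j, Continuous (φ j) := fun j => (hφ j).continuous
  have hs : ∀ a, IsSmooth (comb φ a) := fun a => isSmooth_comb hφ a
  rw [integral_mul_comb (isSmooth_res₁ (D := D) (hs _) (hs (cr x)) hx).continuous hc,
    integral_mul_comb (isSmooth_res₂ (D := D) (hs _) (hs (cr x)) hx).continuous hc]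
  constructor
  · refine Finset.sum_eq_zero fun j _ => ?_
    have : D.gal φ x (Sum.inl j) = 0 := by rw [hx0]; rfl
    rw [show ∫ t, D.res₁ (comb φ (cl x)) (comb φ (cr x)) t * φ j t = 0 from this, zero_mul]
  · refine Finset.sum_eq_zero fun j _ => ?_
    have : D.gal φ x (Sum.inr j) = 0 := by rw [hx0]; rfl
    rw [show ∫ t, D.res₂ (comb φ (cl x)) (comb φ (cr x)) t * φ j t = 0 from this, zero_mul]

end RegProblem

end RegMFG
end

noncomputable section

namespace RegMFG

open Filter Topology UnitAddTorus

/-! ### Compactness in Sobolev spaces -/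

section Compactness

variable {d : ℕ}

lemma finite_wt_le (R : ℝ) : {k : Fin d → ℤ | wt k ≤ R}.Finite := by
  have h : (Metric.closedBall (0 : Fin d → ℤ) (R - 1)).Finite :=
    (isCompact_closedBall 0 (R - 1)).finite_of_discrete
  refine h.subset fun k hk => ?_
  rw [mem_closedBall_zero_iff]
  have : wt k ≤ R := hk
  unfold wt at this
  linarith

lemma hsum_sub_le {s : ℕ} {c c' : (Fin d → ℤ) → ℂ} (h : InH s c) (h' : InH s c') :
    hsum s (fun k => c k - c' k) ≤ 2 * (hsum s c + hsum s c') := by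
  have h1 := (Summable.add h h').mul_left 2
  have h2 := (h.sub h').tsum_le_tsum (fun k => ?_) h1
  · rw [tsum_mul_left, Summable.tsum_add h h'] at h2
    exact h2
  · have h3 : ‖c k - c' k‖ ^ 2 ≤ 2 * (‖c k‖ ^ 2 + ‖c' k‖ ^ 2) := by
      have := pow_le_pow_left₀ (norm_nonneg _) (norm_sub_le (c k) (c' k)) 2
      nlinarith [sq_nonneg (‖c k‖ - ‖c' k‖)]
    have := mul_le_mul_of_nonneg_left h3 (pow_nonneg (wt_pos k).le (2 * s))
    linarith

/-- The spare derivative makes the frequencies with weight above R contribute at most A/R² uniformly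
in n; finitely many frequencies remain. -/
lemma tendsto_hsum_of_pointwise {s : ℕ} {e : ℕ → (Fin d → ℤ) → ℂ} {A : ℝ}
    (he : ∀ n, InH (s + 1) (e n)) (hA : ∀ n, hsum (s + 1) (e n) ≤ A)
    (hlim : ∀ k, Tendsto (fun n => e n k) atTop (𝓝 0)) :
    Tendsto (fun n => hsum s (e n)) atTop (𝓝 0) := by
  have hA0 : 0 ≤ A := (hsum_nonneg _ _).trans (hA 0)
  have key : ∀ R : ℝ, 0 < R → ∀ n, hsum s (e n) ≤
      (∑ k ∈ (finite_wt_le (d := d) R).toFinset, wt k ^ (2 * s) * ‖e n k‖ ^ 2) + A / R ^ 2 := by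
    intro R hR n
    set T := (finite_wt_le (d := d) R).toFinset
    have h1 : HasSum (fun k => if k ∈ T then wt k ^ (2 * s) * ‖e n k‖ ^ 2 else 0)
        (∑ k ∈ T, wt k ^ (2 * s) * ‖e n k‖ ^ 2) := by
      have : HasSum (fun k => if k ∈ T then wt k ^ (2 * s) * ‖e n k‖ ^ 2 else 0)
          (∑ k ∈ T, if k ∈ T then wt k ^ (2 * s) * ‖e n k‖ ^ 2 else 0) :=
        hasSum_sum_of_ne_finset_zero fun k hk => by simp [hk]
      convert this using 1
      exact Finset.sum_congr rfl fun k hk => by simp [hk]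
    have h2 : HasSum (fun k => wt k ^ (2 * (s + 1)) * ‖e n k‖ ^ 2 / R ^ 2)
        (hsum (s + 1) (e n) / R ^ 2) := (he n).hasSum.div_const _
    have h3 : HasSum (fun k => wt k ^ (2 * s) * ‖e n k‖ ^ 2) (hsum s (e n)) :=
      ((he n).mono (Nat.le_succ s)).hasSum
    refine (hasSum_le (fun k => ?_) h3 (h1.add h2)).trans ?_
    · have hw := wt_pos k
      by_cases hk : k ∈ T
      · simp only [hk, if_true]
        have : 0 ≤ wt k ^ (2 * (s + 1)) * ‖e n k‖ ^ 2 / R ^ 2 := by positivity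
        linarith
      · simp only [hk, if_false, zero_add]
        have hRk : R < wt k := by simpa [T] using hk
        rw [le_div_iff₀ (by positivity)]
        calc wt k ^ (2 * s) * ‖e n k‖ ^ 2 * R ^ 2 ≤ wt k ^ (2 * s) * ‖e n k‖ ^ 2 * wt k ^ 2 := by
              gcongr
          _ = _ := by ring
    · gcongr
      exact hA n
  rw [Metric.tendsto_atTop']
  intro ε hε
  obtain ⟨R, hR, hRA⟩ : ∃ R : ℝ, 0 < R ∧ A / R ^ 2 < ε / 2 := by
    have : Tendsto (fun R : ℝ => A / R ^ 2) atTop (𝓝 0) :=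
      tendsto_const_nhds.div_atTop (tendsto_pow_atTop two_ne_zero)
    obtain ⟨R, h1, h2⟩ := ((eventually_gt_atTop 0).and
      (this.eventually (gt_mem_nhds (half_pos hε)))).exists
    exact ⟨R, h1, h2⟩
  have hfin : Tendsto (fun n => ∑ k ∈ (finite_wt_le (d := d) R).toFinset,
      wt k ^ (2 * s) * ‖e n k‖ ^ 2) atTop (𝓝 0) := by
    have := tendsto_finsetSum (finite_wt_le (d := d) R).toFinset fun k _ =>
      (((hlim k).norm).pow 2).const_mul (wt k ^ (2 * s))
    simpa using this
  obtain ⟨N, hN⟩ := eventually_atTop.1 (hfin.eventually (gt_mem_nhds (half_pos hε)))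
  refine ⟨N, fun n hn => ?_⟩
  rw [Real.dist_eq, sub_zero, abs_of_nonneg (hsum_nonneg _ _)]
  have := key R hR n
  have := hN n hn.le
  linarith

lemma exists_subseq_coeff {s : ℕ} {c : ℕ → (Fin d → ℤ) → ℂ} {A : ℝ}
    (hc : ∀ n, InH (s + 1) (c n)) (hA : ∀ n, hsum (s + 1) (c n) ≤ A) :
    ∃ (σ : ℕ → ℕ) (c' : (Fin d → ℤ) → ℂ), StrictMono σ ∧ InH (s + 1) c' ∧
      (∀ k, Tendsto (fun n => c (σ n) k) atTop (𝓝 (c' k))) ∧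
      Tendsto (fun n => hsum s fun k => c (σ n) k - c' k) atTop (𝓝 0) := by
  have hA0 : 0 ≤ A := (hsum_nonneg _ _).trans (hA 0)
  have hb : ∀ n k, ‖c n k‖ ≤ √A := fun n k => by
    refine Real.le_sqrt_of_sq_le ?_
    have h1 : wt k ^ (2 * (s + 1)) * ‖c n k‖ ^ 2 ≤ hsum (s + 1) (c n) :=
      (hc n).le_tsum k fun j _ => by have := wt_pos j; positivity
    have h2 : ‖c n k‖ ^ 2 ≤ wt k ^ (2 * (s + 1)) * ‖c n k‖ ^ 2 :=
      le_mul_of_one_le_left (sq_nonneg _) (one_le_pow₀ (one_le_wt k))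
    exact h2.trans (h1.trans (hA n))
  -- There are countably many frequencies, so this product of discs is sequentially compact; this
  -- replaces a diagonal argument.
  have hcomp : IsCompact (Set.univ.pi fun _ : Fin d → ℤ => Metric.closedBall (0 : ℂ) √A) :=
    isCompact_univ_pi fun _ => isCompact_closedBall _ _
  obtain ⟨c', -, σ, hσ, hlim⟩ := hcomp.tendsto_subseq (x := c) fun n k _ => by
    simpa using hb n k
  have hlim' : ∀ k, Tendsto (fun n => c (σ n) k) atTop (𝓝 (c' k)) := tendsto_pi_nhds.1 hlim
  -- Fatou's lemma in elementary form: finite partial sums pass to the limit and keep the bound.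
  have hsum_le : ∀ T : Finset (Fin d → ℤ), ∑ k ∈ T, wt k ^ (2 * (s + 1)) * ‖c' k‖ ^ 2 ≤ A := by
    intro T
    have h1 := tendsto_finsetSum T fun k _ =>
      (((hlim' k).norm).pow 2).const_mul (wt k ^ (2 * (s + 1)))
    refine le_of_tendsto h1 (Eventually.of_forall fun n => ?_)
    refine le_trans ?_ (hA (σ n))
    exact (hc (σ n)).sum_le_tsum T fun k _ => by have := wt_pos k; positivity
  have hc' : InH (s + 1) c' :=
    summable_of_sum_le (fun k => by have := wt_pos k; positivity) hsum_le
  have hA' : hsum (s + 1) c' ≤ A := hc'.tsum_le_of_sum_le hsum_le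
  refine ⟨σ, c', hσ, hc', hlim', ?_⟩
  refine tendsto_hsum_of_pointwise (A := 4 * A) (fun n => (hc (σ n)).sub hc') (fun n => ?_)
    fun k => ?_
  · have := hsum_sub_le (hc (σ n)) hc'
    have := hA (σ n)
    linarith
  · simpa using (hlim' k).sub_const (c' k)

/-- The limiting coefficients define a function through their absolutely convergent series. Uniform
convergence then shows that the real part of the series still has these coefficients. -/
lemma exists_subseq {s : ℕ} (hs : d < 2 * s) {f : ℕ → Torus d → ℝ} {A : ℝ}
    (hf : ∀ n, Continuous (f n)) (hH : ∀ n, InH (s + 1) (four (f n)))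
    (hA : ∀ n, hsum (s + 1) (four (f n)) ≤ A) :
    ∃ (σ : ℕ → ℕ) (g : Torus d → ℝ), StrictMono σ ∧ Continuous g ∧ InH (s + 1) (four g) ∧
      Tendsto (fun n => hsum s (four fun x => f (σ n) x - g x)) atTop (𝓝 0) := by
  obtain ⟨σ, c, hσ, hc, hlim, hconv⟩ := exists_subseq_coeff hH hA
  have hc0 : Summable fun k => ‖c k‖ := by
    simpa using (hc.summable (n := 0) (by omega)).1
  have hF0 : ∀ n, Summable fun k => ‖four (f n) k‖ := fun n =>
    (summable_four_of_InH (hH n) (by omega)).1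
  let g : Torus d → ℝ := fun x => (∑' k, c k * mFourier k x).re
  have hg : Continuous g := Complex.continuous_re.comp <|
    continuous_tsum (fun k => continuous_const.mul (mFourier k).continuous) hc0 fun k x => by
      rw [norm_mul, norm_mFourier_apply, mul_one]
  have hsm : ∀ (c : (Fin d → ℤ) → ℂ) (x : Torus d), (Summable fun k => ‖c k‖) →
      Summable fun k => c k * mFourier k x := fun c x h => by
    refine Summable.of_norm ?_
    simpa only [norm_mul, norm_mFourier_apply, mul_one] using h
  have hdiff : ∀ n, Summable fun k => ‖four (f (σ n)) k - c k‖ := fun n =>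
    Summable.of_nonneg_of_le (fun k => norm_nonneg _) (fun k => norm_sub_le _ _)
      ((hF0 (σ n)).add hc0)
  have hsup : ∀ n x, |f (σ n) x - g x| ≤ ∑' k, ‖four (f (σ n)) k - c k‖ := fun n x => by
    have h1 : HasSum (fun k => four (f (σ n)) k * mFourier k x) (f (σ n) x : ℂ) :=
      hasSum_fourC (f := fun x => (f (σ n) x : ℂ)) (Complex.continuous_ofReal.comp (hf _))
        (hF0 (σ n)).of_norm x
    have h2 := h1.sub (hsm c x hc0).hasSum
    have h3 : f (σ n) x - g x = ((f (σ n) x : ℂ) - ∑' k, c k * mFourier k x).re := by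
      simp [g]
    rw [h3]
    refine (Complex.abs_re_le_norm _).trans ?_
    rw [← h2.tsum_eq]
    have h4 : ∀ k, ‖four (f (σ n)) k * mFourier k x - c k * mFourier k x‖ =
        ‖four (f (σ n)) k - c k‖ := fun k => by
      rw [← sub_mul, norm_mul, norm_mFourier_apply, mul_one]
    refine (norm_tsum_le_tsum_norm (by simpa only [h4] using hdiff n)).trans (le_of_eq ?_)
    simp only [h4]
  have hδ : Tendsto (fun n => ∑' k, ‖four (f (σ n)) k - c k‖) atTop (𝓝 0) := by
    have h1 : ∀ n, ∑' k, ‖four (f (σ n)) k - c k‖ ≤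
        embConst d s 0 * √(hsum s fun k => four (f (σ n)) k - c k) := fun n => by
      simpa using ((((hH (σ n)).sub hc).mono (Nat.le_succ s)).summable (n := 0) (by omega)).2
    refine squeeze_zero (fun n => tsum_nonneg fun k => norm_nonneg _) h1 ?_
    simpa using (hconv.sqrt).const_mul (embConst d s 0)
  have hfour : ∀ k, four g k = c k := fun k => by
    refine tendsto_nhds_unique (?_ : Tendsto (fun n => four (f (σ n)) k) atTop _) (hlim k)
    rw [tendsto_iff_norm_sub_tendsto_zero]
    refine squeeze_zero (fun n => norm_nonneg _) (fun n => ?_) hδ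
    rw [← four_sub (hf _).integrable_torus hg.integrable_torus]
    exact norm_four_le (hsup n) k
  have hfg : four g = c := funext hfour
  refine ⟨σ, g, hσ, hg, by rwa [hfg], ?_⟩
  refine hconv.congr fun n => ?_
  congr 1
  funext k
  rw [four_sub (hf _).integrable_torus hg.integrable_torus, hfour]

/-- The constant of the embedding `H^s ⊂ C²`. -/
def embConst₂ (d s : ℕ) : ℝ :=
  embConst d s 0 + 2 * Real.pi * embConst d s 1 + (2 * Real.pi) ^ 2 * embConst d s 2

lemma embConst_nonneg (d s n : ℕ) : 0 ≤ embConst d s n := Real.sqrt_nonneg _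

lemma embConst₂_nonneg (d s : ℕ) : 0 ≤ embConst₂ d s := by
  have := embConst_nonneg d s 0
  have := embConst_nonneg d s 1
  have := embConst_nonneg d s 2
  unfold embConst₂
  positivity

lemma abs_le_embConst {f g : Torus d → ℝ} (hg : Continuous g) {s n : ℕ} (hs : 2 * n + d < 2 * s)
    (h : InH s (four f)) {a : ℝ} (ha : 0 ≤ a)
    (hle : ∀ k, ‖four g k‖ ≤ a * (wt k ^ n * ‖four f k‖)) (x : Torus d) :
    |g x| ≤ a * embConst d s n * √(hsum s (four f)) := by
  obtain ⟨h1, h2⟩ := h.summable hs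
  have h3 : Summable fun k => ‖four g k‖ :=
    Summable.of_nonneg_of_le (fun k => norm_nonneg _) hle (h1.mul_left a)
  refine (abs_le_tsum_four hg h3 x).trans ((h3.tsum_le_tsum hle (h1.mul_left a)).trans ?_)
  rw [tsum_mul_left, mul_assoc]
  exact mul_le_mul_of_nonneg_left h2 ha

/-- The embedding of H^s into C²: each derivative multiplies the coefficients by at most 2π·wt(k).
-/
lemma abs_le_of_inH {f : Torus d → ℝ} (hf : IsC 2 f) {s : ℕ} (hs : 4 + d < 2 * s)
    (h : InH s (four f)) (x : Torus d) :
    |f x| ≤ embConst₂ d s * √(hsum s (four f)) ∧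
    (∀ i, |pd i f x| ≤ embConst₂ d s * √(hsum s (four f))) ∧
    ∀ i j, |pd i (pd j f) x| ≤ embConst₂ d s * √(hsum s (four f)) := by
  have e0 := embConst_nonneg d s 0
  have e1 := embConst_nonneg d s 1
  have e2 := embConst_nonneg d s 2
  have hπ := Real.pi_pos
  have q1 : 0 ≤ 2 * Real.pi * embConst d s 1 := by positivity
  have q2 : 0 ≤ (2 * Real.pi) ^ 2 * embConst d s 2 := by positivity
  have hf1 : IsC 1 f := hf.of_le (by norm_num)
  have hp1 : ∀ i, IsC 1 (pd i f) := fun i => IsC.pd (by simpa [one_add_one_eq_two] using hf) i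
  have hp2 : ∀ i j, Continuous (pd i (pd j f)) := fun i j =>
    (IsC.pd (n := 0) (by simpa using hp1 j) i).continuous
  have hsq := Real.sqrt_nonneg (hsum s (four f))
  refine ⟨?_, fun i => ?_, fun i j => ?_⟩
  · refine (abs_le_embConst (a := 1) (n := 0) hf.continuous (by omega) h zero_le_one
      (fun k => by simp) x).trans (mul_le_mul_of_nonneg_right ?_ hsq)
    unfold embConst₂
    linarith
  · refine (abs_le_embConst (a := 2 * Real.pi) (n := 1) (hp1 i).continuous (by omega) h
      (by positivity) (fun k => ?_) x).trans (mul_le_mul_of_nonneg_right ?_ hsq)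
    · rw [four_pd hf1, norm_mul, pow_one, ← mul_assoc]
      exact mul_le_mul_of_nonneg_right (norm_symbol_le k i) (norm_nonneg _)
    · unfold embConst₂
      linarith
  · refine (abs_le_embConst (a := (2 * Real.pi) ^ 2) (n := 2) (hp2 i j) (by omega) h
      (by positivity) (fun k => ?_) x).trans (mul_le_mul_of_nonneg_right ?_ hsq)
    · rw [four_pd (hp1 j), four_pd hf1, ← mul_assoc, norm_mul, norm_mul (2 * Real.pi * Complex.I * _),
        ← mul_assoc, ← mul_pow, pow_two (2 * Real.pi * wt k)]
      refine mul_le_mul_of_nonneg_right ?_ (norm_nonneg _)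
      exact mul_le_mul (norm_symbol_le k i) (norm_symbol_le k j) (norm_nonneg _)
        (by have := wt_pos k; positivity)
    · unfold embConst₂
      linarith

end Compactness

/-! ### Trigonometric polynomials -/

section TrigPoly

variable {d : ℕ}

/-- The real trigonometric polynomials of degree at most `N`. -/
def trigPoly (d N : ℕ) : Submodule ℝ (Torus d → ℝ) :=
  Submodule.span ℝ ((fun z : ℂ × (Fin d → ℤ) => trig z.1 z.2) ''
    (({1, Complex.I} : Set ℂ) ×ˢ Set.Icc (fun _ => -(N : ℤ)) (fun _ => (N : ℤ))))

instance (d N : ℕ) : FiniteDimensional ℝ (trigPoly d N) :=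
  FiniteDimensional.span_of_finite ℝ
    (((Set.toFinite _).prod (Set.finite_Icc _ _)).image _)

lemma isSmooth_of_mem_trigPoly {N : ℕ} {f : Torus d → ℝ} (hf : f ∈ trigPoly d N) :
    IsSmooth f := by
  induction hf using Submodule.span_induction with
  | mem f hf =>
    obtain ⟨z, -, rfl⟩ := hf
    exact isSmooth_trig z.1 z.2
  | zero => exact isSmooth_const 0
  | add f g _ _ hf hg => exact hf.add hg
  | smul a f _ hf => exact (isSmooth_const a).mul hf

lemma trig_mem_trigPoly {N : ℕ} (c : ℂ) {k : Fin d → ℤ} (hk : ∀ i, |k i| ≤ N) :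
    trig c k ∈ trigPoly d N := by
  have hk' : k ∈ Set.Icc (fun _ => -(N : ℤ)) (fun _ => (N : ℤ)) :=
    ⟨fun i => (abs_le.1 (hk i)).1, fun i => (abs_le.1 (hk i)).2⟩
  have h : trig c k = c.re • trig 1 k + c.im • trig Complex.I k := by
    funext x
    simp [trig]
    ring
  rw [h]
  refine Submodule.add_mem _ (Submodule.smul_mem _ _ (Submodule.subset_span ?_))
    (Submodule.smul_mem _ _ (Submodule.subset_span ?_))
  · exact ⟨(1, k), ⟨by simp, hk'⟩, rfl⟩
  · exact ⟨(Complex.I, k), ⟨by simp, hk'⟩, rfl⟩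

lemma one_mem_trigPoly (N : ℕ) : (fun _ => 1) ∈ trigPoly d N := by
  have h : (fun _ : Torus d => (1 : ℝ)) = trig 1 0 := by
    funext x
    simp [trig, mFourier_zero]
  rw [h]
  exact trig_mem_trigPoly 1 fun i => by simp

/-- The space contains both real trigonometric functions of frequency -k, so orthogonality
annihilates the whole complex coefficient. -/
lemma four_eq_zero_of_orthogonal {N : ℕ} {r : Torus d → ℝ} (hr : Continuous r)
    (h : ∀ v ∈ trigPoly d N, ∫ x, r x * v x = 0) {k : Fin d → ℤ} (hk : ∀ i, |k i| ≤ N) :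
    four r k = 0 := by
  have h1 : ∀ c : ℂ, (c * four r k).re = 0 := fun c => by
    rw [← integral_mul_trig hr.integrable_torus]
    exact h _ (trig_mem_trigPoly c fun i => by simpa using hk i)
  apply Complex.ext
  · simpa using h1 1
  · simpa using h1 Complex.I

end TrigPoly

end RegMFG
end

noncomputable section

namespace RegMFG

open Filter Topology UnitAddTorus

namespace RegProblem

variable {d : ℕ} (D : RegProblem d)

/-! ### The limit of the Galerkin approximations -/

/-- The Fourier coefficients of the first equation in weak form. -/
def weak₁ (m u : Torus d → ℝ) (k : Fin d → ℤ) : ℂ :=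
  -four u k + D.lam k * four m k + four (fun x => D.nl₁ x (D.jt m u x)) k

/-- The Fourier coefficients of the second equation in weak form. -/
def weak₂ (m u : Torus d → ℝ) (k : Fin d → ℤ) : ℂ :=
  four (fun x => m x - 1) k + D.lam k * four u k -
    ∑ i, 2 * Real.pi * Complex.I * k i * four (fun x => D.flux i x (D.jt m u x)) k +
    ∑ i, ∑ j, 2 * Real.pi * Complex.I * k i * (2 * Real.pi * Complex.I * k j *
      four (fun x => D.flux₂ i j x (D.jt m u x)) k)

variable {D}

lemma four_res₁ {m u : Torus d → ℝ} (hm : IsSmooth m) (hu : IsSmooth u) (hpos : ∀ x, 0 < m x)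
    (k : Fin d → ℤ) : four (D.res₁ m u) k = D.weak₁ m u k := by
  have e : D.res₁ m u = fun x => ((-1) * u x + D.reg m x) + D.nl₁ x (D.jt m u x) := by
    funext x
    rw [res₁_eq]
    ring
  have s1 : IsSmooth fun x => (-1) * u x := (isSmooth_const (-1)).mul hu
  have s2 := D.isSmooth_reg hm
  have s3 := isSmooth_comp (D := D) D.isNice_nl₁ hm hu hpos
  rw [e, four_add (s1.add s2).continuous.integrable_torus s3.continuous.integrable_torus,
    four_add s1.continuous.integrable_torus s2.continuous.integrable_torus, four_const_mul,
    D.four_reg hm]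
  unfold weak₁
  push_cast
  ring

lemma four_res₂ {m u : Torus d → ℝ} (hm : IsSmooth m) (hu : IsSmooth u) (hpos : ∀ x, 0 < m x)
    (k : Fin d → ℤ) : four (D.res₂ m u) k = D.weak₂ m u k := by
  have e : D.res₂ m u = fun x => m x - 1 + D.reg u x -
      ∑ i, pd i (fun y => D.flux i y (D.jt m u y)) x +
      ∑ i, ∑ j, pd i (pd j fun y => D.flux₂ i j y (D.jt m u y)) x := funext fun x => D.res₂_eq m u x
  have s1 := hm.sub (isSmooth_const 1)
  have s2 := D.isSmooth_reg hu
  have f1 := isSmooth_flux (D := D) hm hu hpos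
  have f2 := isSmooth_flux₂ (D := D) hm hu hpos
  have s3 := isSmooth_sum Finset.univ fun i _ => (f1 i).pd i
  have s4 : ∀ i, IsSmooth fun x => ∑ j, pd i (pd j fun y => D.flux₂ i j y (D.jt m u y)) x :=
    fun i => isSmooth_sum Finset.univ fun j _ => ((f2 i j).pd j).pd i
  have s5 := isSmooth_sum Finset.univ fun i _ => s4 i
  rw [e, four_add ((s1.add s2).sub s3).continuous.integrable_torus s5.continuous.integrable_torus,
    four_sub (s1.add s2).continuous.integrable_torus s3.continuous.integrable_torus,
    four_add s1.continuous.integrable_torus s2.continuous.integrable_torus, D.four_reg hu,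
    four_sum _ fun i _ => ((f1 i).pd i).continuous.integrable_torus,
    four_sum _ fun i _ => (s4 i).continuous.integrable_torus]
  unfold weak₂
  congr 1
  · congr 1
    exact Finset.sum_congr rfl fun i _ => four_pd ((f1 i).isC_nat 1) i k
  · refine Finset.sum_congr rfl fun i _ => ?_
    rw [four_sum _ fun j _ => (((f2 i j).pd j).pd i).continuous.integrable_torus]
    refine Finset.sum_congr rfl fun j _ => ?_
    rw [four_pd (((f2 i j).pd j).isC_nat 1), four_pd ((f2 i j).isC_nat 1)]

variable (D) in
-- The Galerkin solution may be tested with (m-1,u) because constants belong to the space. The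
-- tested residuals vanish, and every bound is expressed by `apConst`, which does not depend on the
-- degree.
lemma exists_approx : ∃ (A c : ℝ) (mn un : ℕ → Torus d → ℝ), 0 < c ∧
    (∀ n, IsSmooth (mn n)) ∧ (∀ n, IsSmooth (un n)) ∧ (∀ n x, c ≤ mn n x) ∧
    (∀ n, hsum (2 * D.p) (four fun x => mn n x - 1) ≤ A) ∧
    (∀ n, hsum (2 * D.p) (four (un n)) ≤ A) ∧
    ∀ (n : ℕ) (k : Fin d → ℤ), (∀ i, |k i| ≤ n) → D.weak₁ (mn n) (un n) k = 0 ∧ D.weak₂ (mn n) (un n) k = 0 := by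
  choose mn hmn un hun hpos horth using fun N => D.exists_galerkin (trigPoly d N)
    (fun f hf => isSmooth_of_mem_trigPoly hf) (one_mem_trigPoly N)
  have sm : ∀ n, IsSmooth (mn n) := fun n => isSmooth_of_mem_trigPoly (hmn n)
  have su : ∀ n, IsSmooth (un n) := fun n => isSmooth_of_mem_trigPoly (hun n)
  have sη : ∀ n, IsSmooth fun x => mn n x - 1 := fun n => (sm n).sub (isSmooth_const 1)
  have hap : ∀ n, (D.energy (fun x => mn n x - 1) + D.energy (un n)) / 2 +
      (∫ x, D.β (mn n x) * (mn n x - 1)) ≤ D.apConst := fun n => by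
    have h := a_priori (D := D) (sm n) (su n) (hpos n)
    have h1 := (horth n _ ((trigPoly d n).sub_mem (hmn n) (one_mem_trigPoly n))).1
    have h2 := (horth n _ (hun n)).2
    simp only [Pi.sub_apply] at h1
    rw [h1, h2] at h
    linarith
  have e1 : ∀ n, 0 ≤ D.energy fun x => mn n x - 1 := fun n => D.energy_nonneg (sη n)
  have e2 : ∀ n, 0 ≤ D.energy (un n) := fun n => D.energy_nonneg (su n)
  have e3 : ∀ n, 0 ≤ ∫ x, D.β (mn n x) * (mn n x - 1) := fun n =>
    integral_nonneg fun x => D.penalization_mul_nonneg (hpos n x)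
  have hA : ∀ n, hsum (2 * D.p) (four fun x => mn n x - 1) ≤ D.lamConst * (2 * D.apConst) :=
    fun n => (D.hsum_le_energy (sη n)).trans <|
      mul_le_mul_of_nonneg_left (by linarith [hap n, e2 n, e3 n]) D.lamConst_pos.le
  have hA' : ∀ n, hsum (2 * D.p) (four (un n)) ≤ D.lamConst * (2 * D.apConst) :=
    fun n => (D.hsum_le_energy (su n)).trans <|
      mul_le_mul_of_nonneg_left (by linarith [hap n, e1 n, e3 n]) D.lamConst_pos.le
  have hord := D.order
  -- The gradient bound now comes from the embedding of H^{2p}, not from a basis, so the lower bound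
  -- is the same for all n.
  obtain ⟨c, hc, hcm⟩ := D.exists_lower_bound
    (embConst₂ d (2 * D.p) * √(D.lamConst * (2 * D.apConst))) D.apConst
  refine ⟨_, c, mn, un, hc, sm, su, fun n => hcm (mn n) (sm n) (hpos n) (fun i x => ?_)
    (by linarith [hap n, e1 n, e2 n]), hA, hA', fun n k hk => ?_⟩
  · have h1 := (abs_le_of_inH ((sη n).isC_nat 2) (s := 2 * D.p) (by omega) ((sη n).inH _) x).2.1 i
    have h2 : pd i (fun x => mn n x - 1) x = pd i (mn n) x := by
      rw [(sm n).pd_sub (isSmooth_const 1)]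
      simp [pd]
    rw [h2] at h1
    exact h1.trans (mul_le_mul_of_nonneg_left (Real.sqrt_le_sqrt (hA n)) (embConst₂_nonneg _ _))
  · rw [← four_res₁ (sm n) (su n) (hpos n), ← four_res₂ (sm n) (su n) (hpos n)]
    exact ⟨four_eq_zero_of_orthogonal (isSmooth_res₁ (sm n) (su n) (hpos n)).continuous
        (fun v hv => (horth n v hv).1) hk,
      four_eq_zero_of_orthogonal (isSmooth_res₂ (sm n) (su n) (hpos n)).continuous
        (fun v hv => (horth n v hv).2) hk⟩

lemma tendsto_four_of_abs_sub_le {f : ℕ → Torus d → ℝ} {g : Torus d → ℝ}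
    (hf : ∀ n, Continuous (f n)) (hg : Continuous g) {δ : ℕ → ℝ} (hδ : Tendsto δ atTop (𝓝 0))
    (h : ∀ᶠ n in atTop, ∀ x, |f n x - g x| ≤ δ n) (k : Fin d → ℤ) :
    Tendsto (fun n => four (f n) k) atTop (𝓝 (four g k)) := by
  rw [tendsto_iff_norm_sub_tendsto_zero]
  refine squeeze_zero' (Eventually.of_forall fun n => norm_nonneg _) ?_ hδ
  filter_upwards [h] with n hn
  rw [← four_sub (hf n).integrable_torus hg.integrable_torus]
  exact norm_four_le hn k

lemma tendsto_four_comp {Ψ : Torus d → JetSpace d → ℝ} (hΨ : IsNice Ψ) {m u : Torus d → ℝ}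
    {mn un : ℕ → Torus d → ℝ} {c R : ℝ} (hc : 0 < c) (hmn : ∀ n x, c ≤ mn n x)
    (hm : ∀ x, c ≤ m x) (hR : ∀ x, ‖D.jt m u x‖ ≤ R) {δ : ℕ → ℝ} (hδ : Tendsto δ atTop (𝓝 0))
    (hjet : ∀ n x, ‖D.jt (mn n) (un n) x - D.jt m u x‖ ≤ δ n)
    (hcn : ∀ n, Continuous fun x => Ψ x (D.jt (mn n) (un n) x))
    (hcl : Continuous fun x => Ψ x (D.jt m u x)) (k : Fin d → ℤ) :
    Tendsto (fun n => four (fun x => Ψ x (D.jt (mn n) (un n) x)) k) atTop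
      (𝓝 (four (fun x => Ψ x (D.jt m u x)) k)) := by
  -- Once δ < 1, all the jets lie in the ball of radius R + 1.
  obtain ⟨K, hK, hlip⟩ := hΨ.exists_lipschitz hc (R + 1)
  refine tendsto_four_of_abs_sub_le hcn hcl (δ := fun n => K * δ n)
    (by simpa using hδ.const_mul K) ?_ k
  filter_upwards [hδ.eventually (gt_mem_nhds one_pos)] with n hn x
  have h1 := norm_le_norm_add_norm_sub' (D.jt (mn n) (un n) x) (D.jt m u x)
  refine (hlip x _ _ ?_ ?_ (hmn n x) (hm x)).trans (mul_le_mul_of_nonneg_left (hjet n x) hK)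
  · linarith [hR x, hjet n x]
  · linarith [hR x]

lemma inH_add_one {s : ℕ} {f : Torus d → ℝ} (hf : Continuous f)
    (h : InH s (four f)) : InH s (four fun x => f x + 1) := by
  have e : four (fun x => f x + 1) = fun k => four f k + four (fun _ => 1) k := funext fun k =>
    four_add hf.integrable_torus continuous_const.integrable_torus k
  rw [e]
  exact h.add ((isSmooth_const 1).inH s)

/-- The jet contains D²u, so H^s must embed in C^{n+2}; the nonlocal term keeps the H^s regularity
of m by assumption (h). -/
lemma isC_comp_jt {Ψ : Torus d → JetSpace d → ℝ} (hΨ : IsNice Ψ) {s n : ℕ}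
    (hs : 2 * (n + 2) + d < 2 * s) {m u : Torus d → ℝ} (hm : Continuous m) (hu : Continuous u)
    (hmH : InH s (four m)) (huH : InH s (four u)) (hpos : ∀ x, 0 < m x) :
    IsC n fun x => Ψ x (D.jt m u x) := by
  have hκ : (d : ℝ) / 2 + 1 < s := by
    have : ((2 * (n + 2) + d : ℕ) : ℝ) < ((2 * s : ℕ) : ℝ) := by exact_mod_cast hs
    push_cast at this
    linarith [(Nat.cast_nonneg n : (0 : ℝ) ≤ n)]
  exact hΨ.isC (isC_of_inH hu huH (by omega)) (isC_of_inH hm hmH (by omega))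
    (isC_of_inH (D.h (bold m)).continuous
      (nonlocal_inH D.assumptionH hκ hm (fun x => (hpos x).le) hmH) (by omega)) hpos

lemma tendsto_sqrt_hsum {a : ℝ} {s : ℕ} {e : ℕ → (Fin d → ℤ) → ℂ}
    (h : Tendsto (fun n => hsum s (e n)) atTop (𝓝 0)) :
    Tendsto (fun n => a * √(hsum s (e n))) atTop (𝓝 0) := by
  simpa using (h.sqrt).const_mul a

variable (D) in
lemma exists_weak_solution : ∃ (c : ℝ) (m u : Torus d → ℝ), 0 < c ∧ Continuous m ∧ Continuous u ∧
    InH (2 * D.p) (four m) ∧ InH (2 * D.p) (four u) ∧ (∀ x, c ≤ m x) ∧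
    ∀ k, D.weak₁ m u k = 0 ∧ D.weak₂ m u k = 0 := by
  obtain ⟨A, c, mn, un, hc, sm, su, hcm, hA, hA', hw⟩ := D.exists_approx
  have hord := D.order
  -- One derivative is given up for compactness; H^{2p-1} still embeds in C² and is still admissible
  -- in assumption (h).
  obtain ⟨s, hs⟩ : ∃ s, 2 * D.p = s + 1 := ⟨2 * D.p - 1, by omega⟩
  rw [hs] at hA hA' ⊢
  have sη : ∀ n, IsSmooth fun x => mn n x - 1 := fun n => (sm n).sub (isSmooth_const 1)
  obtain ⟨σ₁, η, hσ₁, cη, Hη, limη⟩ := exists_subseq (s := s) (by omega)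
    (fun n => (sη n).continuous) (fun n => (sη n).inH _) hA
  obtain ⟨σ₂, u, hσ₂, cu, Hu, limu⟩ := exists_subseq (s := s) (by omega)
    (fun n => (su (σ₁ n)).continuous) (fun n => (su (σ₁ n)).inH _) fun n => hA' (σ₁ n)
  have limη' := limη.comp hσ₂.tendsto_atTop
  let m : Torus d → ℝ := fun x => η x + 1
  let σ : ℕ → ℕ := fun n => σ₁ (σ₂ n)
  have hσ : StrictMono σ := hσ₁.comp hσ₂
  have cm : Continuous m := cη.add continuous_const
  have Hm : InH (s + 1) (four m) := inH_add_one cη Hη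
  have hdiff : ∀ n, (fun x => mn (σ n) x - m x) = fun x => mn (σ n) x - 1 - η x := fun n =>
    funext fun x => by simp only [m]; ring
  have limm : Tendsto (fun n => hsum s (four fun x => mn (σ n) x - m x)) atTop (𝓝 0) := by
    simp only [hdiff]
    exact limη'
  have c2m : IsC (2 : ℕ) m := isC_of_inH cm Hm (by omega)
  have c2u : IsC (2 : ℕ) u := isC_of_inH cu Hu (by omega)
  have bm : ∀ n x, |mn (σ n) x - m x| ≤
      embConst₂ d s * √(hsum s (four fun x => mn (σ n) x - m x)) := fun n x => by
    have h1 : InH s (four fun x => mn (σ n) x - m x) := by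
      rw [show (four fun x => mn (σ n) x - m x) = fun k => four (mn (σ n)) k - four m k from
        funext fun k => four_sub (sm _).continuous.integrable_torus cm.integrable_torus k]
      exact ((sm _).inH s).sub (Hm.mono (Nat.le_succ s))
    exact (abs_le_of_inH (((sm (σ n)).isC_nat 2).sub c2m) (by omega) h1 x).1
  have bu : ∀ n x, |un (σ n) x - u x| ≤
        embConst₂ d s * √(hsum s (four fun x => un (σ n) x - u x)) ∧
      (∀ i, |pd i (un (σ n)) x - pd i u x| ≤
        embConst₂ d s * √(hsum s (four fun x => un (σ n) x - u x))) ∧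
      ∀ i j, |pd i (pd j (un (σ n))) x - pd i (pd j u) x| ≤
        embConst₂ d s * √(hsum s (four fun x => un (σ n) x - u x)) := fun n x => by
    have h1 : InH s (four fun x => un (σ n) x - u x) := by
      rw [show (four fun x => un (σ n) x - u x) = fun k => four (un (σ n)) k - four u k from
        funext fun k => four_sub (su _).continuous.integrable_torus cu.integrable_torus k]
      exact ((su _).inH s).sub (Hu.mono (Nat.le_succ s))
    have h2 := abs_le_of_inH (((su (σ n)).isC_nat 2).sub c2u) (by omega) h1 x
    have c1u : IsC (1 : ℕ) u := c2u.of_le (by norm_cast)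
    have p1 : ∀ i, pd i (fun x => un (σ n) x - u x) =
        fun x => pd i (un (σ n)) x - pd i u x := fun i =>
      IsC.pd_sub ((su (σ n)).isC_nat 1) c1u i
    have p2 : ∀ i j, pd i (fun x => pd j (un (σ n)) x - pd j u x) =
        fun x => pd i (pd j (un (σ n))) x - pd i (pd j u) x := fun i j =>
      IsC.pd_sub (((su (σ n)).pd j).isC_nat 1) (IsC.pd (n := (1 : ℕ)) (by exact_mod_cast c2u) j) i
    simp only [p1, p2] at h2
    exact h2
  have tm : Tendsto (fun n => embConst₂ d s * √(hsum s (four fun x => mn (σ n) x - m x))) atTop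
      (𝓝 0) := tendsto_sqrt_hsum limm
  have tu : Tendsto (fun n => embConst₂ d s * √(hsum s (four fun x => un (σ n) x - u x))) atTop
      (𝓝 0) := tendsto_sqrt_hsum limu
  have hmc : ∀ x, c ≤ m x := fun x => by
    have h1 : Tendsto (fun n => mn (σ n) x) atTop (𝓝 (m x)) := by
      rw [tendsto_iff_norm_sub_tendsto_zero]
      exact squeeze_zero (fun n => norm_nonneg _) (fun n => bm n x) tm
    exact ge_of_tendsto' h1 fun n => hcm _ x
  have hpos : ∀ x, 0 < m x := fun x => hc.trans_le (hmc x)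
  have hpn : ∀ n x, 0 < mn n x := fun n x => hc.trans_le (hcm n x)
  have hκ : (d : ℝ) / 2 + 1 < s := by
    have : ((d + 8 : ℕ) : ℝ) < ((2 * s : ℕ) : ℝ) := by
      have : d + 8 < 2 * s := by omega
      exact_mod_cast this
    push_cast at this
    linarith
  obtain ⟨δ, hδ, hδh⟩ := tendsto_nonlocal D.assumptionH hκ cm (fun x => (hpos x).le)
    (Hm.mono (Nat.le_succ s)) (fun n => (sm (σ n)).continuous) (fun n x => (hpn _ x).le)
    (fun n => (sm (σ n)).inH s) limm
  let ρ : ℕ → ℝ := fun n => embConst₂ d s * √(hsum s (four fun x => un (σ n) x - u x)) +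
    embConst₂ d s * √(hsum s (four fun x => mn (σ n) x - m x)) + |δ n|
  have tρ : Tendsto (fun n => (d + 1) * ρ n) atTop (𝓝 0) := by
    simpa using ((tu.add tm).add hδ.abs).const_mul ((d : ℝ) + 1)
  have hjet : ∀ n x, ‖D.jt (mn (σ n)) (un (σ n)) x - D.jt m u x‖ ≤ (d + 1) * ρ n := fun n x => by
    have n1 := mul_nonneg (embConst₂_nonneg d s)
      (Real.sqrt_nonneg (hsum s (four fun x => un (σ n) x - u x)))
    have n2 := mul_nonneg (embConst₂_nonneg d s)
      (Real.sqrt_nonneg (hsum s (four fun x => mn (σ n) x - m x)))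
    have n3 := abs_nonneg (δ n)
    refine norm_jet_sub_le (by positivity) (fun i => ?_) (fun i j => ?_) ?_ ?_
    · exact ((bu n x).2.1 i).trans (by simp only [ρ]; linarith)
    · exact ((bu n x).2.2 i j).trans (by simp only [ρ]; linarith)
    · exact (bm n x).trans (by simp only [ρ]; linarith)
    · exact (hδh n x).trans ((le_abs_self _).trans (by simp only [ρ]; linarith))
  obtain ⟨R, hR⟩ := exists_norm_jet_le (u := u) (m := m) (θ := D.h (bold m)) c2u cm
    (D.h (bold m)).continuous
  have key : ∀ {Ψ : Torus d → JetSpace d → ℝ}, IsNice Ψ → ∀ k,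
      Tendsto (fun n => four (fun x => Ψ x (D.jt (mn (σ n)) (un (σ n)) x)) k) atTop
        (𝓝 (four (fun x => Ψ x (D.jt m u x)) k)) := fun hΨ k =>
    tendsto_four_comp hΨ hc (fun n => hcm (σ n)) hmc hR tρ hjet
      (fun n => (isSmooth_comp hΨ (sm _) (su _) (hpn _)).continuous)
      (isC_comp_jt hΨ (n := 0) (by omega) cm cu Hm Hu hpos).continuous k
  have fu : ∀ k, Tendsto (fun n => four (un (σ n)) k) atTop (𝓝 (four u k)) := fun k =>
    tendsto_four_of_abs_sub_le (fun n => (su _).continuous) cu tu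
      (Eventually.of_forall fun n x => (bu n x).1) k
  have fm : ∀ k, Tendsto (fun n => four (mn (σ n)) k) atTop (𝓝 (four m k)) := fun k =>
    tendsto_four_of_abs_sub_le (fun n => (sm _).continuous) cm tm
      (Eventually.of_forall fun n x => bm n x) k
  have fm' : ∀ k, Tendsto (fun n => four (fun x => mn (σ n) x - 1) k) atTop
      (𝓝 (four (fun x => m x - 1) k)) := fun k =>
    tendsto_four_of_abs_sub_le (fun n => (sη _).continuous) (cm.sub continuous_const) tm
      (Eventually.of_forall fun n x => by simpa using bm n x) k
  refine ⟨c, m, u, hc, cm, cu, Hm, Hu, hmc, fun k => ?_⟩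
  -- The degree tends to infinity along the subsequence, so a fixed frequency is eventually among
  -- those tested.
  have hev : ∀ᶠ n in atTop, ∀ i, |k i| ≤ (σ n : ℕ) := by
    rw [eventually_all]
    intro i
    filter_upwards [hσ.tendsto_atTop.eventually_ge_atTop (k i).natAbs] with n hn
    rw [Int.abs_eq_natAbs]
    exact_mod_cast hn
  constructor
  · refine tendsto_nhds_unique (f := fun n => D.weak₁ (mn (σ n)) (un (σ n)) k) (l := atTop) ?_ ?_
    · exact ((fu k).neg.add ((fm k).const_mul _)).add (key D.isNice_nl₁ k)
    · refine tendsto_const_nhds.congr' ?_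
      filter_upwards [hev] with n hn
      exact (hw _ k hn).1.symm
  · refine tendsto_nhds_unique (f := fun n => D.weak₂ (mn (σ n)) (un (σ n)) k) (l := atTop) ?_ ?_
    · exact (((fm' k).add ((fu k).const_mul _)).sub
        (tendsto_finsetSum _ fun i _ => (key (D.isNice_flux i) k).const_mul _)).add
        (tendsto_finsetSum _ fun i _ => tendsto_finsetSum _ fun j _ =>
          ((key (D.isNice_flux₂ i j) k).const_mul _).const_mul _)
    · refine tendsto_const_nhds.congr' ?_
      filter_upwards [hev] with n hn
      exact (hw _ k hn).2.symm

end RegProblem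
end RegMFG
end

noncomputable section

namespace RegMFG

/-! ### Regularity of weak solutions -/

section

variable {d : ℕ}

lemma InH.symbol_mul {s : ℕ} {c : (Fin d → ℤ) → ℂ} (h : InH (s + 1) c) (i : Fin d) :
    InH s fun k => 2 * Real.pi * Complex.I * k i * c k :=
  h.of_le (C := 2 * Real.pi) fun k => by
    have h1 := mul_le_mul_of_nonneg_right (norm_symbol_le k i) (norm_nonneg (c k))
    have h2 := mul_le_mul_of_nonneg_left h1 (pow_nonneg (wt_pos k).le s)
    rw [norm_mul]
    refine h2.trans (le_of_eq ?_)
    ring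

end

namespace RegProblem

variable {d : ℕ} {D : RegProblem d}

lemma inH_of_lam_mul {s : ℕ} {c : (Fin d → ℤ) → ℂ} (h : InH s fun k => (D.lam k : ℂ) * c k) :
    InH (s + 4 * D.p) c :=
  h.of_le (C := D.lamConst) fun k => by
    have h1 := mul_le_mul_of_nonneg_right (D.wt_pow_le_lam k) (norm_nonneg (c k))
    have h2 := mul_le_mul_of_nonneg_left h1 (pow_nonneg (wt_pos k).le s)
    rw [norm_mul, Complex.norm_real, Real.norm_of_nonneg (D.lam_pos k).le, pow_add]
    refine (le_of_eq ?_).trans (h2.trans (le_of_eq ?_)) <;> ring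

/-- The equations express `lam` times the coefficients of m and u through lower-order terms, and
dividing by `lam` gains 4p derivatives. This exceeds the loss from the embedding and from the
derivatives in the jet and in the fluxes. -/
lemma inH_succ {m u : Torus d → ℝ} (cm : Continuous m) (cu : Continuous u) (hpos : ∀ x, 0 < m x)
    (hw : ∀ k, D.weak₁ m u k = 0 ∧ D.weak₂ m u k = 0) {s : ℕ} (hs : 2 * D.p ≤ s)
    (Hm : InH s (four m)) (Hu : InH s (four u)) :
    InH (s + 1) (four m) ∧ InH (s + 1) (four u) := by
  have hord := D.order
  -- With u and m in H^s the nonlinear terms are C^{n+2}, hence in H^{n+2}, and two derivatives of a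
  -- flux leave H^n. The order condition makes n a natural number and gives n + 4p ≥ s + 1.
  obtain ⟨n, hn⟩ : ∃ n, n + 2 = s - 3 - d / 2 := ⟨s - 3 - d / 2 - 2, by omega⟩
  have key : ∀ {Ψ : Torus d → JetSpace d → ℝ}, IsNice Ψ →
      InH (n + 1 + 1) (four fun x => Ψ x (D.jt m u x)) := fun hΨ =>
    (isC_comp_jt hΨ (n := n + 1 + 1) (by omega) cm cu Hm Hu hpos).inH
  have Hη : InH n (four fun x => m x - 1) := by
    rw [show (four fun x => m x - 1) = fun k => four m k - four (fun _ => 1) k from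
      funext fun k => four_sub cm.integrable_torus continuous_const.integrable_torus k]
    exact (Hm.mono (by omega)).sub ((isSmooth_const 1).inH n)
  constructor
  · have e : (fun k => (D.lam k : ℂ) * four m k) =
        fun k => four u k - four (fun x => D.nl₁ x (D.jt m u x)) k := funext fun k => by
      have := (hw k).1
      unfold weak₁ at this
      linear_combination this
    refine InH.mono (inH_of_lam_mul (D := D) (s := n) ?_) (by omega)
    rw [e]
    exact (Hu.mono (by omega)).sub ((key D.isNice_nl₁).mono (by omega))
  · have e : (fun k => (D.lam k : ℂ) * four u k) = fun k =>
        (∑ i, 2 * Real.pi * Complex.I * k i * four (fun x => D.flux i x (D.jt m u x)) k) -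
        (∑ i, ∑ j, 2 * Real.pi * Complex.I * k i * (2 * Real.pi * Complex.I * k j *
          four (fun x => D.flux₂ i j x (D.jt m u x)) k)) - four (fun x => m x - 1) k :=
      funext fun k => by
        have := (hw k).2
        unfold weak₂ at this
        linear_combination this
    refine InH.mono (inH_of_lam_mul (D := D) (s := n) ?_) (by omega)
    rw [e]
    exact ((InH.sum _ fun i _ =>
      ((key (D.isNice_flux i)).mono (Nat.le_succ _)).symbol_mul i).sub
      (InH.sum _ fun i _ => InH.sum _ fun j _ =>
        ((key (D.isNice_flux₂ i j)).symbol_mul j).symbol_mul i)).sub Hη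

variable (D) in
lemma exists_solution : ∃ m u : Torus d → ℝ, IsSmooth m ∧ IsSmooth u ∧ 0 < (⨅ x, m x) ∧
    SolvesRP D.h D.H D.p D.ε₁ D.ε₂ D.β m u := by
  obtain ⟨c, m, u, hc, cm, cu, Hm, Hu, hcm, hw⟩ := D.exists_weak_solution
  have hpos : ∀ x, 0 < m x := fun x => hc.trans_le (hcm x)
  have hH : ∀ s, 2 * D.p ≤ s → InH s (four m) ∧ InH s (four u) := fun s hs => by
    induction s, hs using Nat.le_induction with
    | base => exact ⟨Hm, Hu⟩
    | succ s hs ih => exact inH_succ cm cu hpos hw hs ih.1 ih.2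
  have sm : IsSmooth m := isSmooth_of_inH cm fun s hs => (hH s hs).1
  have su : IsSmooth u := isSmooth_of_inH cu fun s hs => (hH s hs).2
  have hz : ∀ k : Fin d → ℤ, four (fun _ : Torus d => (0 : ℝ)) k = 0 := fun k => by
    simpa using four_const_mul (fun _ : Torus d => (0 : ℝ)) 0 k
  -- For smooth (m,u) the weak expressions are the Fourier coefficients of the classical residuals,
  -- which therefore vanish at every point.
  have r1 : D.res₁ m u = fun _ => 0 :=
    eq_of_four_eq (isSmooth_res₁ sm su hpos).continuous continuous_const fun k => by
      rw [four_res₁ sm su hpos, (hw k).1, hz]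
  have r2 : D.res₂ m u = fun _ => 0 :=
    eq_of_four_eq (isSmooth_res₂ sm su hpos).continuous continuous_const fun k => by
      rw [four_res₂ sm su hpos, (hw k).2, hz]
  refine ⟨m, u, sm, su, hc.trans_le (le_ciInf hcm), fun x => ⟨?_, ?_⟩⟩
  · have := congrFun r1 x
    simp only [res₁, reg] at this
    linarith
  · have := congrFun r2 x
    simp only [res₂, reg] at this
    linarith

end RegProblem
end RegMFG
end
-- The stated theorem as an instance of `RegProblem`
theorem proposition3p1 (d : ℕ) (hd : 0 < d) (E : Set ℝ)
    (hE : E = Set.Ioi 0 ∨ E = Set.Ici 0)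
    (h : RegMFG.Mac d → C(RegMFG.Torus d, ℝ))
    (g : RegMFG.Torus d → ℝ → ℝ → ℝ)
    (H : RegMFG.Hamiltonian d)
    (hh : RegMFG.AssumptionH h)
    (hg : RegMFG.AssumptionG E h g)
    (hH1 : RegMFG.AssumptionH1 E h g H)
    (hH2 : RegMFG.AssumptionH2 E H)
    (hH3 : RegMFG.AssumptionH3 E h H)
    (p : ℕ) (hp : (d : ℝ) / 2 + 1 < 2 * (p : ℝ) - 4)
    (q : ℝ) (hq : (d : ℝ) < q)
    (ε₁ ε₂ : ℝ) (hε₁ : ε₁ ∈ Set.Ioo (0 : ℝ) 1) (hε₂ : ε₂ ∈ Set.Ioo (0 : ℝ) 1)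
    (β : ℝ → ℝ) (hβ : RegMFG.IsPenalization ε₁ q β) :
    ∃ m u : RegMFG.Torus d → ℝ,
      RegMFG.IsSmooth m ∧ RegMFG.IsSmooth u ∧ 0 < (⨅ x, m x) ∧
      RegMFG.SolvesRP h H p ε₁ ε₂ β m u := by
  -- For either choice of `E`, smoothness and monotonicity restrict to positive densities, which
  -- form the open domain used throughout.
  have hpos : Set.Ioi 0 ⊆ E := by
    rcases hE with rfl | rfl
    · exact subset_rfl
    · exact Set.Ioi_subset_Ici_self
  have hord : d + 10 < 4 * p := by
    have : ((d + 10 : ℕ) : ℝ) < ((4 * p : ℕ) : ℝ) := by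
      push_cast
      linarith
    exact_mod_cast this
  exact RegMFG.RegProblem.exists_solution
    { h := h, H := H, p := p, q := q, ε₁ := ε₁, ε₂ := ε₂, β := β
      assumptionH := hh
      nice := RegMFG.isNice_hamiltonian hpos hH2
      monotone := fun η v η' v' hη hv hη' hv' hx hx' =>
        hH3 η v η' v' hη hv hη' hv' (fun x => hpos (hx x)) fun x => hpos (hx' x)
      order := hord
      lt_q := hq
      ε₁_pos := hε₁.1
      ε₁_lt := hε₁.2
      ε₂_pos := hε₂.1
      penalization := hβ }
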